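/- Let $n\ge 2$, let $\mathbb{B}=\{x\in\mathbb{R}^n:|x|<1\}$ be the open Euclidean unit ball with Lebesgue measure $dx$, and let Berwald's metric be \[ \mathsf{B}(x,y)=\frac{\left(\sqrt{(1-|x|^2)|y|^2+\langle x,y\rangle^2}+\langle x,y\rangle\right)^2}{(1-|x|^2)^2\sqrt{(1-|x|^2)|y|^2+\langle x,y\rangle^2}},\qquad x\in\mathbb{B},\ y\in\mathbb{R}^n\setminus\{0\},\qquad \mathsf{B}(x,0)=0. \] Definitions. A Minkowski norm on a finite-dimensional real vector space $V$ is a function $\phi:V\to[0,\infty)$ that vanishes only at $0$, satisfies $\phi(\lambda y)=\lambda\phi(y)$ for $\lambda>0$, is smooth on $V\setminus\{0\}$, and for which the Hessian of $\phi^2$ is positive definite at every $y\ne0$; then $(V,\phi)$ is called a Minkowski space. A Finsler metric on a domain $U\subset\mathbb{R}^n$ is a function $F(x,y)$, smooth on $U\times(\mathbb{R}^n\setminus\{0\})$, such that each $F(x,\cdot)$ is a Minkowski norm. Put $g_{ij}=\frac12\partial^2F^2/\partial y^i\partial y^j$, $g_y=(g_{ij}(x,y))$, and (summing over repeated indices)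 \[ G^i=\tfrac14g^{il}\left(2\frac{\partial g_{jl}}{\partial x^k}-\frac{\partial g_{jk}}{\partial x^l}\right)y^jy^k,\qquad R^i_{\,k}=2\frac{\partial G^i}{\partial x^k}-y^j\frac{\partial^2G^i}{\partial x^j\partial y^k}+2G^j\frac{\partial^2G^i}{\partial y^j\partial y^k}-\frac{\partial G^i}{\partial y^j}\frac{\partial G^j}{\partial y^k}. \] Geodesics are the smooth curves with $\ddot\gamma^i+2G^i(\gamma,\dot\gamma)=0$; $(U,F)$ is forward complete if every geodesic on $[0,1)$ extends to a geodesic on $[0,\infty)$. With $R_y(v)=(R^i_{\,k}(x,y)v^k)_i$, the flag curvature is $\mathbf K(y,v)=g_y(R_y(v),v)/\big(g_y(y,y)g_y(v,v)-g_y(y,v)^2\big)$ for linearly independent $y,v$. A Cartan--Hadamard manifold is a simply connected, forward complete Finsler manifold with $\mathbf K\le0$; it is flat if $\mathbf K\equiv0$. The reversibility of $F$ is $\sup_{x\in U}\sup_{y\neq0}F(x,-y)/F(x,y)$. The distance $d_F(a,b)$ is the infimum of $\int_0^1F(\zeta,\dot\zeta)\,dt$ over Lipschitz paths $\zeta:[0,1]\to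 U$ from $a$ to $b$. The co-metric is $F^*(x,\eta)=\sup_{y\ne0}\eta(y)/F(x,y)$, and the gradient $\nabla f(x)$ is the vector whose image under the Legendre transformation $y\mapsto g_y(y,\cdot)$ (with $0\mapsto0$) is $df(x)$. An isometric embedding of $(U,F)$ into $(V,\phi)$ is a $C^1$ embedding $f:U\to V$ with $\phi(df_x(y))=F(x,y)$ for all $x\in U$, $y\in\mathbb{R}^n$. The space $W^{1,p}_0(U,F,dx)$ consists of all (classes of almost everywhere equal) functions $u$ on $U$ with a locally integrable weak differential $du$ for which there are $u_k\in C_0^\infty(U)$ with \[ \left(\int_U|u-u_k|^p\,dx\right)^{1/p}+\left(\int_UF^{*}(x,du-du_k)^p\,dx\right)^{1/p}\longrightarrow0 . \] Theorem. $(\mathbb{B},\mathsf{B})$ is a flat Cartan--Hadamard manifold, and, with $r(x)=d_{\mathsf B}(0,x)$ and $p'=p/(p-1)$: (i) the reversibility of $\mathsf B$ is $+\infty$, and $(\mathbb{B},\mathsf{B})$ admits no isometric embedding into any Minkowski space; (ii) for every $p\in(1,\infty)$, $W^{1,p}_0(\mathbb{B},\mathsf{B},dx)$ is not a vector space, i.e.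 it is not a linear subspace of the space of (classes of) measurable functions on $\mathbb{B}$; (iii) for every $p\in(1,n)$, the numerator below is finite and the denominator is finite and positive for each $f$, and \[ \inf_{f\in C_0^\infty(\mathbb{B})\setminus\{0\}}\frac{\int_{\mathbb B}\mathsf B(x,\nabla f)^p\,dx}{\int_{\mathbb B}|f|^p\,r^{-p}\,dx}=0; \] (iv) for all real $p,s$ with $-p+1<s\le1<p<n$, the integrals below are finite and the denominator is positive for each $f$, and \[ \inf_{f\in C_0^\infty(\mathbb{B})\setminus\{0\}}\frac{\left(\int_{\mathbb B}\mathsf B(x,\nabla f)^p\,dx\right)^{1/p}\left(\int_{\mathbb B}|f|^p\,r^{p's}\,dx\right)^{1/p'}}{\int_{\mathbb B}|f|^p\,r^{s-1}\,dx}=0. \] -/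

import Mathlib

open MeasureTheory Filter Topology
open scoped ENNReal ContDiff

noncomputable section

namespace Finsler

/-! ### Minkowski norms -/

section Minkowski

variable {V : Type*} [NormedAddCommGroup V] [NormedSpace ℝ V]

/-- The bilinear form `½ D²(φ²)(y)`, whose coefficients are `½ ∂²(φ²)/∂yⁱ∂yʲ (y)`. -/
def fundTensor (φ : V → ℝ) (y : V) : V →L[ℝ] V →L[ℝ] ℝ :=
  (1 / 2 : ℝ) • fderiv ℝ (fderiv ℝ (fun w => φ w ^ 2)) y

/-- A Minkowski norm on a (finite-dimensional) real vector space; it need not be symmetric.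
The norm of `V` only serves as a carrier of the canonical topology. -/
structure IsMinkowskiNorm (φ : V → ℝ) : Prop where
  nonneg : ∀ y, 0 ≤ φ y
  eq_zero_iff : ∀ y, φ y = 0 ↔ y = 0
  pos_homogeneous : ∀ (c : ℝ) (y : V), 0 < c → φ (c • y) = c * φ y
  smooth : ContDiffOn ℝ ∞ φ {0}ᶜ
  posDef : ∀ y, y ≠ 0 → ∀ v, v ≠ 0 → 0 < fundTensor φ y v v

end Minkowski

/-! ### Finsler metrics on domains of `ℝⁿ`, in the global Cartesian chart

`F x y` is the value of the metric at the tangent vector `y` at the point `x`. -/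

/-- Euclidean `n`-space. -/
abbrev Eu (n : ℕ) := EuclideanSpace ℝ (Fin n)

variable {n : ℕ}

/-- A Finsler manifold whose underlying manifold is a domain `U` of `ℝⁿ`. -/
structure IsFinslerManifold (U : Set (Eu n)) (F : Eu n → Eu n → ℝ) : Prop where
  isOpen : IsOpen U
  isConnected : IsConnected U
  smooth : ContDiffOn ℝ ∞ (fun z : Eu n × Eu n => F z.1 z.2) (U ×ˢ {0}ᶜ)
  minkowski : ∀ x ∈ U, IsMinkowskiNorm (F x)

/-- The reversibility `sup_x sup_{y ≠ 0} F(x,-y) / F(x,y)`, with values in `[0,∞]`. -/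
def reversibility (U : Set (Eu n)) (F : Eu n → Eu n → ℝ) : ℝ≥0∞ :=
  ⨆ (x ∈ U) (y : Eu n) (_ : y ≠ 0), ENNReal.ofReal (F x (-y) / F x y)

/-- The `i`-th partial derivative of `f` at `x`. -/
def pd (i : Fin n) (f : Eu n → ℝ) (x : Eu n) : ℝ :=
  fderiv ℝ f x (EuclideanSpace.single i 1)

/-- The matrix `g_{ij}(x,y)` of the fundamental tensor. -/
def gMatrix (F : Eu n → Eu n → ℝ) (x y : Eu n) : Matrix (Fin n) (Fin n) ℝ :=
  Matrix.of fun i j =>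
    fundTensor (F x) y (EuclideanSpace.single i 1) (EuclideanSpace.single j 1)

/-- The geodesic coefficients
`Gⁱ = ¼ gⁱˡ (2 ∂g_{jl}/∂xᵏ - ∂g_{jk}/∂xˡ) yʲ yᵏ`. -/
def geodesicCoeff (F : Eu n → Eu n → ℝ) (x y : Eu n) (i : Fin n) : ℝ :=
  (1 / 4 : ℝ) * ∑ l, ∑ j, ∑ k, (gMatrix F x y)⁻¹ i l *
    (2 * pd k (fun z => gMatrix F z y j l) x - pd l (fun z => gMatrix F z y j k) x) * y j * y k

/-- `γ` is a (constant-speed) geodesic of `(U, F)` on the interval `s`; at an end point of `s`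
that belongs to `s` the derivatives are one-sided. -/
structure IsGeodesicOn (U : Set (Eu n)) (F : Eu n → Eu n → ℝ) (γ : ℝ → Eu n) (s : Set ℝ) :
    Prop where
  mapsTo : Set.MapsTo γ s U
  smooth : ContDiffOn ℝ ∞ γ s
  equation : ∀ t ∈ s, ∀ i,
    derivWithin (derivWithin γ s) s t i + 2 * geodesicCoeff F (γ t) (derivWithin γ s t) i = 0

/-- Every geodesic on `[0,1)` extends to a geodesic on `[0,∞)`. -/
def ForwardComplete (U : Set (Eu n)) (F : Eu n → Eu n → ℝ) : Prop :=
  ∀ γ : ℝ → Eu n, IsGeodesicOn U F γ (Set.Ico 0 1) →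
    ∃ γ' : ℝ → Eu n, IsGeodesicOn U F γ' (Set.Ici 0) ∧ Set.EqOn γ γ' (Set.Ico 0 1)

/-- The coefficients `Rⁱ_k(x,y)` of the Riemannian curvature. -/
def riemannCoeff (F : Eu n → Eu n → ℝ) (x y : Eu n) (i k : Fin n) : ℝ :=
  2 * pd k (fun z => geodesicCoeff F z y i) x
    - ∑ j, y j * pd j (fun z => pd k (fun w => geodesicCoeff F z w i) y) x
    + 2 * ∑ j, geodesicCoeff F x y j *
        pd j (fun w => pd k (fun w' => geodesicCoeff F x w' i) w) y
    - ∑ j, pd j (fun w => geodesicCoeff F x w i) y * pd k (fun w => geodesicCoeff F x w j) y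

/-- The linear transformation `R_y` of the tangent space at `x`, applied to `v`. -/
def riemannMap (F : Eu n → Eu n → ℝ) (x y v : Eu n) : Eu n :=
  WithLp.toLp 2 fun i => ∑ k, riemannCoeff F x y i k * v k

/-- The flag curvature `K(y, v)` at `x`, for linearly independent `y` and `v`. -/
def flagCurvature (F : Eu n → Eu n → ℝ) (x y v : Eu n) : ℝ :=
  fundTensor (F x) y (riemannMap F x y v) v /
    (fundTensor (F x) y y y * fundTensor (F x) y v v - fundTensor (F x) y y v ^ 2)

/-- A simply connected, forward complete Finsler manifold of non-positive flag curvature. -/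
structure IsCartanHadamard (U : Set (Eu n)) (F : Eu n → Eu n → ℝ) : Prop where
  finsler : IsFinslerManifold U F
  simplyConnected : SimplyConnectedSpace U
  forwardComplete : ForwardComplete U F
  flagCurvature_nonpos : ∀ x ∈ U, ∀ y v, LinearIndependent ℝ ![y, v] → flagCurvature F x y v ≤ 0

/-- The flag curvature vanishes identically. -/
def IsFlat (U : Set (Eu n)) (F : Eu n → Eu n → ℝ) : Prop :=
  ∀ x ∈ U, ∀ y v, LinearIndependent ℝ ![y, v] → flagCurvature F x y v = 0

/-- An isometric embedding of `(U, F)` into the Minkowski space `(V, φ)`: an embedding of class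
`C¹` (in particular, any smooth one) that pulls `φ` back to `F`. The differential is automatically
injective when `F` is a Finsler metric. -/
structure IsIsometricEmbedding {V : Type*} [NormedAddCommGroup V] [NormedSpace ℝ V]
    (U : Set (Eu n)) (F : Eu n → Eu n → ℝ) (φ : V → ℝ) (f : Eu n → V) : Prop where
  contDiff : ContDiffOn ℝ 1 f U
  isEmbedding : IsEmbedding (fun x : U => f x)
  isometric : ∀ x ∈ U, ∀ y, φ (fderiv ℝ f x y) = F x y

/-! ### Distance, co-metric, gradient -/

/-- The distance `d_F(a,b)`: the infimum of the lengths `∫₀¹ F(ζ, ζ') dt` of the Lipschitz paths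
`ζ : [0,1] → U` from `a` to `b`. -/
def edist (U : Set (Eu n)) (F : Eu n → Eu n → ℝ) (a b : Eu n) : ℝ≥0∞ :=
  ⨅ (ζ : ℝ → Eu n) (_ : (∃ K, LipschitzOnWith K ζ (Set.Icc 0 1)) ∧
      Set.MapsTo ζ (Set.Icc 0 1) U ∧ ζ 0 = a ∧ ζ 1 = b),
    ∫⁻ t in Set.Icc (0 : ℝ) 1, ENNReal.ofReal (F (ζ t) (deriv ζ t))

/-- The co-metric `F*(x,η) = sup_{y ≠ 0} η(y) / F(x,y)`. The supremum is non-negative, so that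
negative quotients may be replaced by `0`. -/
def coMetric (F : Eu n → Eu n → ℝ) (x : Eu n) (η : Eu n →L[ℝ] ℝ) : ℝ≥0∞ :=
  ⨆ (y : Eu n) (_ : y ≠ 0), ENNReal.ofReal (η y / F x y)

/-- The Legendre transformation `y ↦ g_y(y, ·)` at `x`; it sends `0` to `0`. -/
def legendre (F : Eu n → Eu n → ℝ) (x y : Eu n) : Eu n →L[ℝ] ℝ :=
  fundTensor (F x) y y

/-- The Finsler gradient: the preimage of `df` under the Legendre transformation. -/
def gradient (F : Eu n → Eu n → ℝ) (f : Eu n → ℝ) (x : Eu n) : Eu n :=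
  Function.invFun (legendre F x) (fderiv ℝ f x)

/-! ### Function spaces over a domain with Lebesgue measure -/

/-- `f ∈ C₀^∞(U)`. -/
structure IsTestFunction (U : Set (Eu n)) (f : Eu n → ℝ) : Prop where
  smooth : ContDiff ℝ ∞ f
  hasCompactSupport : HasCompactSupport f
  tsupport_subset : tsupport f ⊆ U

/-- The locally integrable one-form `ξ` is the weak differential of `u` in `U`. -/
structure HasWeakDifferential (U : Set (Eu n)) (u : Eu n → ℝ) (ξ : Eu n → Eu n →L[ℝ] ℝ) :
    Prop where
  locallyIntegrable : LocallyIntegrableOn u U volume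
  locallyIntegrable_differential : LocallyIntegrableOn ξ U volume
  integral_eq : ∀ φ, IsTestFunction U φ → ∀ v,
    ∫ x in U, u x * fderiv ℝ φ x v = -∫ x in U, ξ x v * φ x

/-- The pseudo-norm `(∫ |u|^p)^{1/p} + (∫ F*(ξ)^p)^{1/p}` of a function `u` with differential `ξ`. -/
def sobolevNorm (U : Set (Eu n)) (F : Eu n → Eu n → ℝ) (p : ℝ)
    (u : Eu n → ℝ) (ξ : Eu n → Eu n →L[ℝ] ℝ) : ℝ≥0∞ :=
  (∫⁻ x in U, ‖u x‖ₑ ^ p) ^ (1 / p) + (∫⁻ x in U, coMetric F x (ξ x) ^ p) ^ (1 / p)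

/-- The Sobolev space `W₀^{1,p}(U, F, 𝓛ⁿ)`, a set of almost-everywhere classes of functions: the
closure of `C₀^∞(U)` in the sense that `‖u - u_k‖ → 0` for some test functions `u_k`. -/
def sobolevSpace (U : Set (Eu n)) (F : Eu n → Eu n → ℝ) (p : ℝ) :
    Set (Eu n →ₘ[volume.restrict U] ℝ) :=
  {u | ∃ ξ, HasWeakDifferential U u ξ ∧
    ∃ u_ : ℕ → Eu n → ℝ, (∀ k, IsTestFunction U (u_ k)) ∧
      Tendsto (fun k => sobolevNorm U F p (fun x => u x - u_ k x)
        (fun x => ξ x - fderiv ℝ (u_ k) x)) atTop (𝓝 0)}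

/-- The energy `∫_U F^p(∇f) dx`. -/
def energy (U : Set (Eu n)) (F : Eu n → Eu n → ℝ) (p : ℝ) (f : Eu n → ℝ) : ℝ≥0∞ :=
  ∫⁻ x in U, ENNReal.ofReal (F x (gradient F f x)) ^ p

/-- The weighted integral `∫_U |f|^p d_F(0,x)^q dx`. -/
def weighted (U : Set (Eu n)) (F : Eu n → Eu n → ℝ) (p q : ℝ) (f : Eu n → ℝ) : ℝ≥0∞ :=
  ∫⁻ x in U, ‖f x‖ₑ ^ p * edist U F 0 x ^ q

/-! ### Berwald's metric -/

/-- The open Euclidean unit ball. -/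
abbrev unitBall (n : ℕ) : Set (Eu n) := Metric.ball 0 1

/-- Berwald's metric on the unit ball (at `y = 0` the quotient `0 / 0` has the value `0`). -/
def berwald (n : ℕ) (x y : Eu n) : ℝ :=
  (√((1 - ‖x‖ ^ 2) * ‖y‖ ^ 2 + inner ℝ x y ^ 2) + inner ℝ x y) ^ 2 /
    ((1 - ‖x‖ ^ 2) ^ 2 * √((1 - ‖x‖ ^ 2) * ‖y‖ ^ 2 + inner ℝ x y ^ 2))

end Finsler

end

/-!
The Funk metric `Θ` of the ball assigns to `(x, y)` the reciprocal of the time at which the ray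
`x + ty` leaves the ball. It solves Okada's equation `∂Θ/∂xᵏ = Θ ∂Θ/∂yᵏ`, and
`∂B/∂xᵏ = ∂(ΘB)/∂yᵏ` for Berwald's metric `B`. Hence the geodesic coefficients are `Gⁱ = Θ yⁱ`:
the geodesics are line segments, and Okada's equation makes the curvature vanish. Along a geodesic
`Θ' = -Θ²`, so that with `k = Θ(γ(0), γ'(0))` the curve `(1 + kt) γ(t)` is affine, and every
geodesic `γ(t) = γ(0) + t / (1 + kt) γ'(0)` exists for all positive times.

All the failures come from one asymmetry: near the sphere, moving outwards is expensive, as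
`⟨x, y⟩ ≤ (1 - |x|²)² B(x, y)`, while moving inwards has bounded cost. This gives the infinite
reversibility, which a Minkowski space does not allow. A function that increases outwards has small
energy near the sphere: negative cut-off functions with a transition in a thin shell at the sphere
have energy tending to zero, whereas the weighted integrals stay bounded above and below, so the
quotients tend to zero. Likewise `-(1 - |x|²) ^ (1 - 1 / p)` is a limit of test functions, but its
negative has infinite energy near the sphere.
-/

noncomputable section

namespace Finsler

/-! ### Positively homogeneous functions -/

section Homogeneity

variable {V : Type*} [NormedAddCommGroup V] [NormedSpace ℝ V] {φ : V → ℝ} {y : V}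

/-- Positive homogeneity of degree one, the only homogeneity a non-symmetric norm has. -/
def PosHomogeneous (φ : V → ℝ) : Prop :=
  ∀ (c : ℝ) (y : V), 0 < c → φ (c • y) = c * φ y

lemma eventually_one_add_pos : ∀ᶠ t : ℝ in 𝓝 0, 0 < 1 + t :=
  (continuous_const.add continuous_id).continuousAt.eventually (lt_mem_nhds (by norm_num))

namespace PosHomogeneous

lemma fderiv_smul (h : PosHomogeneous φ) {c : ℝ} (hc : 0 < c) (y : V) :
    fderiv ℝ φ (c • y) = fderiv ℝ φ y := by
  have hcomp : (fun w => φ (c • w)) = c • φ := funext fun w => h c w hc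
  have hfd := fderiv_comp_smul (𝕜 := ℝ) (f := φ) (x := y) c
  rw [hcomp, fderiv_const_smul_field] at hfd
  exact (smul_right_injective _ hc.ne' hfd).symm

lemma fderiv_self (h : PosHomogeneous φ) (hφ : DifferentiableAt ℝ φ y) :
    fderiv ℝ φ y y = φ y := by
  refine (hφ.hasFDerivAt.hasLineDerivAt y).unique ?_
  have hlin : HasDerivAt (fun t : ℝ => (1 + t) * φ y) (φ y) 0 := by
    simpa using ((hasDerivAt_id (0 : ℝ)).const_add 1).mul_const (φ y)
  refine hlin.congr_of_eventuallyEq ?_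
  filter_upwards [eventually_one_add_pos] with t ht
  rw [← h _ y ht, add_smul, one_smul]

lemma fderiv_fderiv_self (h : PosHomogeneous φ) (hφ : DifferentiableAt ℝ (fderiv ℝ φ) y) :
    fderiv ℝ (fderiv ℝ φ) y y = 0 := by
  refine (hφ.hasFDerivAt.hasLineDerivAt y).unique ?_
  refine (hasDerivAt_const (0 : ℝ) (fderiv ℝ φ y)).congr_of_eventuallyEq ?_
  filter_upwards [eventually_one_add_pos] with t ht
  rw [← h.fderiv_smul ht y, add_smul, one_smul]

end PosHomogeneous

lemma differentiableAt_fderiv (hφ : ContDiffAt ℝ 2 φ y) : DifferentiableAt ℝ (fderiv ℝ φ) y :=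
  (hφ.fderiv_right (m := 1) (by norm_num)).differentiableAt (by norm_num)

lemma fderiv_fderiv_symm (hφ : ContDiffAt ℝ 2 φ y) (v w : V) :
    fderiv ℝ (fderiv ℝ φ) y v w = fderiv ℝ (fderiv ℝ φ) y w v :=
  (hφ.isSymmSndFDerivAt (by simp)).eq v w

lemma PosHomogeneous.fderiv_fderiv_apply_self (h : PosHomogeneous φ) (hφ : ContDiffAt ℝ 2 φ y)
    (v : V) : fderiv ℝ (fderiv ℝ φ) y v y = 0 := by
  rw [fderiv_fderiv_symm hφ, h.fderiv_fderiv_self (differentiableAt_fderiv hφ)]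
  rfl

lemma fundTensor_apply (hφ : ContDiffAt ℝ 2 φ y) (v w : V) :
    fundTensor φ y v w =
      fderiv ℝ φ y v * fderiv ℝ φ y w + φ y * fderiv ℝ (fderiv ℝ φ) y v w := by
  have hsq : fderiv ℝ (fun w => φ w ^ 2) =ᶠ[𝓝 y] fun w => (2 * φ w) • fderiv ℝ φ w := by
    filter_upwards [hφ.eventually (by simp)] with w hw
    simpa using ((hw.differentiableAt (by norm_num)).hasFDerivAt.pow 2).fderiv
  have hsnd : HasFDerivAt (fun w => (2 * φ w) • fderiv ℝ φ w) _ y :=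
    ((hφ.differentiableAt (by norm_num)).hasFDerivAt.const_mul 2).smul
      (differentiableAt_fderiv hφ).hasFDerivAt
  rw [fundTensor, hsq.fderiv_eq, hsnd.fderiv]
  simp only [smul_apply, add_apply, ContinuousLinearMap.smulRight_apply, smul_eq_mul]
  ring

lemma fundTensor_symm (hφ : ContDiffAt ℝ 2 φ y) (v w : V) :
    fundTensor φ y v w = fundTensor φ y w v := by
  rw [fundTensor_apply hφ, fundTensor_apply hφ, fderiv_fderiv_symm hφ]
  ring

namespace PosHomogeneous

lemma fundTensor_self (h : PosHomogeneous φ) (hφ : ContDiffAt ℝ 2 φ y) (v : V) :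
    fundTensor φ y y v = φ y * fderiv ℝ φ y v := by
  rw [fundTensor_apply hφ, h.fderiv_self (hφ.differentiableAt (by norm_num)),
    h.fderiv_fderiv_self (differentiableAt_fderiv hφ), zero_apply, mul_zero, add_zero]

lemma fundTensor_self_self (h : PosHomogeneous φ) (hφ : ContDiffAt ℝ 2 φ y) :
    fundTensor φ y y y = φ y ^ 2 := by
  rw [h.fundTensor_self hφ, h.fderiv_self (hφ.differentiableAt (by norm_num)), sq]

/-- By homogeneity, it suffices to check convexity transversally to `y`. -/
lemma fundTensor_pos (h : PosHomogeneous φ) (hφ : ContDiffAt ℝ 2 φ y) (hy : 0 < φ y)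
    {ℓ : V →L[ℝ] ℝ} (hℓ : ℓ y ≠ 0)
    (hconv : ∀ v, v ≠ 0 → ℓ v = 0 → 0 < fderiv ℝ (fderiv ℝ φ) y v v) {v : V} (hv : v ≠ 0) :
    0 < fundTensor φ y v v := by
  obtain ⟨s, w, hw, rfl⟩ : ∃ (s : ℝ) (w : V), ℓ w = 0 ∧ v = w + s • y :=
    ⟨ℓ v / ℓ y, v - (ℓ v / ℓ y) • y, by simp [hℓ], by abel⟩
  rcases eq_or_ne w 0 with rfl | hw0
  · have hs : s ≠ 0 := by rintro rfl; simp at hv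
    simp only [zero_add, map_smul, smul_apply, smul_eq_mul, h.fundTensor_self_self hφ, ← mul_assoc]
    exact mul_pos (mul_self_pos.2 hs) (pow_pos hy 2)
  · have hD : fderiv ℝ (fderiv ℝ φ) y (w + s • y) (w + s • y) = fderiv ℝ (fderiv ℝ φ) y w w := by
      simp [h.fderiv_fderiv_self (differentiableAt_fderiv hφ), h.fderiv_fderiv_apply_self hφ]
    rw [fundTensor_apply hφ, hD]
    exact add_pos_of_nonneg_of_pos (mul_self_nonneg _) (mul_pos hy (hconv w hw0 hw))

end PosHomogeneous

end Homogeneity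

section MixedPartials

variable {E E' : Type*} [NormedAddCommGroup E] [NormedSpace ℝ E] [NormedAddCommGroup E']
  [NormedSpace ℝ E'] {f : E → E' → ℝ} {x : E} {y : E'}

lemma fderiv_left_eq (hf : DifferentiableAt ℝ (fun p : E × E' => f p.1 p.2) (x, y)) (u : E) :
    fderiv ℝ (fun z => f z y) x u = fderiv ℝ (fun p : E × E' => f p.1 p.2) (x, y) (u, 0) := by
  have hd : HasFDerivAt (fun z => f z y) _ x :=
    hf.hasFDerivAt.comp (f := fun z => (z, y)) x (hasFDerivAt_prodMk_left x y)
  simp [hd.fderiv]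

lemma fderiv_right_eq (hf : DifferentiableAt ℝ (fun p : E × E' => f p.1 p.2) (x, y)) (v : E') :
    fderiv ℝ (f x) y v = fderiv ℝ (fun p : E × E' => f p.1 p.2) (x, y) (0, v) := by
  have hd : HasFDerivAt (f x) _ y := hf.hasFDerivAt.comp y (hasFDerivAt_prodMk_right x y)
  simp [hd.fderiv]

lemma hasFDerivAt_fderiv_right (hf : ContDiffAt ℝ 2 (fun p : E × E' => f p.1 p.2) (x, y))
    (v : E') :
    HasFDerivAt (fun p : E × E' => fderiv ℝ (f p.1) p.2 v)
      ((fderiv ℝ (fderiv ℝ fun p : E × E' => f p.1 p.2) (x, y)).flip (0, v)) (x, y) := by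
  refine ((differentiableAt_fderiv hf).hasFDerivAt.clm_apply
    (hasFDerivAt_const ((0, v) : E × E') (x, y))).congr_of_eventuallyEq ?_ |>.congr_fderiv ?_
  · filter_upwards [hf.eventually (by simp)] with p hp
    exact fderiv_right_eq (hp.differentiableAt (by norm_num)) v
  · ext <;> simp

lemma contDiffAt_fderiv_right (hf : ContDiffAt ℝ ∞ (fun p : E × E' => f p.1 p.2) (x, y)) :
    ContDiffAt ℝ ∞ (fun p : E × E' => fderiv ℝ (f p.1) p.2) (x, y) := by
  refine ContDiffAt.fderiv (m := ∞) (n := ∞) (x₀ := (x, y))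
    (f := fun (p : E × E') w => f p.1 w) (g := fun p => p.2) ?_ contDiffAt_snd (by simp)
  exact hf.comp (f := fun q : (E × E') × E' => (q.1.1, q.2)) ((x, y), y) (by fun_prop)

lemma fderiv_left_fderiv_right_comm (hf : ContDiffAt ℝ 2 (fun p : E × E' => f p.1 p.2) (x, y))
    (u : E) (v : E') :
    fderiv ℝ (fun z => fderiv ℝ (f z) y v) x u =
      fderiv ℝ (fun w => fderiv ℝ (fun z => f z w) x u) y v := by
  have hleft : (fun w => fderiv ℝ (fun z => f z w) x u) =ᶠ[𝓝 y]
      fun w => fderiv ℝ (fun p : E × E' => f p.1 p.2) (x, w) (u, 0) := by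
    have hcont : ContinuousAt (fun w : E' => (x, w)) y := by fun_prop
    filter_upwards [hcont.eventually (hf.eventually (by simp))] with w hw
    exact fderiv_left_eq (hw.differentiableAt (by norm_num)) u
  have hx : HasFDerivAt (fun z => fderiv ℝ (f z) y v) _ x :=
    (hasFDerivAt_fderiv_right hf v).comp (f := fun z => (z, y)) x (hasFDerivAt_prodMk_left x y)
  have hy : HasFDerivAt (fun w => fderiv ℝ (fun p : E × E' => f p.1 p.2) (x, w) (u, 0)) _ y :=
    ((differentiableAt_fderiv hf).hasFDerivAt.comp y (hasFDerivAt_prodMk_right x y)).clm_apply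
      (hasFDerivAt_const _ y)
  rw [hleft.fderiv_eq, hx.fderiv, hy.fderiv]
  simpa using fderiv_fderiv_symm hf (u, 0) (0, v)

end MixedPartials

/-! ### Projectively flat Finsler metrics -/

variable {n : ℕ}

section Coordinates

variable {W : Type*} [NormedAddCommGroup W] [NormedSpace ℝ W]

lemma sum_smul_apply_single (L : Eu n →L[ℝ] W) (y : Eu n) :
    ∑ j, y j • L (EuclideanSpace.single j 1) = L y := by
  conv_rhs => rw [← (EuclideanSpace.basisFun (Fin n) ℝ).sum_repr y]
  simp

lemma sum_mul_pd (f : Eu n → ℝ) (x y : Eu n) : ∑ j, y j * pd j f x = fderiv ℝ f x y :=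
  sum_smul_apply_single (fderiv ℝ f x) y

lemma sum_sum_smul_apply_single (L : Eu n →L[ℝ] Eu n →L[ℝ] W) (v w : Eu n) :
    ∑ j, ∑ k, (v j * w k) • L (EuclideanSpace.single j 1) (EuclideanSpace.single k 1) = L v w := by
  rw [← sum_smul_apply_single L v, sum_apply]
  refine Finset.sum_congr rfl fun j _ => ?_
  rw [smul_apply, ← sum_smul_apply_single (L _) w, Finset.smul_sum]
  simp only [mul_smul]

lemma hasFDerivAt_coord (i : Fin n) (y : Eu n) :
    HasFDerivAt (fun w : Eu n => w i) (EuclideanSpace.proj (𝕜 := ℝ) i) y :=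
  (EuclideanSpace.proj (𝕜 := ℝ) i : Eu n →L[ℝ] ℝ).hasFDerivAt

end Coordinates

section FinslerMetric

variable {U : Set (Eu n)} {F : Eu n → Eu n → ℝ} {x y : Eu n}

lemma IsMinkowskiNorm.posHomogeneous {V : Type*} [NormedAddCommGroup V] [NormedSpace ℝ V]
    {φ : V → ℝ} (hφ : IsMinkowskiNorm φ) : PosHomogeneous φ :=
  hφ.pos_homogeneous

namespace IsFinslerManifold

lemma contDiffAt (hF : IsFinslerManifold U F) (hx : x ∈ U) (hy : y ≠ 0) :
    ContDiffAt ℝ ∞ (fun z : Eu n × Eu n => F z.1 z.2) (x, y) :=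
  hF.smooth.contDiffAt ((hF.isOpen.prod isOpen_compl_singleton).mem_nhds ⟨hx, hy⟩)

lemma contDiffAt_left (hF : IsFinslerManifold U F) (hx : x ∈ U) (hy : y ≠ 0) :
    ContDiffAt ℝ ∞ (fun z => F z y) x :=
  ContDiffAt.comp (f := fun z => (z, y)) x (hF.contDiffAt hx hy) (by fun_prop)

lemma contDiffAt_right (hF : IsFinslerManifold U F) (hx : x ∈ U) (hy : y ≠ 0) :
    ContDiffAt ℝ 2 (F x) y :=
  ContDiffAt.comp (f := fun w => (x, w)) y ((hF.contDiffAt hx hy).of_le (by norm_cast))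
    (by fun_prop)

lemma differentiableAt_fundTensor (hF : IsFinslerManifold U F) (hx : x ∈ U) (hy : y ≠ 0) :
    DifferentiableAt ℝ (fun z => fundTensor (F z) y) x := by
  have hD := contDiffAt_fderiv_right (f := fun z w => F z w ^ 2) ((hF.contDiffAt hx hy).pow 2)
  have hDD : ContDiffAt ℝ ∞ (fun z => fderiv ℝ (fderiv ℝ (fun w => F z w ^ 2)) y) x :=
    ContDiffAt.fderiv (m := ∞) (n := ∞) (f := fun z => fderiv ℝ (fun w => F z w ^ 2))
      (g := fun _ => y) hD contDiffAt_const (by simp)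
  exact (hDD.const_smul (1 / 2 : ℝ)).differentiableAt (by simp)

lemma hasFDerivAt_fundTensor_apply (hF : IsFinslerManifold U F) (hx : x ∈ U) (hy : y ≠ 0)
    (v w : Eu n) :
    HasFDerivAt (fun z => fundTensor (F z) y v w)
      (((fderiv ℝ (fun z => fundTensor (F z) y) x).flip v).flip w) x := by
  refine (((hF.differentiableAt_fundTensor hx hy).hasFDerivAt.clm_apply
    (hasFDerivAt_const v x)).clm_apply (hasFDerivAt_const w x)).congr_fderiv ?_
  ext; simp

lemma pd_gMatrix (hF : IsFinslerManifold U F) (hx : x ∈ U) (hy : y ≠ 0) (i j k : Fin n) :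
    pd k (fun z => gMatrix F z y i j) x =
      fderiv ℝ (fun z => fundTensor (F z) y) x (EuclideanSpace.single k 1)
        (EuclideanSpace.single i 1) (EuclideanSpace.single j 1) :=
  congrArg (· (EuclideanSpace.single k 1)) (hF.hasFDerivAt_fundTensor_apply hx hy _ _).fderiv

lemma sum_pd_gMatrix (hF : IsFinslerManifold U F) (hx : x ∈ U) (hy : y ≠ 0) (l : Fin n) :
    ∑ j, ∑ k, (2 * pd k (fun z => gMatrix F z y j l) x - pd l (fun z => gMatrix F z y j k) x) *
        y j * y k =
      2 * fderiv ℝ (fun z => fundTensor (F z) y) x y y (EuclideanSpace.single l 1) -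
        fderiv ℝ (fun z => fundTensor (F z) y) x (EuclideanSpace.single l 1) y y := by
  set T := fderiv ℝ (fun z => fundTensor (F z) y) x
  set e : Fin n → Eu n := fun i => EuclideanSpace.single i 1
  calc _ = ∑ j, ∑ k, (2 * (y j * y k) * T (e k) (e j) (e l) -
        y j * y k * T (e l) (e j) (e k)) := by
        simp only [hF.pd_gMatrix hx hy]
        exact Finset.sum_congr rfl fun _ _ => Finset.sum_congr rfl fun _ _ => by ring
    _ = 2 * ∑ j, ∑ k, (y j * y k) • T.flip (e j) (e k) (e l) -
        ∑ j, ∑ k, (y j * y k) • T (e l) (e j) (e k) := by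
        simp only [Finset.sum_sub_distrib, Finset.mul_sum, mul_assoc, smul_eq_mul,
          ContinuousLinearMap.flip_apply]
    _ = _ := by
        have hT := congrArg (· (e l)) (sum_sum_smul_apply_single T.flip y y)
        simp only [sum_apply, smul_apply, ContinuousLinearMap.flip_apply] at hT
        simp only [ContinuousLinearMap.flip_apply]
        rw [sum_sum_smul_apply_single, hT]

lemma fderiv_fundTensor_self_self (hF : IsFinslerManifold U F) (hx : x ∈ U) (hy : y ≠ 0)
    (u : Eu n) :
    fderiv ℝ (fun z => fundTensor (F z) y) x u y y =
      2 * F x y * fderiv ℝ (fun z => F z y) x u := by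
  have hd : HasFDerivAt (fun z => F z y ^ 2) _ x :=
    ((hF.contDiffAt_left hx hy).differentiableAt (by simp)).hasFDerivAt.pow 2
  have heq : (fun z => fundTensor (F z) y y y) =ᶠ[𝓝 x] fun z => F z y ^ 2 := by
    filter_upwards [hF.isOpen.mem_nhds hx] with z hz
    exact (hF.minkowski z hz).posHomogeneous.fundTensor_self_self (hF.contDiffAt_right hz hy)
  have := congrArg (· u)
    ((hF.hasFDerivAt_fundTensor_apply hx hy y y).unique (hd.congr_of_eventuallyEq heq))
  simpa using this

lemma fderiv_fundTensor_self (hF : IsFinslerManifold U F) (hx : x ∈ U) (hy : y ≠ 0)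
    (u v : Eu n) :
    fderiv ℝ (fun z => fundTensor (F z) y) x u y v =
      fderiv ℝ (fun z => F z y) x u * fderiv ℝ (F x) y v +
        F x y * fderiv ℝ (fun z => fderiv ℝ (F z) y v) x u := by
  have hmixed : DifferentiableAt ℝ (fun z => fderiv ℝ (F z) y v) x :=
    (hasFDerivAt_fderiv_right ((hF.contDiffAt hx hy).of_le (by norm_cast)) v).comp
      (f := fun z => (z, y)) x (hasFDerivAt_prodMk_left x y) |>.differentiableAt
  have hd : HasFDerivAt (fun z => F z y * fderiv ℝ (F z) y v) _ x :=
    ((hF.contDiffAt_left hx hy).differentiableAt (by simp)).hasFDerivAt.mul hmixed.hasFDerivAt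
  have heq : (fun z => fundTensor (F z) y y v) =ᶠ[𝓝 x] fun z => F z y * fderiv ℝ (F z) y v := by
    filter_upwards [hF.isOpen.mem_nhds hx] with z hz
    exact (hF.minkowski z hz).posHomogeneous.fundTensor_self (hF.contDiffAt_right hz hy) v
  have := congrArg (· u)
    ((hF.hasFDerivAt_fundTensor_apply hx hy y v).unique (hd.congr_of_eventuallyEq heq))
  simp only [ContinuousLinearMap.flip_apply, add_apply, smul_apply, smul_eq_mul] at this
  rw [this]
  ring

lemma gMatrix_mulVec (hF : IsFinslerManifold U F) (hx : x ∈ U) (hy : y ≠ 0) (v : Eu n) :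
    (gMatrix F x y).mulVec v = fun l => fundTensor (F x) y v (EuclideanSpace.single l 1) := by
  funext l
  rw [fundTensor_symm (hF.contDiffAt_right hx hy), ← sum_smul_apply_single _ v]
  simp only [Matrix.mulVec, dotProduct, gMatrix, Matrix.of_apply, smul_eq_mul, mul_comm]

lemma isUnit_det_gMatrix (hF : IsFinslerManifold U F) (hx : x ∈ U) (hy : y ≠ 0) :
    IsUnit (gMatrix F x y).det := by
  rw [isUnit_iff_ne_zero]
  intro hdet
  obtain ⟨v, hv, hgv⟩ := Matrix.exists_mulVec_eq_zero_iff.2 hdet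
  have hv' : WithLp.toLp 2 v ≠ (0 : Eu n) := (WithLp.toLp_eq_zero 2).not.2 hv
  have hzero : fundTensor (F x) y (WithLp.toLp 2 v) = 0 := by
    ext w
    rw [← sum_smul_apply_single _ w]
    have h := hF.gMatrix_mulVec hx hy (WithLp.toLp 2 v)
    rw [show (gMatrix F x y).mulVec (WithLp.toLp 2 v : Eu n) = 0 from hgv] at h
    exact Finset.sum_eq_zero fun l _ => by rw [← congrFun h l]; simp
  have hpos := (hF.minkowski x hx).posDef y hy _ hv'
  rw [hzero] at hpos
  exact hpos.ne rfl

/-- Hamel's criterion: straight lines are geodesics, up to parametrization. -/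
theorem geodesicCoeff_eq_of_hamel (hF : IsFinslerManifold U F) (hx : x ∈ U) (hy : y ≠ 0) {P : ℝ}
    (hP : fderiv ℝ (fun z => F z y) x y = 2 * P * F x y)
    (hamel : ∀ v, fderiv ℝ (fun z => fderiv ℝ (F z) y v) x y = fderiv ℝ (fun z => F z y) x v)
    (i : Fin n) : geodesicCoeff F x y i = P * y i := by
  have hsum : ∀ l, ∑ j, ∑ k, (2 * pd k (fun z => gMatrix F z y j l) x -
      pd l (fun z => gMatrix F z y j k) x) * y j * y k =
        4 * P * (gMatrix F x y).mulVec y l := by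
    intro l
    rw [hF.sum_pd_gMatrix hx hy, hF.fderiv_fundTensor_self hx hy,
      hF.fderiv_fundTensor_self_self hx hy, hP, hamel, congrFun (hF.gMatrix_mulVec hx hy y) l,
      (hF.minkowski x hx).posHomogeneous.fundTensor_self (hF.contDiffAt_right hx hy)]
    ring
  have hinv : (gMatrix F x y)⁻¹.mulVec ((gMatrix F x y).mulVec y) i = y i := by
    rw [Matrix.mulVec_mulVec, Matrix.nonsing_inv_mul _ (hF.isUnit_det_gMatrix hx hy),
      Matrix.one_mulVec]
  calc geodesicCoeff F x y i
      = 1 / 4 * ∑ l, (gMatrix F x y)⁻¹ i l * ∑ j, ∑ k,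
          (2 * pd k (fun z => gMatrix F z y j l) x - pd l (fun z => gMatrix F z y j k) x) *
            y j * y k := by
        simp only [geodesicCoeff, Finset.mul_sum, mul_assoc]
    _ = P * (gMatrix F x y)⁻¹.mulVec ((gMatrix F x y).mulVec y) i := by
        rw [Matrix.mulVec, dotProduct, Finset.mul_sum, Finset.mul_sum]
        exact Finset.sum_congr rfl fun l _ => by rw [hsum]; ring
    _ = P * y i := by rw [hinv]

/-- If `D_xF = D_y(PF)`, then Hamel's equations reduce to Euler's relations, because `PF` is
homogeneous of degree two. -/
theorem geodesicCoeff_eq_of_fderiv_left (hF : IsFinslerManifold U F) (hx : x ∈ U) {P : Eu n → ℝ}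
    (hP : PosHomogeneous P) (hPsmooth : ContDiffOn ℝ 2 P {0}ᶜ)
    (hleft : ∀ y, y ≠ 0 → ∀ v, fderiv ℝ (fun z => F z y) x v =
      P y * fderiv ℝ (F x) y v + F x y * fderiv ℝ P y v)
    (y : Eu n) (i : Fin n) : geodesicCoeff F x y i = P y * y i := by
  rcases eq_or_ne y 0 with rfl | hy
  · simp [geodesicCoeff]
  have hFhom := (hF.minkowski x hx).posHomogeneous
  have hF2 := hF.contDiffAt_right hx hy
  have hP2 : ContDiffAt ℝ 2 P y := hPsmooth.contDiffAt (isOpen_compl_singleton.mem_nhds hy)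
  have hFd := hF2.differentiableAt (by norm_num)
  have hPd := hP2.differentiableAt (by norm_num)
  refine hF.geodesicCoeff_eq_of_hamel hx hy ?_ (fun v => ?_) i
  · rw [hleft y hy, hFhom.fderiv_self hFd, hP.fderiv_self hPd]
    ring
  · have hev : (fun w => fderiv ℝ (fun z => F z w) x y) =ᶠ[𝓝 y]
        fun w => P w * fderiv ℝ (F x) w y + F x w * fderiv ℝ P w y := by
      filter_upwards [isOpen_compl_singleton.mem_nhds hy] with w hw using hleft w hw y
    have hd : HasFDerivAt (fun w => P w * fderiv ℝ (F x) w y + F x w * fderiv ℝ P w y) _ y :=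
      (hPd.hasFDerivAt.mul ((differentiableAt_fderiv hF2).hasFDerivAt.clm_apply
        (hasFDerivAt_const y y))).add (hFd.hasFDerivAt.mul
          ((differentiableAt_fderiv hP2).hasFDerivAt.clm_apply (hasFDerivAt_const y y)))
    rw [fderiv_left_fderiv_right_comm ((hF.contDiffAt hx hy).of_le (by norm_cast)), hev.fderiv_eq,
      hd.fderiv, hleft y hy]
    simp [hFhom.fderiv_self hFd, hP.fderiv_self hPd, hFhom.fderiv_fderiv_apply_self hF2,
      hP.fderiv_fderiv_apply_self hP2]
    ring

end IsFinslerManifold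

section Okada

variable {P : Eu n → Eu n → ℝ}

lemma pd_mul_coord {f : Eu n → ℝ} (hf : DifferentiableAt ℝ f y) (i k : Fin n) :
    pd k (fun w => f w * w i) y = pd k f y * y i + f y * EuclideanSpace.single k (1 : ℝ) i := by
  have hd : HasFDerivAt (fun w => f w * w i) _ y := hf.hasFDerivAt.mul (hasFDerivAt_coord i y)
  rw [pd, hd.fderiv, pd]
  simp only [add_apply, smul_apply, smul_eq_mul, PiLp.proj_apply]
  ring

/-- Okada's equation `∂P/∂xᵏ = P ∂P/∂yᵏ` for a positively homogeneous function `P` on the tangent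
bundle of `U`. The sprays `Gⁱ = P yⁱ` with such a projective factor `P` have no curvature. -/
structure SolvesOkada (U : Set (Eu n)) (P : Eu n → Eu n → ℝ) : Prop where
  isOpen : IsOpen U
  smooth : ContDiffOn ℝ 2 (fun z : Eu n × Eu n => P z.1 z.2) (U ×ˢ {0}ᶜ)
  posHomogeneous : ∀ x ∈ U, PosHomogeneous (P x)
  equation : ∀ x ∈ U, ∀ y, y ≠ 0 → ∀ v,
    fderiv ℝ (fun z => P z y) x v = P x y * fderiv ℝ (P x) y v

namespace SolvesOkada

lemma contDiffAt (hP : SolvesOkada U P) (hx : x ∈ U) (hy : y ≠ 0) :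
    ContDiffAt ℝ 2 (fun z : Eu n × Eu n => P z.1 z.2) (x, y) :=
  hP.smooth.contDiffAt ((hP.isOpen.prod isOpen_compl_singleton).mem_nhds ⟨hx, hy⟩)

lemma contDiffAt_right (hP : SolvesOkada U P) (hx : x ∈ U) (hy : y ≠ 0) :
    ContDiffAt ℝ 2 (P x) y :=
  ContDiffAt.comp (f := fun w => (x, w)) y (hP.contDiffAt hx hy) (by fun_prop)

lemma differentiableAt_left (hP : SolvesOkada U P) (hx : x ∈ U) (hy : y ≠ 0) :
    DifferentiableAt ℝ (fun z => P z y) x :=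
  DifferentiableAt.comp (f := fun z => (z, y)) x
    ((hP.contDiffAt hx hy).differentiableAt (by norm_num)) (by fun_prop)

lemma differentiableAt_right (hP : SolvesOkada U P) (hx : x ∈ U) (hy : y ≠ 0) :
    DifferentiableAt ℝ (P x) y :=
  (hP.contDiffAt_right hx hy).differentiableAt (by norm_num)

lemma fderiv_right_self (hP : SolvesOkada U P) (hx : x ∈ U) (hy : y ≠ 0) :
    fderiv ℝ (P x) y y = P x y :=
  (hP.posHomogeneous x hx).fderiv_self (hP.differentiableAt_right hx hy)

lemma fderiv_left_fderiv_right (hP : SolvesOkada U P) (hx : x ∈ U) (hy : y ≠ 0) (v : Eu n) :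
    fderiv ℝ (fun z => fderiv ℝ (P z) y v) x y = P x y * fderiv ℝ (P x) y v := by
  have hC := hP.contDiffAt_right hx hy
  have heq : (fun w => fderiv ℝ (fun z => P z w) x y) =ᶠ[𝓝 y]
      fun w => P x w * fderiv ℝ (P x) w y := by
    filter_upwards [isOpen_ne.mem_nhds hy] with w hw using hP.equation x hx w hw y
  have hd : HasFDerivAt (fun w => P x w * fderiv ℝ (P x) w y) _ y :=
    (hP.differentiableAt_right hx hy).hasFDerivAt.mul
      ((differentiableAt_fderiv hC).hasFDerivAt.clm_apply (hasFDerivAt_const y y))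
  rw [fderiv_left_fderiv_right_comm (hP.contDiffAt hx hy), heq.fderiv_eq, hd.fderiv]
  simp [(hP.posHomogeneous x hx).fderiv_fderiv_apply_self hC, hP.fderiv_right_self hx hy]

lemma pd_spray (hP : SolvesOkada U P) (hx : x ∈ U) (hy : y ≠ 0) (i k : Fin n) :
    pd k (fun w => P x w * w i) y =
      pd k (P x) y * y i + P x y * EuclideanSpace.single k (1 : ℝ) i :=
  pd_mul_coord (hP.differentiableAt_right hx hy) i k

lemma fderiv_left_pd_spray (hP : SolvesOkada U P) (hx : x ∈ U) (hy : y ≠ 0) (i k : Fin n) :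
    fderiv ℝ (fun z => pd k (P z) y * y i + P z y * EuclideanSpace.single k (1 : ℝ) i) x y =
      P x y * pd k (P x) y * y i + P x y ^ 2 * EuclideanSpace.single k (1 : ℝ) i := by
  have hpd : DifferentiableAt ℝ (fun z => pd k (P z) y) x :=
    (hasFDerivAt_fderiv_right (hP.contDiffAt hx hy) _).comp (f := fun z => (z, y)) x
      (hasFDerivAt_prodMk_left x y) |>.differentiableAt
  have hd : HasFDerivAt
      (fun z => pd k (P z) y * y i + P z y * EuclideanSpace.single k (1 : ℝ) i) _ x :=
    (hpd.hasFDerivAt.mul_const _).add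
      ((hP.differentiableAt_left hx hy).hasFDerivAt.mul_const _)
  rw [hd.fderiv]
  simp only [add_apply, smul_apply, smul_eq_mul, pd, hP.fderiv_left_fderiv_right hx hy,
    hP.equation x hx y hy, hP.fderiv_right_self hx hy]
  ring

lemma fderiv_right_pd_spray (hP : SolvesOkada U P) (hx : x ∈ U) (hy : y ≠ 0) (i k : Fin n) :
    fderiv ℝ (fun w => pd k (P x) w * w i + P x w * EuclideanSpace.single k (1 : ℝ) i) y y =
      pd k (P x) y * y i + P x y * EuclideanSpace.single k (1 : ℝ) i := by
  have hC := differentiableAt_fderiv (hP.contDiffAt_right hx hy)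
  have hd : HasFDerivAt
      (fun w => pd k (P x) w * w i + P x w * EuclideanSpace.single k (1 : ℝ) i) _ y :=
    ((hC.hasFDerivAt.clm_apply (hasFDerivAt_const _ y)).mul (hasFDerivAt_coord i y)).add
      ((hP.differentiableAt_right hx hy).hasFDerivAt.mul_const _)
  rw [hd.fderiv]
  simp only [pd, add_apply, smul_apply, smul_eq_mul, ContinuousLinearMap.comp_apply, zero_apply,
    ContinuousLinearMap.flip_apply, map_zero, (hP.posHomogeneous x hx).fderiv_fderiv_self hC,
    hP.fderiv_right_self hx hy, PiLp.proj_apply]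
  ring

lemma sum_pd_spray_mul_pd_spray (hP : SolvesOkada U P) (hx : x ∈ U) (hy : y ≠ 0)
    (i k : Fin n) :
    ∑ j, pd j (fun w => P x w * w i) y * pd k (fun w => P x w * w j) y =
      3 * P x y * pd k (P x) y * y i + P x y ^ 2 * EuclideanSpace.single k (1 : ℝ) i := by
  set e : Eu n := EuclideanSpace.single k 1
  have hterm : ∀ j, pd j (fun w => P x w * w i) y * pd k (fun w => P x w * w j) y =
      (pd k (P x) y • y + P x y • e) j * pd j (fun w => P x w * w i) y := by
    intro j
    rw [hP.pd_spray hx hy j k, mul_comm]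
    rfl
  have hd : HasFDerivAt (fun w => P x w * w i) _ y :=
    (hP.differentiableAt_right hx hy).hasFDerivAt.mul (hasFDerivAt_coord i y)
  simp only [hterm, sum_mul_pd, hd.fderiv, map_add, map_smul, add_apply, smul_apply, smul_eq_mul,
    hP.fderiv_right_self hx hy, PiLp.proj_apply]
  rw [← pd]
  ring

theorem riemannCoeff_eq_zero (hP : SolvesOkada U P)
    (hG : ∀ x ∈ U, ∀ y i, geodesicCoeff F x y i = P x y * y i) (hx : x ∈ U) (hy : y ≠ 0)
    (i k : Fin n) : riemannCoeff F x y i k = 0 := by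
  have hG' : ∀ z ∈ U, ∀ j, (fun w => geodesicCoeff F z w j) = fun w => P z w * w j :=
    fun z hz j => funext fun w => hG z hz w j
  have hU : ∀ᶠ z in 𝓝 x, z ∈ U := hP.isOpen.mem_nhds hx
  have base : pd k (fun z => geodesicCoeff F z y i) x = P x y * pd k (P x) y * y i := by
    have heq : (fun z => geodesicCoeff F z y i) =ᶠ[𝓝 x] fun z => P z y * y i :=
      hU.mono fun z hz => hG z hz y i
    rw [pd, heq.fderiv_eq, fderiv_mul_const (hP.differentiableAt_left hx hy), smul_apply,
      hP.equation x hx y hy, smul_eq_mul, pd]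
    ring
  have mixed : ∑ j, y j * pd j (fun z => pd k (fun w => geodesicCoeff F z w i) y) x =
      P x y * pd k (P x) y * y i + P x y ^ 2 * EuclideanSpace.single k (1 : ℝ) i := by
    rw [sum_mul_pd, ← hP.fderiv_left_pd_spray hx hy]
    refine congrArg (fun L : Eu n →L[ℝ] ℝ => L y)
      (EventuallyEq.fderiv_eq (hU.mono fun z hz => ?_))
    simp only [hG' z hz, hP.pd_spray hz hy]
  have fiber : ∑ j, geodesicCoeff F x y j *
      pd j (fun w => pd k (fun w' => geodesicCoeff F x w' i) w) y =
        P x y * (pd k (P x) y * y i + P x y * EuclideanSpace.single k (1 : ℝ) i) := by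
    simp only [hG x hx, mul_assoc]
    rw [← Finset.mul_sum, sum_mul_pd, ← hP.fderiv_right_pd_spray hx hy]
    refine congrArg (fun L : Eu n →L[ℝ] ℝ => P x y * L y) (EventuallyEq.fderiv_eq ?_)
    filter_upwards [isOpen_ne.mem_nhds hy] with w hw using hP.pd_spray hx hw i k
  rw [riemannCoeff, base, mixed, fiber]
  simp only [hG' x hx, hP.sum_pd_spray_mul_pd_spray hx hy]
  ring

lemma flagCurvature_eq_zero (hP : SolvesOkada U P)
    (hG : ∀ x ∈ U, ∀ y i, geodesicCoeff F x y i = P x y * y i) (hx : x ∈ U) (hy : y ≠ 0)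
    (v : Eu n) : flagCurvature F x y v = 0 := by
  have hR : riemannMap F x y v = 0 := by
    ext i
    simp [riemannMap, hP.riemannCoeff_eq_zero hG hx hy]
  simp [flagCurvature, hR]

end SolvesOkada

end Okada

end FinslerMetric

/-! ### The Funk metric and Berwald's metric -/

/-- The quadratic form under the square root in Berwald's metric. -/
def disc (x y : Eu n) : ℝ := (1 - ‖x‖ ^ 2) * ‖y‖ ^ 2 + inner ℝ x y ^ 2

/-- The Funk metric `Θ` of the unit ball. -/
def funk (x y : Eu n) : ℝ := (√(disc x y) + inner ℝ x y) / (1 - ‖x‖ ^ 2)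

/-- The point `u` where the ray from `x` in the direction `y` leaves the unit ball. -/
def exitPoint (x y : Eu n) : Eu n := x + (funk x y)⁻¹ • y

/-- The quantity `q = 1 - ⟨x, u⟩`, for which Berwald's metric is `Θ / q`. -/
def exitGap (x y : Eu n) : ℝ := 1 - inner ℝ x (exitPoint x y)

section Algebra

variable {x y : Eu n}

lemma one_sub_norm_sq_pos (hx : ‖x‖ < 1) : 0 < 1 - ‖x‖ ^ 2 := by
  nlinarith [norm_nonneg x]

lemma disc_pos (hx : ‖x‖ < 1) (hy : y ≠ 0) : 0 < disc x y := by
  unfold disc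
  exact add_pos_of_pos_of_nonneg
    (mul_pos (one_sub_norm_sq_pos hx) (pow_pos (norm_pos_iff.2 hy) 2)) (sq_nonneg _)

lemma disc_smul (x y : Eu n) (t : ℝ) : disc x (t • y) = t ^ 2 * disc x y := by
  simp only [disc, norm_smul, inner_smul_right, mul_pow, Real.norm_eq_abs, sq_abs]
  ring

lemma sqrt_disc_smul (x y : Eu n) {t : ℝ} (ht : 0 ≤ t) :
    √(disc x (t • y)) = t * √(disc x y) := by
  rw [disc_smul, Real.sqrt_mul (sq_nonneg t), Real.sqrt_sq ht]

lemma abs_inner_lt_sqrt_disc (hx : ‖x‖ < 1) (hy : y ≠ 0) :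
    |(inner ℝ x y : ℝ)| < √(disc x y) := by
  refine Real.lt_sqrt_of_sq_lt ?_
  rw [sq_abs, disc]
  exact lt_add_of_pos_left _
    (mul_pos (one_sub_norm_sq_pos hx) (pow_pos (norm_pos_iff.2 hy) 2))

lemma funk_pos (hx : ‖x‖ < 1) (hy : y ≠ 0) : 0 < funk x y :=
  div_pos (by linarith [(abs_lt.1 (abs_inner_lt_sqrt_disc hx hy)).1]) (one_sub_norm_sq_pos hx)

@[simp] lemma funk_zero_right (x : Eu n) : funk x 0 = 0 := by simp [funk, disc]

lemma funk_nonneg (hx : ‖x‖ < 1) (y : Eu n) : 0 ≤ funk x y := by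
  rcases eq_or_ne y 0 with rfl | hy
  · simp
  · exact (funk_pos hx hy).le

lemma funk_smul (x y : Eu n) {t : ℝ} (ht : 0 ≤ t) : funk x (t • y) = t * funk x y := by
  rw [funk, sqrt_disc_smul x y ht, inner_smul_right, ← mul_add, mul_div_assoc, funk]

lemma sqrt_disc_eq (hx : ‖x‖ < 1) (y : Eu n) :
    √(disc x y) = (1 - ‖x‖ ^ 2) * funk x y - inner ℝ x y := by
  rw [funk, mul_div_cancel₀ _ (one_sub_norm_sq_pos hx).ne', add_sub_cancel_right]

/-- This equation characterizes `Θ`: it says that `x + y / Θ` lies on the unit sphere. -/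
lemma norm_funk_smul_add (hx : ‖x‖ < 1) (y : Eu n) : ‖funk x y • x + y‖ = funk x y := by
  have hc := one_sub_norm_sq_pos hx
  have hD : 0 ≤ disc x y := by unfold disc; positivity
  have hsq := Real.sq_sqrt hD
  rw [sqrt_disc_eq hx, disc] at hsq
  refine (sq_eq_sq₀ (norm_nonneg _) (funk_nonneg hx y)).1 (mul_left_cancel₀ hc.ne' ?_)
  rw [norm_add_sq_real, norm_smul, inner_smul_left, mul_pow, Real.norm_eq_abs, sq_abs,
    RCLike.conj_to_real]
  linear_combination -hsq

lemma smul_exitPoint_sub (hx : ‖x‖ < 1) (hy : y ≠ 0) : funk x y • (exitPoint x y - x) = y := by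
  rw [exitPoint, add_sub_cancel_left, smul_inv_smul₀ (funk_pos hx hy).ne']

lemma norm_exitPoint (hx : ‖x‖ < 1) (hy : y ≠ 0) : ‖exitPoint x y‖ = 1 := by
  have hΘ := funk_pos hx hy
  have h := norm_funk_smul_add hx y
  nth_rewrite 2 [← smul_exitPoint_sub hx hy] at h
  rw [← smul_add, add_sub_cancel, norm_smul, Real.norm_of_nonneg hΘ.le] at h
  exact mul_left_cancel₀ hΘ.ne' (h.trans (mul_one _).symm)

lemma exitGap_pos (hx : ‖x‖ < 1) (hy : y ≠ 0) : 0 < exitGap x y := by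
  have h := real_inner_le_norm x (exitPoint x y)
  rw [norm_exitPoint hx hy] at h
  unfold exitGap
  linarith

lemma inner_exitPoint (x y : Eu n) : inner ℝ x (exitPoint x y) = 1 - exitGap x y := by
  rw [exitGap, sub_sub_cancel]

lemma norm_exitPoint_sub_sq (hx : ‖x‖ < 1) (hy : y ≠ 0) :
    ‖exitPoint x y - x‖ ^ 2 = 2 * exitGap x y - (1 - ‖x‖ ^ 2) := by
  rw [norm_sub_sq_real, norm_exitPoint hx hy, real_inner_comm, inner_exitPoint]
  ring

lemma norm_exitPoint_sub_sq_pos (hx : ‖x‖ < 1) (hy : y ≠ 0) : 0 < ‖exitPoint x y - x‖ ^ 2 := by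
  have hne : exitPoint x y ≠ x := fun h => hx.ne (h ▸ norm_exitPoint hx hy)
  exact pow_pos (norm_pos_iff.2 (sub_ne_zero.2 hne)) 2

lemma inner_eq_funk_mul (hx : ‖x‖ < 1) (hy : y ≠ 0) (v : Eu n) :
    inner ℝ v y = funk x y * (inner ℝ v (exitPoint x y) - inner ℝ v x) := by
  conv_lhs => rw [← smul_exitPoint_sub hx hy]
  rw [inner_smul_right, inner_sub_right]

lemma inner_self_left (hx : ‖x‖ < 1) (hy : y ≠ 0) :
    inner ℝ x y = funk x y * (1 - ‖x‖ ^ 2 - exitGap x y) := by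
  rw [inner_eq_funk_mul hx hy, real_inner_self_eq_norm_sq, inner_exitPoint]
  ring

lemma inner_exitPoint_self (hx : ‖x‖ < 1) (hy : y ≠ 0) :
    inner ℝ (exitPoint x y) y = funk x y * exitGap x y := by
  rw [inner_eq_funk_mul hx hy, real_inner_self_eq_norm_sq, norm_exitPoint hx hy, exitGap,
    real_inner_comm, one_pow]

lemma berwald_eq_disc (x y : Eu n) :
    berwald n x y = (√(disc x y) + inner ℝ x y) ^ 2 / ((1 - ‖x‖ ^ 2) ^ 2 * √(disc x y)) := rfl

lemma berwald_eq (hx : ‖x‖ < 1) (hy : y ≠ 0) : berwald n x y = funk x y / exitGap x y := by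
  have hΘ := funk_pos hx hy
  have hc := one_sub_norm_sq_pos hx
  have hq := exitGap_pos hx hy
  have hsqrt : √(disc x y) = funk x y * exitGap x y := by
    rw [sqrt_disc_eq hx, inner_self_left hx hy]
    ring
  have hsum : √(disc x y) + inner ℝ x y = (1 - ‖x‖ ^ 2) * funk x y := by
    rw [sqrt_disc_eq hx, sub_add_cancel]
  rw [berwald_eq_disc, hsum, hsqrt]
  field_simp

@[simp] lemma berwald_zero_right (x : Eu n) : berwald n x 0 = 0 := by simp [berwald]

lemma berwald_pos (hx : ‖x‖ < 1) (hy : y ≠ 0) : 0 < berwald n x y := by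
  rw [berwald_eq hx hy]
  exact div_pos (funk_pos hx hy) (exitGap_pos hx hy)

lemma posHomogeneous_funk (x : Eu n) : PosHomogeneous (funk x) :=
  fun _ y hc => funk_smul x y hc.le

lemma posHomogeneous_berwald (x : Eu n) : PosHomogeneous (berwald n x) := by
  intro c y hc
  rw [berwald_eq_disc, sqrt_disc_smul x y hc.le, inner_smul_right, ← mul_add, mul_pow, sq c,
    mul_assoc, mul_left_comm (_ ^ 2) c, mul_div_mul_left _ _ hc.ne', mul_div_assoc,
    ← berwald_eq_disc]

end Algebra

section Smoothness

variable {x y : Eu n}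

lemma contDiff_disc : ContDiff ℝ ∞ (fun z : Eu n × Eu n => disc z.1 z.2) :=
  ((contDiff_const.sub (contDiff_fst.norm_sq ℝ)).mul (contDiff_snd.norm_sq ℝ)).add
    ((contDiff_fst.inner ℝ contDiff_snd).pow 2)

lemma contDiffAt_sqrt_disc (hx : ‖x‖ < 1) (hy : y ≠ 0) :
    ContDiffAt ℝ ∞ (fun z : Eu n × Eu n => √(disc z.1 z.2)) (x, y) :=
  contDiff_disc.contDiffAt.sqrt (disc_pos hx hy).ne'

lemma contDiffAt_sqrt_disc_add_inner (hx : ‖x‖ < 1) (hy : y ≠ 0) :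
    ContDiffAt ℝ ∞ (fun z : Eu n × Eu n => √(disc z.1 z.2) + inner ℝ z.1 z.2) (x, y) :=
  (contDiffAt_sqrt_disc hx hy).add (contDiff_fst.inner ℝ contDiff_snd).contDiffAt

lemma contDiff_one_sub_norm_sq_fst : ContDiff ℝ ∞ (fun z : Eu n × Eu n => 1 - ‖z.1‖ ^ 2) :=
  contDiff_const.sub (contDiff_fst.norm_sq ℝ)

lemma contDiffAt_funk (hx : ‖x‖ < 1) (hy : y ≠ 0) :
    ContDiffAt ℝ ∞ (fun z : Eu n × Eu n => funk z.1 z.2) (x, y) :=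
  (contDiffAt_sqrt_disc_add_inner hx hy).div contDiff_one_sub_norm_sq_fst.contDiffAt
    (one_sub_norm_sq_pos hx).ne'

lemma contDiffAt_berwald (hx : ‖x‖ < 1) (hy : y ≠ 0) :
    ContDiffAt ℝ ∞ (fun z : Eu n × Eu n => berwald n z.1 z.2) (x, y) :=
  ((contDiffAt_sqrt_disc_add_inner hx hy).pow 2).div
    ((contDiff_one_sub_norm_sq_fst.contDiffAt.pow 2).mul (contDiffAt_sqrt_disc hx hy))
    (mul_pos (pow_pos (one_sub_norm_sq_pos hx) 2) (Real.sqrt_pos.2 (disc_pos hx hy))).ne'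

lemma contDiffAt_berwald_right (hx : ‖x‖ < 1) (hy : y ≠ 0) : ContDiffAt ℝ ∞ (berwald n x) y :=
  ContDiffAt.comp (f := fun w => (x, w)) y (contDiffAt_berwald hx hy) (by fun_prop)

lemma continuousOn_funk :
    ContinuousOn (fun z : Eu n × Eu n => funk z.1 z.2) (unitBall n ×ˢ Set.univ) := by
  refine ContinuousOn.div (Continuous.continuousOn ?_) (Continuous.continuousOn ?_) ?_
  · exact (Real.continuous_sqrt.comp contDiff_disc.continuous).add
      (continuous_fst.inner continuous_snd)
  · exact contDiff_one_sub_norm_sq_fst.continuous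
  · exact fun z hz => (one_sub_norm_sq_pos (mem_ball_zero_iff.1 hz.1)).ne'

end Smoothness

section Derivatives

variable {x y v : Eu n}

/-- The differential of the Funk metric `Θ(x, ·)` at `y`. -/
def funkDeriv (x y : Eu n) : Eu n →L[ℝ] ℝ := (exitGap x y)⁻¹ • innerSL ℝ (exitPoint x y)

/-- The direction `y' + Θ x'` of the fibre. By Okada's equation `D_xΘ = Θ D_yΘ`, the functions `Θ`
and `u` vary in the direction `(x', y')` as in the direction `(0, y' + Θ x')`. -/
def funkShift (x y : Eu n) : Eu n × Eu n →L[ℝ] Eu n :=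
  ContinuousLinearMap.snd ℝ (Eu n) (Eu n) + funk x y • ContinuousLinearMap.fst ℝ (Eu n) (Eu n)

/-- The differential of the exit point `u(x, ·)` at `y`. -/
def exitPointDeriv (x y : Eu n) : Eu n →L[ℝ] Eu n :=
  (funk x y)⁻¹ • (ContinuousLinearMap.id ℝ (Eu n) - (funkDeriv x y).smulRight (exitPoint x y - x))

/-- The differential of Berwald's metric `B(x, ·)` at `y`. -/
def berwaldDeriv (x y : Eu n) : Eu n →L[ℝ] ℝ :=
  (exitGap x y ^ 2)⁻¹ • (innerSL ℝ x + (2 * exitGap x y - (1 - ‖x‖ ^ 2)) • funkDeriv x y)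

lemma funkDeriv_apply (x y v : Eu n) :
    funkDeriv x y v = inner ℝ (exitPoint x y) v / exitGap x y := by
  simp [funkDeriv, div_eq_inv_mul]

lemma funkShift_apply (x y x' y' : Eu n) : funkShift x y (x', y') = y' + funk x y • x' := rfl

lemma berwaldDeriv_apply (x y v : Eu n) :
    berwaldDeriv x y v =
      (inner ℝ x v + (2 * exitGap x y - (1 - ‖x‖ ^ 2)) * funkDeriv x y v) / exitGap x y ^ 2 := by
  simp [berwaldDeriv, div_eq_inv_mul, mul_add]

lemma exitPointDeriv_apply (x y v : Eu n) :
    exitPointDeriv x y v = (funk x y)⁻¹ • (v - funkDeriv x y v • (exitPoint x y - x)) := rfl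

lemma funkDeriv_self (hx : ‖x‖ < 1) (hy : y ≠ 0) : funkDeriv x y y = funk x y := by
  rw [funkDeriv_apply, inner_exitPoint_self hx hy, mul_div_cancel_right₀ _ (exitGap_pos hx hy).ne']

lemma hasFDerivAt_funk (hx : ‖x‖ < 1) (hy : y ≠ 0) :
    HasFDerivAt (fun z : Eu n × Eu n => funk z.1 z.2) (funkDeriv x y ∘L funkShift x y) (x, y) := by
  have hd := ((contDiffAt_funk hx hy).differentiableAt (by simp)).hasFDerivAt
  set D := fderiv ℝ (fun z : Eu n × Eu n => funk z.1 z.2) (x, y)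
  have hsq : HasFDerivAt (fun z : Eu n × Eu n => ‖funk z.1 z.2 • z.1 + z.2‖ ^ 2) _ (x, y) :=
    ((hd.smul hasFDerivAt_fst).add hasFDerivAt_snd).norm_sq
  have heq : (fun z : Eu n × Eu n => ‖funk z.1 z.2 • z.1 + z.2‖ ^ 2) =ᶠ[𝓝 (x, y)]
      fun z => funk z.1 z.2 ^ 2 := by
    filter_upwards [continuousAt_fst.norm.eventually (eventually_lt_nhds hx)] with z hz
    rw [norm_funk_smul_add hz]
  have hEq := (hsq.congr_of_eventuallyEq heq.symm).unique (hd.pow 2)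
  have hu : funk x y • x + y = funk x y • exitPoint x y := by
    nth_rewrite 2 [← smul_exitPoint_sub hx hy]
    rw [← smul_add, add_sub_cancel]
  refine hd.congr_fderiv (ContinuousLinearMap.ext fun h => ?_)
  have hh : 2 * inner ℝ (funk x y • exitPoint x y) (funk x y • h.1 + D h • x + h.2) =
      2 * funk x y * D h := by
    rw [← hu]
    simpa [inner_add_left, inner_add_right, inner_smul_left, inner_smul_right, mul_add, add_assoc,
      mul_left_comm] using congrArg (· h) hEq
  simp only [inner_smul_left, inner_smul_right, inner_add_right, RCLike.conj_to_real,
    real_inner_comm x, inner_exitPoint] at hh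
  change _ = funkDeriv x y (h.2 + funk x y • h.1)
  rw [funkDeriv_apply, eq_div_iff (exitGap_pos hx hy).ne', inner_add_right, inner_smul_right]
  refine mul_left_cancel₀ (funk_pos hx hy).ne' ?_
  linear_combination -hh / 2

lemma hasFDerivAt_exitPoint (hx : ‖x‖ < 1) (hy : y ≠ 0) :
    HasFDerivAt (fun z : Eu n × Eu n => exitPoint z.1 z.2)
      (exitPointDeriv x y ∘L funkShift x y) (x, y) := by
  have hΘ := funk_pos hx hy
  have hd : HasFDerivAt (fun z : Eu n × Eu n => z.1 + (funk z.1 z.2)⁻¹ • z.2) _ (x, y) :=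
    hasFDerivAt_fst.add (((hasDerivAt_inv hΘ.ne').comp_hasFDerivAt (x, y)
      (hasFDerivAt_funk hx hy)).smul hasFDerivAt_snd)
  refine hd.congr_fderiv (ContinuousLinearMap.ext fun ⟨x', y'⟩ => ?_)
  have hu : exitPoint x y - x = (funk x y)⁻¹ • y := add_sub_cancel_left _ _
  simp only [hu, Function.comp_apply, add_apply, smul_apply, ContinuousLinearMap.comp_apply,
    ContinuousLinearMap.coe_fst', ContinuousLinearMap.coe_snd', ContinuousLinearMap.smulRight_apply,
    exitPointDeriv_apply, funkShift_apply]
  match_scalars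
  · field_simp
  · ring
  · ring

lemma hasFDerivAt_exitGap (hx : ‖x‖ < 1) (hy : y ≠ 0) :
    HasFDerivAt (fun z : Eu n × Eu n => exitGap z.1 z.2)
      (-(innerSL ℝ (exitPoint x y) ∘L ContinuousLinearMap.fst ℝ (Eu n) (Eu n) +
        innerSL ℝ x ∘L exitPointDeriv x y ∘L funkShift x y)) (x, y) := by
  have hd : HasFDerivAt (fun z : Eu n × Eu n => 1 - inner ℝ z.1 (exitPoint z.1 z.2)) _ (x, y) :=
    (hasFDerivAt_fst.inner ℝ (hasFDerivAt_exitPoint hx hy)).const_sub 1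
  refine hd.congr_fderiv (ContinuousLinearMap.ext fun h => ?_)
  simp [real_inner_comm, add_comm]

lemma hasFDerivAt_berwald (hx : ‖x‖ < 1) (hy : y ≠ 0) :
    HasFDerivAt (fun z : Eu n × Eu n => berwald n z.1 z.2)
      (berwaldDeriv x y ∘L funkShift x y +
        berwald n x y • funkDeriv x y ∘L ContinuousLinearMap.fst ℝ (Eu n) (Eu n)) (x, y) := by
  have hΘ := funk_pos hx hy
  have hq := exitGap_pos hx hy
  have hd : HasFDerivAt (fun z : Eu n × Eu n => funk z.1 z.2 * (exitGap z.1 z.2)⁻¹) _ (x, y) :=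
    (hasFDerivAt_funk hx hy).mul
      ((hasDerivAt_inv hq.ne').comp_hasFDerivAt (x, y) (hasFDerivAt_exitGap hx hy))
  have heq : (fun z : Eu n × Eu n => berwald n z.1 z.2) =ᶠ[𝓝 (x, y)]
      fun z => funk z.1 z.2 * (exitGap z.1 z.2)⁻¹ := by
    filter_upwards [continuousAt_fst.norm.eventually (eventually_lt_nhds hx),
      continuousAt_snd.eventually (isOpen_compl_singleton.mem_nhds hy)] with z hz hz'
    rw [berwald_eq hz hz', div_eq_mul_inv]
  refine (hd.congr_of_eventuallyEq heq).congr_fderiv (ContinuousLinearMap.ext fun ⟨x', y'⟩ => ?_)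
  simp only [add_apply, smul_apply, neg_apply, ContinuousLinearMap.comp_apply,
    innerSL_apply_apply, ContinuousLinearMap.coe_fst', smul_eq_mul, exitPointDeriv_apply,
    berwaldDeriv_apply, berwald_eq hx hy, inner_smul_right, inner_sub_right, inner_exitPoint,
    real_inner_self_eq_norm_sq, funkDeriv_apply x y x']
  field_simp
  ring

lemma fderiv_berwald_right (hx : ‖x‖ < 1) (hy : y ≠ 0) :
    fderiv ℝ (berwald n x) y = berwaldDeriv x y := by
  ext v
  rw [fderiv_right_eq (hasFDerivAt_berwald hx hy).differentiableAt,
    (hasFDerivAt_berwald hx hy).fderiv]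
  simp [funkShift_apply]

lemma fderiv_funk_right (hx : ‖x‖ < 1) (hy : y ≠ 0) : fderiv ℝ (funk x) y = funkDeriv x y := by
  ext v
  rw [fderiv_right_eq (hasFDerivAt_funk hx hy).differentiableAt, (hasFDerivAt_funk hx hy).fderiv]
  simp [funkShift_apply]

lemma fderiv_funk_left (hx : ‖x‖ < 1) (hy : y ≠ 0) (v : Eu n) :
    fderiv ℝ (fun z => funk z y) x v = funk x y * fderiv ℝ (funk x) y v := by
  rw [fderiv_left_eq (hasFDerivAt_funk hx hy).differentiableAt, (hasFDerivAt_funk hx hy).fderiv,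
    fderiv_funk_right hx hy]
  simp [funkShift_apply]

lemma fderiv_berwald_left (hx : ‖x‖ < 1) (hy : y ≠ 0) (v : Eu n) :
    fderiv ℝ (fun z => berwald n z y) x v =
      funk x y * fderiv ℝ (berwald n x) y v + berwald n x y * fderiv ℝ (funk x) y v := by
  rw [fderiv_left_eq (hasFDerivAt_berwald hx hy).differentiableAt,
    (hasFDerivAt_berwald hx hy).fderiv, fderiv_berwald_right hx hy, fderiv_funk_right hx hy]
  simp [funkShift_apply]

lemma hasLineDerivAt_exitGap_of_mem_ker (hx : ‖x‖ < 1) (hy : y ≠ 0) (hv : funkDeriv x y v = 0) :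
    HasLineDerivAt ℝ (exitGap x) (-((funk x y)⁻¹ * inner ℝ x v)) y v := by
  simpa [exitPointDeriv_apply, funkShift_apply, hv, inner_smul_right, Function.comp_def] using
    ((hasFDerivAt_exitGap hx hy).comp y (hasFDerivAt_prodMk_right x y)).hasLineDerivAt v

lemma hasLineDerivAt_funkDeriv_of_mem_ker (hx : ‖x‖ < 1) (hy : y ≠ 0) (hv : funkDeriv x y v = 0) :
    HasLineDerivAt ℝ (fun w => funkDeriv x w v) ((funk x y)⁻¹ * ‖v‖ ^ 2 / exitGap x y) y v := by
  have hq := (exitGap_pos hx hy).ne'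
  have huv : inner ℝ (exitPoint x y) v = 0 := by simpa [funkDeriv_apply, hq] using hv
  have hu : HasDerivAt (fun t : ℝ => exitPoint x (y + t • v)) ((funk x y)⁻¹ • v) 0 := by
    simpa [exitPointDeriv_apply, funkShift_apply, hv, HasLineDerivAt, Function.comp_def] using
      ((hasFDerivAt_exitPoint hx hy).comp y (hasFDerivAt_prodMk_right x y)).hasLineDerivAt v
  have hd : HasDerivAt (fun t : ℝ => inner ℝ (exitPoint x (y + t • v)) v / exitGap x (y + t • v))
      _ 0 :=
    (hu.inner ℝ (hasDerivAt_const (0 : ℝ) v)).div (hasLineDerivAt_exitGap_of_mem_ker hx hy hv)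
      (by simpa using hq)
  simp only [HasLineDerivAt, funkDeriv_apply]
  refine HasDerivAt.congr_deriv hd ?_
  simp only [zero_smul, add_zero, inner_zero_right, inner_smul_left, RCLike.conj_to_real, huv,
    real_inner_self_eq_norm_sq, zero_mul, zero_add, sub_zero]
  field_simp

lemma fderiv_fderiv_berwald_of_mem_ker (hx : ‖x‖ < 1) (hy : y ≠ 0) (hv : funkDeriv x y v = 0) :
    fderiv ℝ (fderiv ℝ (berwald n x)) y v v =
      (2 * inner ℝ x v ^ 2 + ‖exitPoint x y - x‖ ^ 2 * ‖v‖ ^ 2) / (funk x y * exitGap x y ^ 3) := by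
  have hq := (exitGap_pos hx hy).ne'
  have hB : HasFDerivAt (fun w => fderiv ℝ (berwald n x) w v) _ y :=
    (differentiableAt_fderiv ((contDiffAt_berwald_right hx hy).of_le
      (by norm_cast))).hasFDerivAt.clm_apply (hasFDerivAt_const v y)
  have heq : (fun w => fderiv ℝ (berwald n x) w v) =ᶠ[𝓝 y] fun w => berwaldDeriv x w v := by
    filter_upwards [isOpen_compl_singleton.mem_nhds hy] with w hw
    rw [fderiv_berwald_right hx hw]
  have hgap := hasLineDerivAt_exitGap_of_mem_ker hx hy hv
  have hd : HasDerivAt (fun t : ℝ => (inner ℝ x v + (2 * exitGap x (y + t • v) - (1 - ‖x‖ ^ 2)) *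
      funkDeriv x (y + t • v) v) / exitGap x (y + t • v) ^ 2) _ 0 :=
    ((((hgap.const_mul 2).sub_const _).mul
      (hasLineDerivAt_funkDeriv_of_mem_ker hx hy hv)).const_add _).div (hgap.pow 2) (by simpa)
  simp only [← berwaldDeriv_apply] at hd
  have hval := ((hB.congr_of_eventuallyEq heq.symm).hasLineDerivAt v).unique hd
  have hΘ := (funk_pos hx hy).ne'
  simp only [ContinuousLinearMap.comp_zero, zero_add, ContinuousLinearMap.flip_apply,
    Pi.mul_apply, zero_smul, add_zero, hv, mul_zero, Nat.cast_ofNat] at hval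
  rw [hval, norm_exitPoint_sub_sq hx hy]
  field_simp
  ring

lemma fundTensor_berwald_pos (hx : ‖x‖ < 1) (hy : y ≠ 0) (hv : v ≠ 0) :
    0 < fundTensor (berwald n x) y v v :=
  (posHomogeneous_berwald x).fundTensor_pos ((contDiffAt_berwald_right hx hy).of_le (by norm_cast))
    (berwald_pos hx hy) (ℓ := funkDeriv x y) ((funkDeriv_self hx hy).trans_ne (funk_pos hx hy).ne')
    (fun w hw hker => by
      have := norm_exitPoint_sub_sq_pos hx hy
      have := norm_pos_iff.2 hw
      have := funk_pos hx hy
      have := exitGap_pos hx hy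
      rw [fderiv_fderiv_berwald_of_mem_ker hx hy hker]
      positivity) hv

end Derivatives

lemma isMinkowskiNorm_berwald {x : Eu n} (hx : ‖x‖ < 1) : IsMinkowskiNorm (berwald n x) where
  nonneg y := by
    rcases eq_or_ne y 0 with rfl | hy
    · simp
    · exact (berwald_pos hx hy).le
  eq_zero_iff y :=
    ⟨fun h => by_contra fun hy => (berwald_pos hx hy).ne' h, fun h => h ▸ berwald_zero_right x⟩
  pos_homogeneous := posHomogeneous_berwald x
  smooth _ hy := (contDiffAt_berwald_right hx hy).contDiffWithinAt
  posDef _ hy _ hv := fundTensor_berwald_pos hx hy hv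

lemma isFinslerManifold_berwald : IsFinslerManifold (unitBall n) (berwald n) where
  isOpen := Metric.isOpen_ball
  isConnected := Metric.isConnected_ball one_pos
  smooth := fun _ hz => (contDiffAt_berwald (mem_ball_zero_iff.1 hz.1) hz.2).contDiffWithinAt
  minkowski _ hx := isMinkowskiNorm_berwald (mem_ball_zero_iff.1 hx)

lemma contDiffAt_funk_right {x y : Eu n} (hx : ‖x‖ < 1) (hy : y ≠ 0) : ContDiffAt ℝ ∞ (funk x) y :=
  ContDiffAt.comp (f := fun w => (x, w)) y (contDiffAt_funk hx hy) (by fun_prop)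

lemma geodesicCoeff_berwald {x : Eu n} (hx : x ∈ unitBall n) (y : Eu n) (i : Fin n) :
    geodesicCoeff (berwald n) x y i = funk x y * y i := by
  have hx' := mem_ball_zero_iff.1 hx
  exact isFinslerManifold_berwald.geodesicCoeff_eq_of_fderiv_left hx (posHomogeneous_funk x)
    (fun w hw => ((contDiffAt_funk_right hx' hw).of_le (by norm_cast)).contDiffWithinAt)
    (fun w hw v => fderiv_berwald_left hx' hw v) y i

lemma solvesOkada_funk : SolvesOkada (unitBall n) (funk (n := n)) where
  isOpen := Metric.isOpen_ball
  smooth := fun _ hz =>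
    ((contDiffAt_funk (mem_ball_zero_iff.1 hz.1) hz.2).of_le (by norm_cast)).contDiffWithinAt
  posHomogeneous x _ := posHomogeneous_funk x
  equation _ hx _ hy v := fderiv_funk_left (mem_ball_zero_iff.1 hx) hy v

lemma isFlat_berwald : IsFlat (unitBall n) (berwald n) := fun _ hx _ v hyv =>
  solvesOkada_funk.flagCurvature_eq_zero (fun _ => geodesicCoeff_berwald) hx
    (by simpa using hyv.ne_zero 0) v

/-! ### Geodesics of Berwald's metric -/

section Ray

variable {x y : Eu n}

lemma funk_eq_of_norm {k : ℝ} (hx : ‖x‖ < 1) (hk : 0 ≤ k) (h : ‖k • x + y‖ = k) :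
    funk x y = k := by
  rcases eq_or_ne y 0 with rfl | hy
  · rw [add_zero, norm_smul, Real.norm_of_nonneg hk] at h
    rw [funk_zero_right, (mul_eq_zero.1 (by linear_combination h : k * (‖x‖ - 1) = 0)).resolve_right
      (by linarith)]
  have hsq : ∀ c : ℝ, ‖c • x + y‖ ^ 2 = c ^ 2 * ‖x‖ ^ 2 + 2 * c * inner ℝ x y + ‖y‖ ^ 2 := by
    intro c
    rw [norm_add_sq_real, norm_smul, inner_smul_left, RCLike.conj_to_real, mul_pow,
      Real.norm_eq_abs, sq_abs]
    ring
  have hΘsq := hsq (funk x y)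
  have hksq := hsq k
  rw [norm_funk_smul_add hx y] at hΘsq
  rw [h] at hksq
  by_contra hne
  -- The quadratic equation has only one non-negative root, as the product of its roots is negative.
  have hsum : (1 - ‖x‖ ^ 2) * (funk x y + k) = 2 * inner ℝ x y :=
    mul_left_cancel₀ (sub_ne_zero.2 hne) (by linear_combination hΘsq - hksq)
  have hprod : (1 - ‖x‖ ^ 2) * (funk x y * k) + ‖y‖ ^ 2 = 0 := by
    linear_combination k * hsum - hksq
  have hroots := mul_nonneg (one_sub_norm_sq_pos hx).le (mul_nonneg (funk_nonneg hx y) hk)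
  exact (add_pos_of_nonneg_of_pos hroots (pow_pos (norm_pos_iff.2 hy) 2)).ne' hprod

lemma norm_add_smul_lt_one {s : ℝ} (hx : ‖x‖ < 1) (hs : 0 ≤ s) (hsΘ : s * funk x y < 1) :
    ‖x + s • y‖ < 1 := by
  have hsplit : x + s • y = (1 - s * funk x y) • x + s • (funk x y • x + y) := by module
  calc ‖x + s • y‖ ≤ (1 - s * funk x y) * ‖x‖ + s * funk x y := by
        rw [hsplit]
        refine (norm_add_le _ _).trans_eq ?_
        rw [norm_smul, norm_smul, norm_funk_smul_add hx, Real.norm_of_nonneg hs,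
          Real.norm_of_nonneg (sub_pos.2 hsΘ).le]
    _ < 1 := by nlinarith

lemma funk_add_smul {s : ℝ} (hx : ‖x‖ < 1) (hs : 0 ≤ s) (hsΘ : s * funk x y < 1) :
    funk (x + s • y) y = funk x y / (1 - s * funk x y) := by
  have hpos := sub_pos.2 hsΘ
  refine funk_eq_of_norm (norm_add_smul_lt_one hx hs hsΘ)
    (div_nonneg (funk_nonneg hx y) hpos.le) ?_
  have hsmul : (funk x y / (1 - s * funk x y)) • (x + s • y) + y =
      (1 - s * funk x y)⁻¹ • (funk x y • x + y) := by
    rw [eq_inv_smul_iff₀ hpos.ne', smul_add, smul_smul, mul_div_cancel₀ _ hpos.ne']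
    module
  rw [hsmul, norm_smul, norm_funk_smul_add hx, norm_inv, Real.norm_of_nonneg hpos.le,
    inv_mul_eq_div]

lemma hasDerivAt_add_div_smul (x y : Eu n) {k t : ℝ} (h : 1 + k * t ≠ 0) :
    HasDerivAt (fun t => x + (t / (1 + k * t)) • y) (((1 + k * t) ^ 2)⁻¹ • y) t := by
  have hlin : HasDerivAt (fun t => 1 + k * t) k t := by
    simpa using ((hasDerivAt_id t).const_mul k).const_add 1
  refine ((((hasDerivAt_id t).div hlin h).smul_const y).const_add x).congr_deriv ?_
  rw [id, one_mul, mul_comm t k, add_sub_cancel_right, one_div]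

lemma hasDerivAt_inv_sq_smul (y : Eu n) {k t : ℝ} (h : 1 + k * t ≠ 0) :
    HasDerivAt (fun t => ((1 + k * t) ^ 2)⁻¹ • y) ((-2 * k / (1 + k * t) ^ 3) • y) t := by
  have hlin : HasDerivAt (fun t => 1 + k * t) k t := by
    simpa using ((hasDerivAt_id t).const_mul k).const_add 1
  refine (((hlin.fun_pow 2).fun_inv (pow_ne_zero 2 h)).smul_const y).congr_deriv ?_
  congr 1
  rw [div_eq_div_iff (by positivity) (by positivity)]
  push_cast
  ring

lemma isGeodesicOn_ray (hx : ‖x‖ < 1) (y : Eu n) :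
    IsGeodesicOn (unitBall n) (berwald n) (fun t => x + (t / (1 + funk x y * t)) • y)
      (Set.Ici 0) := by
  set k := funk x y with hk
  have hpos : ∀ t ∈ Set.Ici (0 : ℝ), 0 < 1 + k * t := fun t ht =>
    add_pos_of_pos_of_nonneg one_pos (mul_nonneg (funk_nonneg hx y) ht)
  have hgap : ∀ t ∈ Set.Ici (0 : ℝ), 1 - t / (1 + k * t) * k = (1 + k * t)⁻¹ := fun t ht => by
    have := (hpos t ht).ne'
    rw [← mul_eq_one_iff_eq_inv₀ this, sub_mul, mul_right_comm, div_mul_cancel₀ _ this]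
    ring
  have hs : ∀ t ∈ Set.Ici (0 : ℝ), 0 ≤ t / (1 + k * t) ∧ t / (1 + k * t) * k < 1 := fun t ht =>
    ⟨div_nonneg ht (hpos t ht).le, sub_pos.1 (hgap t ht ▸ inv_pos.2 (hpos t ht))⟩
  have hvel : ∀ t ∈ Set.Ici (0 : ℝ), derivWithin (fun t => x + (t / (1 + k * t)) • y)
      (Set.Ici 0) t = ((1 + k * t) ^ 2)⁻¹ • y := fun t ht =>
    (hasDerivAt_add_div_smul x y (hpos t ht).ne').hasDerivWithinAt.derivWithin
      (uniqueDiffOn_Ici 0 t ht)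
  have hacc : ∀ t ∈ Set.Ici (0 : ℝ), derivWithin (derivWithin
      (fun t => x + (t / (1 + k * t)) • y) (Set.Ici 0)) (Set.Ici 0) t =
        (-2 * k / (1 + k * t) ^ 3) • y := fun t ht => by
    rw [derivWithin_congr hvel (hvel t ht)]
    exact (hasDerivAt_inv_sq_smul y (hpos t ht).ne').hasDerivWithinAt.derivWithin
      (uniqueDiffOn_Ici 0 t ht)
  refine ⟨fun t ht => ?_, fun t ht => ?_, fun t ht i => ?_⟩
  · exact mem_ball_zero_iff.2 (norm_add_smul_lt_one hx (hs t ht).1 (hs t ht).2)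
  · have hs : ContDiffAt ℝ ∞ (fun t : ℝ => t / (1 + k * t)) t :=
      contDiffAt_id.div (by fun_prop) (hpos t ht).ne'
    exact (contDiffAt_const.add (hs.smul contDiffAt_const)).contDiffWithinAt
  · have hne := (hpos t ht).ne'
    rw [hacc t ht, hvel t ht, geodesicCoeff_berwald
      (mem_ball_zero_iff.2 (norm_add_smul_lt_one hx (hs t ht).1 (hs t ht).2)),
      funk_smul _ _ (by positivity), funk_add_smul hx (hs t ht).1 (hs t ht).2, ← hk, hgap t ht]
    simp only [PiLp.smul_apply, smul_eq_mul, div_inv_eq_mul]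
    field_simp
    ring

end Ray

section LinearODE

variable {V : Type*} [NormedAddCommGroup V] [NormedSpace ℝ V]

lemma eq_of_hasDerivWithinAt_zero {f : ℝ → V} {s : Set ℝ} (hs : Convex ℝ s)
    (h : ∀ t ∈ s, HasDerivWithinAt f 0 s t) {a b : ℝ} (ha : a ∈ s) (hb : b ∈ s) : f b = f a := by
  simpa [sub_eq_zero] using
    hs.norm_image_sub_le_of_norm_hasDerivWithin_le (C := 0) h (by simp) ha hb

lemma exists_pos_smul_eq_of_hasDerivWithinAt {v : ℝ → V} {f : ℝ → ℝ} {a b : ℝ} (hab : a ≤ b)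
    (hf : ContinuousOn f (Set.Icc a b))
    (hv : ∀ t ∈ Set.Icc a b, HasDerivWithinAt v (f t • v t) (Set.Icc a b) t) :
    ∃ c : ℝ, 0 < c ∧ v b = c • v a := by
  set E : ℝ → ℝ := fun t => Real.exp (-∫ τ in a..t, Set.IccExtend hab (fun s => f s) τ)
  have hcont : Continuous (Set.IccExtend hab fun s => f s) :=
    (continuousOn_iff_continuous_domRestrict.1 hf).Icc_extend'
  have hconst : ∀ t ∈ Set.Icc a b, HasDerivWithinAt (fun t => E t • v t) 0 (Set.Icc a b) t := by
    intro t ht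
    refine ((hcont.integral_hasStrictDerivAt a t).hasDerivAt.neg.exp.hasDerivWithinAt.smul
      (hv t ht)).congr_deriv ?_
    rw [Set.IccExtend_of_mem _ _ ht, smul_smul, ← add_smul, mul_neg, add_neg_cancel, zero_smul]
  have hE := eq_of_hasDerivWithinAt_zero (convex_Icc a b) hconst
    (Set.left_mem_Icc.2 hab) (Set.right_mem_Icc.2 hab)
  have hEa : E a = 1 := by simp [E]
  refine ⟨(E b)⁻¹, inv_pos.2 (Real.exp_pos _), ?_⟩
  rw [hEa, one_smul] at hE
  rw [← hE, inv_smul_smul₀ (Real.exp_pos _).ne']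

end LinearODE

namespace IsGeodesicOn

variable {γ : ℝ → Eu n} {t T : ℝ}

lemma hasDerivWithinAt {U : Set (Eu n)} {F : Eu n → Eu n → ℝ} {s : Set ℝ}
    (h : IsGeodesicOn U F γ s) (ht : t ∈ s) : HasDerivWithinAt γ (derivWithin γ s t) s t :=
  ((h.smooth t ht).differentiableWithinAt (by simp)).hasDerivWithinAt

lemma hasDerivWithinAt_velocity {s : Set ℝ} (h : IsGeodesicOn (unitBall n) (berwald n) γ s)
    (hs : UniqueDiffOn ℝ s) (ht : t ∈ s) :
    HasDerivWithinAt (derivWithin γ s)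
      ((-2 * funk (γ t) (derivWithin γ s t)) • derivWithin γ s t) s t := by
  have hsmooth : ContDiffOn ℝ ∞ (derivWithin γ s) s := h.smooth.derivWithin hs (by simp)
  refine ((hsmooth t ht).differentiableWithinAt (by simp)).hasDerivWithinAt.congr_deriv ?_
  ext i
  have heq := h.equation t ht i
  rw [geodesicCoeff_berwald (h.mapsTo ht)] at heq
  simp only [PiLp.smul_apply, smul_eq_mul]
  linarith

lemma exists_velocity_eq (h : IsGeodesicOn (unitBall n) (berwald n) γ (Set.Ico 0 T))
    (ht : t ∈ Set.Ico 0 T) :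
    ∃ c : ℝ, 0 < c ∧ derivWithin γ (Set.Ico 0 T) t = c • derivWithin γ (Set.Ico 0 T) 0 := by
  have hsub : Set.Icc 0 t ⊆ Set.Ico 0 T := fun τ hτ => ⟨hτ.1, hτ.2.trans_lt ht.2⟩
  have hv := fun τ (hτ : τ ∈ Set.Icc 0 t) =>
    (h.hasDerivWithinAt_velocity (uniqueDiffOn_Ico 0 T) (hsub hτ)).mono hsub
  have hpair : ContinuousOn (fun τ => (γ τ, derivWithin γ (Set.Ico 0 T) τ)) (Set.Icc 0 t) :=
    (h.smooth.continuousOn.mono hsub).prodMk fun τ hτ => (hv τ hτ).continuousWithinAt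
  have hΘ := (continuousOn_funk (n := n)).comp hpair
    fun τ hτ => ⟨h.mapsTo (hsub hτ), Set.mem_univ _⟩
  exact exists_pos_smul_eq_of_hasDerivWithinAt ht.1 (hΘ.const_mul (-2)) hv

lemma hasDerivWithinAt_funk {s : Set ℝ} (h : IsGeodesicOn (unitBall n) (berwald n) γ s)
    (hs : UniqueDiffOn ℝ s) (ht : t ∈ s) (hv : derivWithin γ s t ≠ 0) :
    HasDerivWithinAt (fun τ => funk (γ τ) (derivWithin γ s τ))
      (-funk (γ t) (derivWithin γ s t) ^ 2) s t := by
  have hx := mem_ball_zero_iff.1 (h.mapsTo ht)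
  refine (((hasFDerivAt_funk hx hv).comp_hasDerivWithinAt (f := fun τ => (γ τ, derivWithin γ s τ))
    t ((h.hasDerivWithinAt ht).prodMk (h.hasDerivWithinAt_velocity hs ht)))).congr_deriv ?_
  rw [ContinuousLinearMap.comp_apply, funkShift_apply, ← add_smul, map_smul, funkDeriv_self hx hv,
    smul_eq_mul]
  ring

lemma funk_velocity (h : IsGeodesicOn (unitBall n) (berwald n) γ (Set.Ico 0 T))
    (ht : t ∈ Set.Ico 0 T) {k : ℝ} (hk : k = funk (γ 0) (derivWithin γ (Set.Ico 0 T) 0)) :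
    (1 + k * t) * funk (γ t) (derivWithin γ (Set.Ico 0 T) t) = k := by
  have h0 : (0 : ℝ) ∈ Set.Ico 0 T := ⟨le_rfl, ht.1.trans_lt ht.2⟩
  by_cases hv0 : derivWithin γ (Set.Ico 0 T) 0 = 0
  · obtain ⟨c, -, hc⟩ := h.exists_velocity_eq ht
    simp [hk, hc, hv0]
  have hv : ∀ τ ∈ Set.Ico 0 T, derivWithin γ (Set.Ico 0 T) τ ≠ 0 := fun τ hτ => by
    obtain ⟨c, hc0, hc⟩ := h.exists_velocity_eq hτ
    exact hc ▸ smul_ne_zero hc0.ne' hv0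
  have hpos : ∀ τ ∈ Set.Ico 0 T, 0 < funk (γ τ) (derivWithin γ (Set.Ico 0 T) τ) := fun τ hτ =>
    funk_pos (mem_ball_zero_iff.1 (h.mapsTo hτ)) (hv τ hτ)
  have hconst : ∀ τ ∈ Set.Ico 0 T, HasDerivWithinAt
      (fun τ => (funk (γ τ) (derivWithin γ (Set.Ico 0 T) τ))⁻¹ - τ) 0 (Set.Ico 0 T) τ := by
    intro τ hτ
    have hne := (hpos τ hτ).ne'
    refine (((h.hasDerivWithinAt_funk (uniqueDiffOn_Ico 0 T) hτ (hv τ hτ)).inv hne).sub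
      (hasDerivWithinAt_id τ _)).congr_deriv ?_
    field_simp
    ring
  have hinv := eq_of_hasDerivWithinAt_zero (convex_Ico 0 T) hconst h0 ht
  rw [← hk, sub_zero, sub_eq_iff_eq_add] at hinv
  have hkpos := hk ▸ hpos 0 h0
  have := (hpos t ht).ne'
  field_simp at hinv
  linear_combination -hinv

lemma smul_eq (h : IsGeodesicOn (unitBall n) (berwald n) γ (Set.Ico 0 T))
    (ht : t ∈ Set.Ico 0 T) {k : ℝ} (hk : k = funk (γ 0) (derivWithin γ (Set.Ico 0 T) 0)) :
    (1 + k * t) • γ t = γ 0 + t • (derivWithin γ (Set.Ico 0 T) 0 + k • γ 0) := by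
  set v := derivWithin γ (Set.Ico 0 T)
  have h0 : (0 : ℝ) ∈ Set.Ico 0 T := ⟨le_rfl, ht.1.trans_lt ht.2⟩
  have hlin : ∀ τ, HasDerivWithinAt (fun τ : ℝ => 1 + k * τ) k (Set.Ico 0 T) τ := fun τ => by
    simpa using (((hasDerivAt_id τ).const_mul k).const_add 1).hasDerivWithinAt
  have hslope : ∀ τ ∈ Set.Ico 0 T, (1 + k * τ) • v τ + k • γ τ = v 0 + k • γ 0 := by
    have hconst : ∀ τ ∈ Set.Ico 0 T,
        HasDerivWithinAt (fun τ => (1 + k * τ) • v τ + k • γ τ) 0 (Set.Ico 0 T) τ := by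
      intro τ hτ
      refine (((hlin τ).smul (h.hasDerivWithinAt_velocity (uniqueDiffOn_Ico 0 T) hτ)).add
        ((h.hasDerivWithinAt hτ).const_smul k)).congr_deriv ?_
      have hzero : (1 + k * τ) * (-2 * funk (γ τ) (v τ)) + k + k = 0 := by
        linear_combination -2 * h.funk_velocity hτ hk
      rw [smul_smul, ← add_smul, ← add_smul, hzero, zero_smul]
    intro τ hτ
    simpa using eq_of_hasDerivWithinAt_zero (convex_Ico 0 T) hconst h0 hτ
  have hconst : ∀ τ ∈ Set.Ico 0 T, HasDerivWithinAt
      (fun τ => (1 + k * τ) • γ τ - τ • (v 0 + k • γ 0)) 0 (Set.Ico 0 T) τ := by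
    intro τ hτ
    refine (((hlin τ).smul (h.hasDerivWithinAt hτ)).sub
      ((hasDerivWithinAt_id τ _).smul_const _)).congr_deriv ?_
    rw [one_smul, sub_eq_zero]
    exact hslope τ hτ
  have heq := eq_of_hasDerivWithinAt_zero (convex_Ico 0 T) hconst h0 ht
  simpa [sub_eq_iff_eq_add] using heq

end IsGeodesicOn

theorem forwardComplete_berwald : ForwardComplete (unitBall n) (berwald n) := by
  intro γ h
  have hx : ‖γ 0‖ < 1 := mem_ball_zero_iff.1 (h.mapsTo ⟨le_rfl, one_pos⟩)
  refine ⟨_, isGeodesicOn_ray hx (derivWithin γ (Set.Ico 0 1) 0), fun t ht => ?_⟩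
  have hpos : 0 < 1 + funk (γ 0) (derivWithin γ (Set.Ico 0 1) 0) * t :=
    add_pos_of_pos_of_nonneg one_pos (mul_nonneg (funk_nonneg hx _) ht.1)
  refine smul_right_injective _ hpos.ne' ((h.smul_eq ht rfl).trans ?_)
  beta_reduce
  rw [smul_add _ (γ 0), smul_smul, mul_div_cancel₀ _ hpos.ne']
  module

theorem isCartanHadamard_berwald : IsCartanHadamard (unitBall n) (berwald n) where
  finsler := isFinslerManifold_berwald
  simplyConnected :=
    have : ContractibleSpace (unitBall n) :=
      (convex_ball (0 : Eu n) 1).contractibleSpace ⟨0, by simp⟩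
    SimplyConnectedSpace.ofContractible _
  forwardComplete := forwardComplete_berwald
  flagCurvature_nonpos x hx y v hyv := (isFlat_berwald x hx y v hyv).le

/-! ### Minkowski norms and the Legendre transformation -/

section Minkowski

variable {V : Type*} [NormedAddCommGroup V] [NormedSpace ℝ V] {φ : V → ℝ} {y : V}

lemma exists_forall_ne_zero_le_of_map_smul [FiniteDimensional ℝ V] [Nontrivial V] {f : V → ℝ}
    (hf : ContinuousOn f {0}ᶜ) (hsmul : ∀ (c : ℝ) y, 0 < c → f (c • y) = f y) :
    ∃ y₀, y₀ ≠ 0 ∧ ∀ w, w ≠ 0 → f w ≤ f y₀ := by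
  have hne : Metric.sphere (0 : V) 1 ⊆ {0}ᶜ := fun w hw =>
    ne_zero_of_mem_unit_sphere ⟨w, hw⟩
  obtain ⟨y₀, hy₀, hmax⟩ := (isCompact_sphere (0 : V) 1).exists_isMaxOn
    (NormedSpace.sphere_nonempty.2 zero_le_one) (hf.mono hne)
  refine ⟨y₀, hne hy₀, fun w hw => ?_⟩
  rw [← hsmul ‖w‖⁻¹ w (inv_pos.2 (norm_pos_iff.2 hw))]
  exact hmax (by simpa using norm_smul_inv_norm (𝕜 := ℝ) hw)

namespace IsMinkowskiNorm

lemma map_zero (hφ : IsMinkowskiNorm φ) : φ 0 = 0 :=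
  (hφ.eq_zero_iff 0).2 rfl

lemma pos (hφ : IsMinkowskiNorm φ) (hy : y ≠ 0) : 0 < φ y :=
  (hφ.nonneg y).lt_of_ne' (mt (hφ.eq_zero_iff y).1 hy)

lemma contDiffAt (hφ : IsMinkowskiNorm φ) (hy : y ≠ 0) : ContDiffAt ℝ ∞ φ y :=
  hφ.smooth.contDiffAt (isOpen_compl_singleton.mem_nhds hy)

lemma exists_map_neg_le [FiniteDimensional ℝ V] (hφ : IsMinkowskiNorm φ) :
    ∃ C, ∀ w, φ (-w) ≤ C * φ w := by
  rcases subsingleton_or_nontrivial V with _ | _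
  · exact ⟨0, fun w => by simp [Subsingleton.elim (-w) 0, hφ.map_zero]⟩
  have hcont : ContinuousOn (fun w => φ (-w) / φ w) {0}ᶜ :=
    (hφ.smooth.continuousOn.comp continuousOn_neg fun w hw => neg_ne_zero.2 hw).div
      hφ.smooth.continuousOn fun w hw => (hφ.pos hw).ne'
  obtain ⟨y₀, -, hmax⟩ := exists_forall_ne_zero_le_of_map_smul hcont fun c y hc => by
    rw [← smul_neg, hφ.posHomogeneous c _ hc, hφ.posHomogeneous c _ hc,
      mul_div_mul_left _ _ hc.ne']
  refine ⟨φ (-y₀) / φ y₀, fun w => ?_⟩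
  rcases eq_or_ne w 0 with rfl | hw
  · simp [hφ.map_zero]
  · exact (div_le_iff₀ (hφ.pos hw)).1 (hmax w hw)

/-- The supporting hyperplanes of the indicatrix `{φ = 1}` have all directions. -/
lemma exists_eq_smul_fderiv [FiniteDimensional ℝ V] (hφ : IsMinkowskiNorm φ) {η : V →L[ℝ] ℝ}
    (hη : η ≠ 0) : ∃ M : ℝ, 0 < M ∧ ∃ y, y ≠ 0 ∧ η = M • fderiv ℝ φ y := by
  obtain ⟨v, hv⟩ : ∃ v, 0 < η v := by
    obtain ⟨v, hv⟩ := DFunLike.ne_iff.1 hη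
    rcases lt_or_gt_of_ne hv with h | h
    · exact ⟨-v, by simpa using h⟩
    · exact ⟨v, h⟩
  have hv0 : v ≠ 0 := by rintro rfl; simp at hv
  have : Nontrivial V := nontrivial_of_ne v 0 hv0
  have hcont : ContinuousOn (fun w => η w / φ w) {0}ᶜ :=
    η.continuous.continuousOn.div hφ.smooth.continuousOn fun w hw => (hφ.pos hw).ne'
  obtain ⟨y, hy, hmax⟩ := exists_forall_ne_zero_le_of_map_smul hcont fun c y hc => by
    rw [hφ.posHomogeneous c y hc, map_smul, smul_eq_mul, mul_div_mul_left _ _ hc.ne']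
  set M := η y / φ y with hM
  refine ⟨M, (div_pos hv (hφ.pos hv0)).trans_le (hmax v hv0), y, hy, ?_⟩
  have hle (w : V) : η w - M * φ w ≤ 0 := by
    rcases eq_or_ne w 0 with rfl | hw
    · simp [hφ.map_zero]
    · exact sub_nonpos.2 ((div_le_iff₀ (hφ.pos hw)).1 (hmax w hw))
  have heq : η y - M * φ y = 0 := by rw [hM, div_mul_cancel₀ _ (hφ.pos hy).ne', sub_self]
  have hcrit : fderiv ℝ (fun w => η w - M * φ w) y = 0 :=
    IsLocalMax.fderiv_eq_zero (.of_forall fun w => (hle w).trans_eq heq.symm)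
  have hd : DifferentiableAt ℝ φ y := (hφ.contDiffAt hy).differentiableAt (by simp)
  rw [fderiv_fun_sub η.differentiableAt (hd.const_mul M), fderiv_const_mul hd,
    ContinuousLinearMap.fderiv] at hcrit
  exact sub_eq_zero.1 hcrit

lemma fundTensor_surjective [FiniteDimensional ℝ V] (hφ : IsMinkowskiNorm φ) :
    Function.Surjective fun y => fundTensor φ y y := by
  intro η
  rcases eq_or_ne η 0 with rfl | hη
  · exact ⟨0, by simp⟩
  obtain ⟨M, hM, y, hy, rfl⟩ := hφ.exists_eq_smul_fderiv hη
  have hs : 0 < M / φ y := div_pos hM (hφ.pos hy)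
  refine ⟨(M / φ y) • y, ContinuousLinearMap.ext fun v => ?_⟩
  have hC2 := (hφ.contDiffAt (smul_ne_zero hs.ne' hy)).of_le (m := 2) (by norm_cast)
  rw [hφ.posHomogeneous.fundTensor_self hC2, hφ.posHomogeneous.fderiv_smul hs,
    hφ.posHomogeneous _ _ hs, div_mul_cancel₀ _ (hφ.pos hy).ne']
  rfl

variable {F : Eu n → Eu n → ℝ} {x : Eu n}

lemma legendre_gradient (hF : IsMinkowskiNorm (F x)) (f : Eu n → ℝ) :
    legendre F x (gradient F f x) = fderiv ℝ f x :=
  Function.invFun_eq (hF.fundTensor_surjective _)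

lemma map_gradient_le (hF : IsMinkowskiNorm (F x)) {f : Eu n → ℝ} {M : ℝ} (hM : 0 ≤ M)
    (h : ∀ y, fderiv ℝ f x y ≤ M * F x y) : F x (gradient F f x) ≤ M := by
  rcases eq_or_ne (gradient F f x) 0 with h0 | h0
  · rwa [h0, hF.map_zero]
  have hC2 := (hF.contDiffAt h0).of_le (m := 2) (by norm_cast)
  have hg := h (gradient F f x)
  rw [← hF.legendre_gradient f, legendre, hF.posHomogeneous.fundTensor_self_self hC2, sq] at hg
  exact le_of_mul_le_mul_right hg (hF.pos h0)

end IsMinkowskiNorm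

end Minkowski

/-! ### Pointwise estimates -/

section Pointwise

variable {x : Eu n}

lemma berwald_nonneg (hx : ‖x‖ < 1) (y : Eu n) : 0 ≤ berwald n x y :=
  (isMinkowskiNorm_berwald hx).nonneg y

lemma norm_le_four_mul_berwald (hx : ‖x‖ < 1) (y : Eu n) : ‖y‖ ≤ 4 * berwald n x y := by
  rcases eq_or_ne y 0 with rfl | hy
  · simp
  have hΘ := funk_pos hx hy
  have hq := exitGap_pos hx hy
  have hu := norm_exitPoint hx hy
  have hchord : ‖exitPoint x y - x‖ ≤ 2 :=
    (norm_sub_le _ _).trans (by linarith)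
  have hgap : exitGap x y ≤ 2 := by
    have := (abs_le.1 (abs_real_inner_le_norm x (exitPoint x y))).1
    rw [hu] at this
    unfold exitGap
    linarith
  calc ‖y‖ = funk x y * ‖exitPoint x y - x‖ := by
        conv_lhs => rw [← smul_exitPoint_sub hx hy, norm_smul, Real.norm_of_nonneg hΘ.le]
    _ ≤ funk x y * 2 := by gcongr
    _ = 4 * (funk x y / 2) := by ring
    _ ≤ 4 * berwald n x y := by rw [berwald_eq hx hy]; gcongr

lemma inner_le_mul_berwald (hx : ‖x‖ < 1) (y : Eu n) :
    inner ℝ x y ≤ (1 - ‖x‖ ^ 2) ^ 2 * berwald n x y := by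
  rcases eq_or_ne y 0 with rfl | hy
  · simp
  have hΘ := funk_pos hx hy
  have hq := exitGap_pos hx hy
  rw [berwald_eq hx hy, inner_self_left hx hy, mul_div_assoc', le_div_iff₀ hq]
  nlinarith [sq_nonneg ((1 - ‖x‖ ^ 2) - 2 * exitGap x y), sq_nonneg (1 - ‖x‖ ^ 2)]

lemma berwald_gradient_le_norm (hx : ‖x‖ < 1) (f : Eu n → ℝ) :
    berwald n x (gradient (berwald n) f x) ≤ 4 * ‖fderiv ℝ f x‖ := by
  refine (isMinkowskiNorm_berwald hx).map_gradient_le (by positivity) fun y => ?_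
  calc fderiv ℝ f x y ≤ ‖fderiv ℝ f x‖ * ‖y‖ := (le_abs_self _).trans ((fderiv ℝ f x).le_opNorm y)
    _ ≤ ‖fderiv ℝ f x‖ * (4 * berwald n x y) := by gcongr; exact norm_le_four_mul_berwald hx y
    _ = 4 * ‖fderiv ℝ f x‖ * berwald n x y := by ring

lemma berwald_smul_left {t : ℝ} (ht : 1 + t * ‖x‖ ≠ 0) :
    berwald n (t • x) x = ‖x‖ / (1 - t * ‖x‖) ^ 2 := by
  rcases eq_or_ne x 0 with rfl | hx0
  · simp
  have hx := norm_pos_iff.2 hx0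
  have hnorm : ‖t • x‖ ^ 2 = t ^ 2 * ‖x‖ ^ 2 := by
    rw [norm_smul, mul_pow, Real.norm_eq_abs, sq_abs]
  have hinner : inner ℝ (t • x) x = t * ‖x‖ ^ 2 := by
    rw [real_inner_smul_left, real_inner_self_eq_norm_sq]
  have hdisc : disc (t • x) x = ‖x‖ ^ 2 := by
    rw [disc, hnorm, hinner]
    ring
  rw [berwald_eq_disc, hdisc, Real.sqrt_sq hx.le, hnorm, hinner,
    show 1 - t ^ 2 * ‖x‖ ^ 2 = (1 - t * ‖x‖) * (1 + t * ‖x‖) by ring]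
  rw [mul_comm t] at ht ⊢
  field_simp

lemma berwald_self : berwald n x x = ‖x‖ / (1 - ‖x‖) ^ 2 := by
  simpa using berwald_smul_left (x := x) (t := 1) (by positivity)

lemma berwald_neg_self (hx : ‖x‖ < 1) : berwald n x (-x) = ‖x‖ / (1 + ‖x‖) ^ 2 := by
  simpa using berwald_smul_left (x := -x) (t := -1) (by rw [norm_neg]; linarith)

end Pointwise

/-! ### Infinite reversibility -/

lemma exists_mul_berwald_lt (hn : 0 < n) (C : ℝ) :
    ∃ x ∈ unitBall n, ∃ y, y ≠ 0 ∧ C * berwald n x y < berwald n x (-y) := by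
  have : Nonempty (Fin n) := ⟨⟨0, hn⟩⟩
  have hlim : ∀ᶠ t : ℝ in 𝓝[<] 1, C * (1 - t) ^ 2 < (1 + t) ^ 2 :=
    nhdsWithin_le_nhds (ContinuousAt.eventually_lt (by fun_prop) (by fun_prop) (by norm_num))
  obtain ⟨t, ht, ht0, ht1⟩ := (hlim.and (Ioo_mem_nhdsLT zero_lt_one)).exists
  obtain ⟨x, rfl⟩ := exists_norm_eq (Eu n) ht0.le
  refine ⟨x, mem_ball_zero_iff.2 ht1, -x, neg_ne_zero.2 (norm_pos_iff.1 ht0), ?_⟩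
  rw [neg_neg, berwald_neg_self ht1, berwald_self, mul_div_assoc', div_lt_div_iff₀ (by positivity)
    (pow_pos (sub_pos.2 ht1) 2)]
  calc C * ‖x‖ * (1 - ‖x‖) ^ 2 = ‖x‖ * (C * (1 - ‖x‖) ^ 2) := by ring
    _ < ‖x‖ * (1 + ‖x‖) ^ 2 := by gcongr

theorem reversibility_berwald (hn : 0 < n) : reversibility (unitBall n) (berwald n) = ⊤ := by
  refine ENNReal.eq_top_of_forall_nnreal_le fun C => ?_
  obtain ⟨x, hx, y, hy, h⟩ := exists_mul_berwald_lt hn C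
  have hpos := berwald_pos (mem_ball_zero_iff.1 hx) hy
  calc (C : ℝ≥0∞) = ENNReal.ofReal C := ENNReal.ofReal_coe_nnreal.symm
    _ ≤ ENNReal.ofReal (berwald n x (-y) / berwald n x y) :=
        ENNReal.ofReal_le_ofReal ((le_div_iff₀ hpos).2 h.le)
    _ ≤ reversibility (unitBall n) (berwald n) :=
        le_iSup₂_of_le x hx (le_iSup₂_of_le y hy le_rfl)

theorem not_exists_isIsometricEmbedding (hn : 0 < n) {V : Type*} [NormedAddCommGroup V]
    [NormedSpace ℝ V] [FiniteDimensional ℝ V] {φ : V → ℝ} (hφ : IsMinkowskiNorm φ) :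
    ¬ ∃ f, IsIsometricEmbedding (unitBall n) (berwald n) φ f := by
  rintro ⟨f, hf⟩
  obtain ⟨C, hC⟩ := hφ.exists_map_neg_le
  obtain ⟨x, hx, y, -, hlt⟩ := exists_mul_berwald_lt hn C
  rw [← hf.isometric x hx, ← hf.isometric x hx, map_neg] at hlt
  exact (hC _).not_gt hlt

/-! ### The distance from the centre -/

lemma enorm_sub_le_lintegral_deriv_of_lipschitzOnWith {E : Type*} [NormedAddCommGroup E]
    [NormedSpace ℝ E] [FiniteDimensional ℝ E] {ζ : ℝ → E} {K : NNReal} {a b : ℝ} (hab : a ≤ b)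
    (hζ : LipschitzOnWith K ζ (Set.Icc a b)) :
    ‖ζ b - ζ a‖ₑ ≤ ∫⁻ t in Set.Icc a b, ‖deriv ζ t‖ₑ := by
  obtain ⟨L, hL, hLval⟩ := exists_dual_vector'' ℝ (ζ b - ζ a)
  have hL_le (w : E) : ‖L w‖ₑ ≤ ‖w‖ₑ :=
    enorm_le_iff_norm_le.2 ((L.le_of_opNorm_le hL w).trans_eq (one_mul _))
  have hac : AbsolutelyContinuousOnInterval (fun t => L (ζ t)) a b :=
    ((L.lipschitz.comp_lipschitzOnWith hζ).mono
      (Set.uIcc_of_le hab).subset).absolutelyContinuousOnInterval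
  have hdiff : ∀ᵐ t ∂volume.restrict (Set.Ioo a b), DifferentiableAt ℝ ζ t := by
    rw [ae_restrict_iff' measurableSet_Ioo]
    filter_upwards [hζ.ae_differentiableWithinAt_of_mem (μ := volume)] with t ht hmem
    exact (ht (Set.Ioo_subset_Icc_self hmem)).differentiableAt (Icc_mem_nhds hmem.1 hmem.2)
  rw [← restrict_Ioo_eq_restrict_Icc]
  calc ‖ζ b - ζ a‖ₑ = ‖∫ t in Set.Ioo a b, deriv (fun t => L (ζ t)) t‖ₑ := by
        rw [← integral_Ioc_eq_integral_Ioo, ← intervalIntegral.integral_of_le hab,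
          hac.integral_deriv_eq_sub, ← map_sub, hLval]
        simp
    _ ≤ ∫⁻ t in Set.Ioo a b, ‖deriv (fun t => L (ζ t)) t‖ₑ := enorm_integral_le_lintegral_enorm _
    _ ≤ ∫⁻ t in Set.Ioo a b, ‖deriv ζ t‖ₑ := by
        refine lintegral_mono_ae ?_
        filter_upwards [hdiff] with t ht
        exact (L.hasFDerivAt.comp_hasDerivAt t ht.hasDerivAt).deriv ▸ hL_le _

lemma ofReal_norm_div_four_le_edist (x : Eu n) :
    ENNReal.ofReal (‖x‖ / 4) ≤ edist (unitBall n) (berwald n) 0 x := by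
  refine le_iInf₂ fun ζ ⟨⟨K, hK⟩, hmaps, h0, h1⟩ => ?_
  calc ENNReal.ofReal (‖x‖ / 4) = ENNReal.ofReal (1 / 4) * ‖ζ 1 - ζ 0‖ₑ := by
        rw [h0, h1, sub_zero, ← ofReal_norm, ← ENNReal.ofReal_mul (by norm_num),
          one_div_mul_eq_div]
    _ ≤ ENNReal.ofReal (1 / 4) * ∫⁻ t in Set.Icc (0 : ℝ) 1, ‖deriv ζ t‖ₑ := by
        gcongr
        exact enorm_sub_le_lintegral_deriv_of_lipschitzOnWith zero_le_one hK
    _ = ∫⁻ t in Set.Icc (0 : ℝ) 1, ENNReal.ofReal (1 / 4) * ‖deriv ζ t‖ₑ :=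
        (lintegral_const_mul' _ _ ENNReal.ofReal_ne_top).symm
    _ ≤ ∫⁻ t in Set.Icc (0 : ℝ) 1, ENNReal.ofReal (berwald n (ζ t) (deriv ζ t)) := by
        refine setLIntegral_mono' measurableSet_Icc fun t ht => ?_
        rw [← ofReal_norm, ← ENNReal.ofReal_mul (by norm_num)]
        have := norm_le_four_mul_berwald (mem_ball_zero_iff.1 (hmaps ht)) (deriv ζ t)
        exact ENNReal.ofReal_le_ofReal (by linarith)

lemma lintegral_div_one_sub_mul_sq {r : ℝ} (hr0 : 0 ≤ r) (hr1 : r < 1) :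
    ∫⁻ t in Set.Icc (0 : ℝ) 1, ENNReal.ofReal (r / (1 - t * r) ^ 2) =
      ENNReal.ofReal (r / (1 - r)) := by
  have hpos : ∀ t ∈ Set.Icc (0 : ℝ) 1, 0 < 1 - t * r := fun t ht => by nlinarith [ht.1, ht.2]
  have hcont : ContinuousOn (fun t : ℝ => r / (1 - t * r) ^ 2) (Set.Icc 0 1) :=
    continuousOn_const.div (by fun_prop) fun t ht => (pow_pos (hpos t ht) 2).ne'
  have hderiv : ∀ t ∈ Set.uIcc (0 : ℝ) 1,
      HasDerivAt (fun t : ℝ => (1 - t * r)⁻¹) (r / (1 - t * r) ^ 2) t := by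
    intro t ht
    rw [Set.uIcc_of_le zero_le_one] at ht
    simpa using (((hasDerivAt_id t).mul_const r).const_sub 1).fun_inv (hpos t ht).ne'
  rw [← ofReal_integral_eq_lintegral_ofReal hcont.integrableOn_Icc
      (.of_forall fun t => by positivity), integral_Icc_eq_integral_Ioc,
    ← intervalIntegral.integral_of_le zero_le_one,
    intervalIntegral.integral_eq_sub_of_hasDerivAt hderiv
      (ContinuousOn.intervalIntegrable (by rwa [Set.uIcc_of_le zero_le_one]))]
  have : 1 - r ≠ 0 := (sub_pos.2 hr1).ne'
  congr 1
  field_simp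
  ring

lemma edist_le_ofReal {x : Eu n} (hx : ‖x‖ < 1) :
    edist (unitBall n) (berwald n) 0 x ≤ ENNReal.ofReal (‖x‖ / (1 - ‖x‖)) := by
  have hlip : LipschitzWith ‖x‖₊ (fun t : ℝ => t • x) :=
    LipschitzWith.of_dist_le_mul fun s t => by
      rw [dist_eq_norm, ← sub_smul, norm_smul, dist_eq_norm, mul_comm, coe_nnnorm]
  have hmaps : Set.MapsTo (fun t : ℝ => t • x) (Set.Icc 0 1) (unitBall n) := fun t ht => by
    rw [mem_ball_zero_iff, norm_smul, Real.norm_of_nonneg ht.1]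
    exact (mul_le_of_le_one_left (norm_nonneg x) ht.2).trans_lt hx
  refine (iInf₂_le (fun t : ℝ => t • x)
    ⟨⟨_, hlip.lipschitzOnWith⟩, hmaps, zero_smul ℝ x, one_smul ℝ x⟩).trans_eq ?_
  rw [← lintegral_div_one_sub_mul_sq (norm_nonneg x) hx]
  refine setLIntegral_congr_fun measurableSet_Icc fun t ht => ?_
  have hderiv : deriv (fun t : ℝ => t • x) t = x := by
    simpa using ((hasDerivAt_id t).smul_const x).deriv
  have : 0 < 1 + t * ‖x‖ := by nlinarith [ht.1, norm_nonneg x]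
  simp only [hderiv, berwald_smul_left this.ne']

/-! ### Finiteness of the energy and of the weighted integrals -/

lemma ennreal_rpow_le_rpow_of_exponent_nonpos {a b : ℝ≥0∞} {z : ℝ} (h : a ≤ b) (hz : z ≤ 0) :
    b ^ z ≤ a ^ z := by
  rw [← neg_neg z, ENNReal.rpow_neg, ENNReal.rpow_neg a]
  exact ENNReal.inv_le_inv.2 (ENNReal.rpow_le_rpow h (neg_nonneg.2 hz))

lemma ennreal_rpow_pos_of_exponent_nonpos {a : ℝ≥0∞} {z : ℝ} (h : a ≠ ⊤) (hz : z ≤ 0) :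
    0 < a ^ z := by
  rw [← neg_neg z, ENNReal.rpow_neg]
  exact ENNReal.inv_pos.2 (ENNReal.rpow_ne_top_of_nonneg (neg_nonneg.2 hz) h)

namespace IsTestFunction

variable {U : Set (Eu n)} {f : Eu n → ℝ}

lemma exists_bound (hf : IsTestFunction U f) : ∃ C, ∀ x, ‖f x‖ₑ ≤ ENNReal.ofReal C := by
  obtain ⟨C, hC⟩ := hf.smooth.continuous.bounded_above_of_compact_support hf.hasCompactSupport
  exact ⟨C, fun x => ofReal_norm (f x) ▸ ENNReal.ofReal_le_ofReal (hC x)⟩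

lemma exists_bound_fderiv (hf : IsTestFunction U f) : ∃ C, ∀ x, ‖fderiv ℝ f x‖ ≤ C :=
  (hf.smooth.continuous_fderiv (by simp)).bounded_above_of_compact_support
    (hf.hasCompactSupport.fderiv (𝕜 := ℝ))

end IsTestFunction

section Finiteness

variable {p q : ℝ} {f : Eu n → ℝ}

lemma energy_berwald_lt_top (hp : 0 < p) (hf : IsTestFunction (unitBall n) f) :
    energy (unitBall n) (berwald n) p f < ⊤ := by
  obtain ⟨C, hC⟩ := hf.exists_bound_fderiv
  have hbound : ∀ x ∈ unitBall n,
      ENNReal.ofReal (berwald n x (gradient (berwald n) f x)) ^ p ≤ ENNReal.ofReal (4 * C) ^ p := by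
    intro x hx
    have hgrad := berwald_gradient_le_norm (mem_ball_zero_iff.1 hx) f
    gcongr
    linarith [hC x]
  exact setLIntegral_lt_top_of_le_nnreal measure_ball_lt_top.ne
    ⟨(ENNReal.ofReal (4 * C) ^ p).toNNReal, fun x hx => (hbound x hx).trans_eq
      (ENNReal.coe_toNNReal (ENNReal.rpow_ne_top_of_nonneg hp.le ENNReal.ofReal_ne_top)).symm⟩

lemma lintegral_edist_rpow_lt_top (hn : 0 < n) (hq : q ≤ 0) (hqn : -(n : ℝ) < q) :
    ∫⁻ x in unitBall n, edist (unitBall n) (berwald n) 0 x ^ q < ⊤ := by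
  have : Nonempty (Fin n) := ⟨⟨0, hn⟩⟩
  have hint : IntegrableOn (fun x : Eu n => (‖x‖ / 4) ^ q) (unitBall n) := by
    refine integrableOn_ball_of_norm_le_rpow (C := (1 / 4) ^ q) (α := -q) (by simpa using! hn)
      (by simp; linarith) (.of_forall fun x => ?_) ?_
    · rw [neg_neg, ← Real.mul_rpow (by norm_num) (norm_nonneg x), one_div_mul_eq_div,
        Real.norm_of_nonneg (by positivity)]
    · exact ((measurable_norm.div_const 4).pow_const q).aestronglyMeasurable
  refine lt_of_le_of_lt (lintegral_mono_ae ?_) hint.lintegral_lt_top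
  filter_upwards [ae_restrict_of_ae (Measure.ae_ne volume (0 : Eu n))] with x hx
  rw [← ENNReal.ofReal_rpow_of_pos (by positivity)]
  exact ennreal_rpow_le_rpow_of_exponent_nonpos (ofReal_norm_div_four_le_edist x) hq

lemma weighted_berwald_lt_top_of_nonpos (hn : 0 < n) (hp : 0 ≤ p) (hq : q ≤ 0)
    (hqn : -(n : ℝ) < q) (hf : IsTestFunction (unitBall n) f) :
    weighted (unitBall n) (berwald n) p q f < ⊤ := by
  obtain ⟨C, hC⟩ := hf.exists_bound
  have hCp : ENNReal.ofReal C ^ p ≠ ⊤ := ENNReal.rpow_ne_top_of_nonneg hp ENNReal.ofReal_ne_top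
  calc weighted (unitBall n) (berwald n) p q f
      ≤ ∫⁻ x in unitBall n, ENNReal.ofReal C ^ p * edist (unitBall n) (berwald n) 0 x ^ q :=
        lintegral_mono fun x => by gcongr; exact hC x
    _ = ENNReal.ofReal C ^ p * ∫⁻ x in unitBall n, edist (unitBall n) (berwald n) 0 x ^ q :=
        lintegral_const_mul' _ _ hCp
    _ < ⊤ := ENNReal.mul_lt_top hCp.lt_top (lintegral_edist_rpow_lt_top hn hq hqn)

lemma weighted_berwald_lt_top_of_nonneg (hp : 0 < p) (hq : 0 ≤ q)
    (hf : IsTestFunction (unitBall n) f) : weighted (unitBall n) (berwald n) p q f < ⊤ := by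
  obtain ⟨C, hC⟩ := hf.exists_bound
  obtain ⟨R, hR, hsub⟩ := exists_lt_subset_ball (isClosed_tsupport f) hf.tsupport_subset
  have hfinite : ENNReal.ofReal C ^ p * ENNReal.ofReal (1 / (1 - R)) ^ q ≠ ⊤ :=
    ENNReal.mul_ne_top (ENNReal.rpow_ne_top_of_nonneg hp.le ENNReal.ofReal_ne_top)
      (ENNReal.rpow_ne_top_of_nonneg hq ENNReal.ofReal_ne_top)
  refine setLIntegral_lt_top_of_le_nnreal measure_ball_lt_top.ne
    ⟨(ENNReal.ofReal C ^ p * ENNReal.ofReal (1 / (1 - R)) ^ q).toNNReal, fun x hx => ?_⟩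
  rw [ENNReal.coe_toNNReal hfinite]
  by_cases hfx : f x = 0
  · simp [hfx, ENNReal.zero_rpow_of_pos hp]
  have hxR : ‖x‖ < R := mem_ball_zero_iff.1 (hsub (subset_tsupport f hfx))
  have hedist : edist (unitBall n) (berwald n) 0 x ≤ ENNReal.ofReal (1 / (1 - R)) := by
    refine (edist_le_ofReal (mem_ball_zero_iff.1 hx)).trans (ENNReal.ofReal_le_ofReal ?_)
    exact div_le_div₀ zero_le_one (by linarith) (by linarith) (by linarith)
  gcongr
  exact hC x

lemma weighted_berwald_lt_top (hn : 0 < n) (hp : 0 < p) (hqn : -(n : ℝ) < q)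
    (hf : IsTestFunction (unitBall n) f) : weighted (unitBall n) (berwald n) p q f < ⊤ := by
  rcases le_total q 0 with hq | hq
  · exact weighted_berwald_lt_top_of_nonpos hn hp.le hq hqn hf
  · exact weighted_berwald_lt_top_of_nonneg hp hq hf

lemma weighted_berwald_pos (hp : 0 < p) (hq : q ≤ 0) (hf : IsTestFunction (unitBall n) f)
    (hf0 : f ≠ 0) : 0 < weighted (unitBall n) (berwald n) p q f := by
  set g : Eu n → ℝ≥0∞ := fun x => ‖f x‖ₑ ^ p * ENNReal.ofReal (‖x‖ / (1 - ‖x‖)) ^ q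
  have hmeas : Measurable g := by
    have := hf.smooth.continuous.measurable
    fun_prop
  have hle : ∫⁻ x in unitBall n, g x ≤ weighted (unitBall n) (berwald n) p q f := by
    refine setLIntegral_mono' measurableSet_ball fun x hx => ?_
    exact mul_le_mul_right (ennreal_rpow_le_rpow_of_exponent_nonpos
      (edist_le_ofReal (mem_ball_zero_iff.1 hx)) hq) _
  have hsub : Function.support f ⊆ Function.support g ∩ unitBall n := fun x hx =>
    ⟨mul_ne_zero (ENNReal.rpow_pos_of_nonneg (enorm_pos.2 hx) hp.le).ne'
      (ennreal_rpow_pos_of_exponent_nonpos ENNReal.ofReal_ne_top hq).ne',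
      hf.tsupport_subset (subset_tsupport f hx)⟩
  refine lt_of_lt_of_le ((setLIntegral_pos_iff hmeas).2 ?_) hle
  exact (hf.smooth.continuous.isOpen_support.measure_pos _
    (Function.support_nonempty_iff.2 hf0)).trans_le (measure_mono hsub)

end Finiteness

/-! ### Cut-off functions of small energy -/

section CutOff

variable {C p q ε : ℝ} {x : Eu n}

/-- The cut-off function used as trial function: it is smooth, equal to `-1` where `1 - |x|² ≥ 2ε`
and to `0` where `1 - |x|² ≤ ε`. It has the sign for which its differential points outwards, since
outward covectors have small Berwald norm. -/
def cutoff (n : ℕ) (ε : ℝ) (x : Eu n) : ℝ := -Real.smoothTransition ((1 - ‖x‖ ^ 2) / ε - 1)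

/-- The part of the ball near the boundary that contains the transition region of the cut-off
function of width `ε`. -/
def shell (n : ℕ) (ε : ℝ) : Set (Eu n) := unitBall n ∩ {x | 1 - ‖x‖ ^ 2 ≤ 2 * ε}

lemma exists_deriv_smoothTransition_le :
    ∃ C, 0 ≤ C ∧ ∀ t, deriv Real.smoothTransition t ≤ C := by
  have hc : Continuous (deriv Real.smoothTransition) :=
    (Real.smoothTransition.contDiff (n := 1)).continuous_deriv (by simp)
  have hs : HasCompactSupport (deriv Real.smoothTransition) := by
    refine HasCompactSupport.intro (isCompact_Icc (a := (0 : ℝ)) (b := 1)) fun t ht => ?_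
    rw [Set.mem_Icc, not_and_or, not_le, not_le] at ht
    rcases ht with ht | ht
    · have : Real.smoothTransition =ᶠ[𝓝 t] fun _ => 0 := by
        filter_upwards [eventually_lt_nhds ht] with s hs
        exact Real.smoothTransition.zero_of_nonpos hs.le
      rw [this.deriv_eq, deriv_const]
    · have : Real.smoothTransition =ᶠ[𝓝 t] fun _ => 1 := by
        filter_upwards [eventually_gt_nhds ht] with s hs
        exact Real.smoothTransition.one_of_one_le hs.le
      rw [this.deriv_eq, deriv_const]
  obtain ⟨C, hC⟩ := hc.bounded_above_of_compact_support hs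
  exact ⟨C, (norm_nonneg _).trans (hC 0), fun t => (le_abs_self _).trans (hC t)⟩

lemma contDiff_cutoff (ε : ℝ) : ContDiff ℝ ∞ (cutoff n ε) :=
  ((Real.smoothTransition.contDiff (n := ⊤)).comp
    (((contDiff_const.sub (contDiff_id.norm_sq ℝ)).div_const ε).sub contDiff_const)).neg

lemma cutoff_eq_zero (hε : 0 < ε) (h : 1 - ‖x‖ ^ 2 ≤ ε) : cutoff n ε x = 0 := by
  rw [cutoff, Real.smoothTransition.zero_of_nonpos, neg_zero]
  rwa [sub_nonpos, div_le_one hε]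

lemma cutoff_eq_neg_one (hε : 0 < ε) (h : 2 * ε ≤ 1 - ‖x‖ ^ 2) : cutoff n ε x = -1 := by
  rw [cutoff, Real.smoothTransition.one_of_one_le]
  rw [le_sub_iff_add_le, le_div_iff₀ hε]
  linarith

lemma enorm_cutoff_le_one (ε : ℝ) (x : Eu n) : ‖cutoff n ε x‖ₑ ≤ 1 := by
  rw [← ofReal_norm, cutoff, norm_neg, Real.norm_of_nonneg (Real.smoothTransition.nonneg _)]
  exact ENNReal.ofReal_le_one.2 (Real.smoothTransition.le_one _)

lemma isTestFunction_cutoff (hε : 0 < ε) : IsTestFunction (unitBall n) (cutoff n ε) := by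
  have hball : tsupport (cutoff n ε) ⊆ unitBall n := by
    have hsub : tsupport (cutoff n ε) ⊆ {x | ε ≤ 1 - ‖x‖ ^ 2} := by
      refine closure_minimal (fun x hx => ?_) (isClosed_le continuous_const (by fun_prop))
      by_contra h
      exact hx (cutoff_eq_zero hε (not_le.1 h).le)
    refine hsub.trans fun x (hx : ε ≤ 1 - ‖x‖ ^ 2) => ?_
    rw [mem_ball_zero_iff]
    nlinarith [norm_nonneg x]
  exact ⟨contDiff_cutoff ε, (isCompact_closedBall (0 : Eu n) 1).of_isClosed_subset
    (isClosed_tsupport _) (hball.trans Metric.ball_subset_closedBall), hball⟩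

lemma cutoff_ne_zero (hε : 0 < ε) (h : 2 * ε ≤ 1) : cutoff n ε ≠ 0 := fun h0 => by
  have h1 := cutoff_eq_neg_one (n := n) hε (x := 0) (by simpa using h)
  rw [h0] at h1
  simp at h1

lemma fderiv_cutoff (ε : ℝ) (x y : Eu n) :
    fderiv ℝ (cutoff n ε) x y =
      deriv Real.smoothTransition ((1 - ‖x‖ ^ 2) / ε - 1) * (2 / ε) * inner ℝ x y := by
  have hinner : HasFDerivAt (fun x : Eu n => (1 - ‖x‖ ^ 2) / ε - 1) _ x :=
    (((hasFDerivAt_id x).norm_sq.const_sub 1).mul_const ε⁻¹).sub_const 1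
  have houter := ((Real.smoothTransition.contDiff (n := 1)).differentiable (by simp)
    ((1 - ‖x‖ ^ 2) / ε - 1)).hasDerivAt
  have h := houter.comp_hasFDerivAt x hinner
  rw [HasFDerivAt.fderiv (f := cutoff n ε) h.neg]
  simp only [div_eq_inv_mul, id_eq, ContinuousLinearMap.comp_id, smul_neg, neg_neg, smul_apply,
    coe_innerSL_apply, nsmul_eq_mul, Nat.cast_ofNat, smul_eq_mul]
  ring

lemma berwald_gradient_cutoff_le (hC0 : 0 ≤ C) (hC : ∀ t, deriv Real.smoothTransition t ≤ C)
    (hε : 0 < ε) (hx : x ∈ shell n ε) :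
    berwald n x (gradient (berwald n) (cutoff n ε) x) ≤ 8 * C * ε := by
  have hx1 : ‖x‖ < 1 := mem_ball_zero_iff.1 hx.1
  refine (isMinkowskiNorm_berwald hx1).map_gradient_le (by positivity) fun y => ?_
  set d := deriv Real.smoothTransition ((1 - ‖x‖ ^ 2) / ε - 1)
  have hd0 : 0 ≤ d := Real.smoothTransition.monotone.deriv_nonneg
  have hB := berwald_nonneg hx1 y
  have hsq : (1 - ‖x‖ ^ 2) ^ 2 ≤ (2 * ε) ^ 2 :=
    pow_le_pow_left₀ (one_sub_norm_sq_pos hx1).le hx.2 2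
  calc fderiv ℝ (cutoff n ε) x y = d * (2 / ε) * inner ℝ x y := by rw [fderiv_cutoff]
    _ ≤ d * (2 / ε) * ((1 - ‖x‖ ^ 2) ^ 2 * berwald n x y) := by
        gcongr
        exact inner_le_mul_berwald hx1 y
    _ ≤ C * (2 / ε) * ((2 * ε) ^ 2 * berwald n x y) := by
        gcongr
        exact hC _
    _ = 8 * C * ε * berwald n x y := by
        field_simp
        ring

lemma berwald_gradient_cutoff_nonpos (hε : 0 < ε) (hx : ‖x‖ < 1) (hxs : x ∉ shell n ε) :
    berwald n x (gradient (berwald n) (cutoff n ε) x) ≤ 0 := by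
  refine (isMinkowskiNorm_berwald hx).map_gradient_le le_rfl fun y => ?_
  have hlt : 2 * ε < 1 - ‖x‖ ^ 2 := by
    by_contra! h
    exact hxs ⟨mem_ball_zero_iff.2 hx, h⟩
  have hconst : cutoff n ε =ᶠ[𝓝 x] fun _ => -1 := by
    have hcont : Continuous fun x : Eu n => 1 - ‖x‖ ^ 2 := by fun_prop
    filter_upwards [hcont.continuousAt.eventually (eventually_gt_nhds hlt)] with z hz
    exact cutoff_eq_neg_one hε hz.le
  simp [hconst.fderiv_eq]

lemma measurableSet_shell (ε : ℝ) : MeasurableSet (shell n ε) :=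
  measurableSet_ball.inter (isClosed_le (f := fun x : Eu n => 1 - ‖x‖ ^ 2) (by fun_prop)
    continuous_const).measurableSet

lemma energy_cutoff_le (hC0 : 0 ≤ C) (hC : ∀ t, deriv Real.smoothTransition t ≤ C) (hε : 0 < ε)
    (hp : 0 < p) :
    energy (unitBall n) (berwald n) p (cutoff n ε) ≤
      ENNReal.ofReal (8 * C * ε) ^ p * volume (shell n ε) := by
  calc energy (unitBall n) (berwald n) p (cutoff n ε)
      ≤ ∫⁻ x in unitBall n, (shell n ε).indicator (fun _ => ENNReal.ofReal (8 * C * ε) ^ p) x := by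
        refine setLIntegral_mono' measurableSet_ball fun x hx => ?_
        by_cases hs : x ∈ shell n ε
        · rw [Set.indicator_of_mem hs]
          exact ENNReal.rpow_le_rpow
            (ENNReal.ofReal_le_ofReal (berwald_gradient_cutoff_le hC0 hC hε hs)) hp.le
        · rw [Set.indicator_of_notMem hs, ENNReal.ofReal_of_nonpos
            (berwald_gradient_cutoff_nonpos hε (mem_ball_zero_iff.1 hx) hs),
            ENNReal.zero_rpow_of_pos hp]
    _ ≤ ∫⁻ x, (shell n ε).indicator (fun _ => ENNReal.ofReal (8 * C * ε) ^ p) x :=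
        setLIntegral_le_lintegral _ _
    _ = ENNReal.ofReal (8 * C * ε) ^ p * volume (shell n ε) := by
        rw [lintegral_indicator (measurableSet_shell ε), setLIntegral_const]

lemma tendsto_volume_shell : Tendsto (fun ε => volume (shell n ε)) (𝓝[>] 0) (𝓝 0) := by
  have h := tendsto_measure_biInter_gt (μ := volume) (s := shell n) (a := 0)
    (fun ε _ => (measurableSet_shell ε).nullMeasurableSet)
    (fun i j _ hij x hx => ⟨hx.1, le_trans (b := 2 * i) hx.2 (by gcongr)⟩)
    ⟨1, one_pos, measure_ne_top_of_subset Set.inter_subset_left measure_ball_lt_top.ne⟩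
  have hempty : ⋂ ε > 0, shell n ε = ∅ := by
    refine Set.eq_empty_iff_forall_notMem.2 fun x hx => ?_
    simp only [Set.mem_iInter] at hx
    have h0 := one_sub_norm_sq_pos (mem_ball_zero_iff.1 (hx 1 one_pos).1)
    have h1 : 1 - ‖x‖ ^ 2 ≤ 2 * ((1 - ‖x‖ ^ 2) / 4) := (hx _ (by positivity)).2
    linarith
  rwa [hempty, measure_empty] at h

lemma volume_ball_half_le_weighted_cutoff (hε : 0 < ε) (hε' : ε ≤ 1 / 4) (hq : q ≤ 0) :
    volume (Metric.ball (0 : Eu n) (1 / 2)) ≤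
      weighted (unitBall n) (berwald n) p q (cutoff n ε) := by
  calc volume (Metric.ball (0 : Eu n) (1 / 2)) = ∫⁻ _ in Metric.ball (0 : Eu n) (1 / 2), 1 := by
        simp
    _ ≤ ∫⁻ x in Metric.ball (0 : Eu n) (1 / 2),
          ‖cutoff n ε x‖ₑ ^ p * edist (unitBall n) (berwald n) 0 x ^ q := by
        refine setLIntegral_mono' measurableSet_ball fun x hx => ?_
        have hx' : ‖x‖ < 1 / 2 := mem_ball_zero_iff.1 hx
        have hdist : edist (unitBall n) (berwald n) 0 x ≤ 1 := by
          refine (edist_le_ofReal (by linarith)).trans (ENNReal.ofReal_le_one.2 ?_)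
          rw [div_le_one (by linarith)]
          linarith
        rw [cutoff_eq_neg_one hε (by nlinarith [norm_nonneg x])]
        simpa using ennreal_rpow_le_rpow_of_exponent_nonpos hdist hq
    _ ≤ weighted (unitBall n) (berwald n) p q (cutoff n ε) :=
        lintegral_mono_set (Metric.ball_subset_ball (by norm_num))

lemma weighted_cutoff_le (hp : 0 ≤ p) :
    weighted (unitBall n) (berwald n) p q (cutoff n ε) ≤
      ∫⁻ x in unitBall n, edist (unitBall n) (berwald n) 0 x ^ q :=
  lintegral_mono fun x => mul_le_of_le_one_left' (ENNReal.rpow_le_one (enorm_cutoff_le_one ε x) hp)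

lemma weighted_cutoff_le_of_nonneg (hε : 0 < ε) (hp : 0 < p) (hq : 0 ≤ q) :
    weighted (unitBall n) (berwald n) p q (cutoff n ε) ≤
      ENNReal.ofReal (2 / ε) ^ q * volume (unitBall n) := by
  rw [← setLIntegral_const]
  refine setLIntegral_mono' measurableSet_ball fun x hx => ?_
  have hx' := mem_ball_zero_iff.1 hx
  by_cases h0 : 1 - ‖x‖ ^ 2 ≤ ε
  · simp [cutoff_eq_zero hε h0, ENNReal.zero_rpow_of_pos hp]
  have hdist : edist (unitBall n) (berwald n) 0 x ≤ ENNReal.ofReal (2 / ε) := by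
    refine (edist_le_ofReal hx').trans (ENNReal.ofReal_le_ofReal ?_)
    rw [div_le_div_iff₀ (by linarith) hε]
    nlinarith [norm_nonneg x]
  calc ‖cutoff n ε x‖ₑ ^ p * edist (unitBall n) (berwald n) 0 x ^ q
      ≤ 1 * ENNReal.ofReal (2 / ε) ^ q := by
        gcongr
        exact ENNReal.rpow_le_one (enorm_cutoff_le_one ε x) hp.le
    _ = ENNReal.ofReal (2 / ε) ^ q := one_mul _

end CutOff

/-! ### Failure of the Hardy and uncertainty inequalities -/

section Quotients

variable {p s : ℝ}

lemma conjExponent_pos (hp : 1 < p) : 0 < Real.conjExponent p :=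
  div_pos (by linarith) (by linarith)

lemma neg_lt_conjExponent_mul (hp : 1 < p) (hs : -p + 1 < s) : -p < Real.conjExponent p * s := by
  rw [Real.conjExponent, div_mul_eq_mul_div, lt_div_iff₀ (by linarith)]
  nlinarith

lemma exists_weighted_cutoff_rpow_le (hn : 0 < n) (hp : 1 < p) (hpn : p < n)
    (hs : -p + 1 < s) (hs1 : s ≤ 1) :
    ∃ A : ℝ≥0∞, A ≠ ⊤ ∧ ∀ ε, 0 < ε → ε ≤ 1 / 4 →
      weighted (unitBall n) (berwald n) p (Real.conjExponent p * s) (cutoff n ε) ^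
        (1 / Real.conjExponent p) ≤ ENNReal.ofReal (2 / ε) * A := by
  have hp' := conjExponent_pos hp
  have hi : 0 ≤ 1 / Real.conjExponent p := by positivity
  have hone : ∀ {ε : ℝ}, 0 < ε → ε ≤ 1 / 4 → 1 ≤ ENNReal.ofReal (2 / ε) := fun hε hε' => by
    rw [ENNReal.one_le_ofReal, le_div_iff₀ hε]
    linarith
  rcases le_total s 0 with h0 | h0
  · refine ⟨(∫⁻ x in unitBall n, edist (unitBall n) (berwald n) 0 x ^
      (Real.conjExponent p * s)) ^ (1 / Real.conjExponent p), ?_, fun ε hε hε' => ?_⟩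
    · exact ENNReal.rpow_ne_top_of_nonneg hi (lintegral_edist_rpow_lt_top hn
        (mul_nonpos_of_nonneg_of_nonpos hp'.le h0)
        (by linarith [neg_lt_conjExponent_mul hp hs])).ne
    · exact (ENNReal.rpow_le_rpow (weighted_cutoff_le (by linarith)) hi).trans
        (le_mul_of_one_le_left' (hone hε hε'))
  · refine ⟨volume (unitBall n) ^ (1 / Real.conjExponent p),
      ENNReal.rpow_ne_top_of_nonneg hi measure_ball_lt_top.ne, fun ε hε hε' => ?_⟩
    calc weighted (unitBall n) (berwald n) p (Real.conjExponent p * s) (cutoff n ε) ^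
          (1 / Real.conjExponent p)
        ≤ (ENNReal.ofReal (2 / ε) ^ (Real.conjExponent p * s) * volume (unitBall n)) ^
            (1 / Real.conjExponent p) :=
          ENNReal.rpow_le_rpow (weighted_cutoff_le_of_nonneg hε (by linarith)
            (mul_nonneg hp'.le h0)) hi
      _ = ENNReal.ofReal (2 / ε) ^ s * volume (unitBall n) ^ (1 / Real.conjExponent p) := by
          rw [ENNReal.mul_rpow_of_nonneg _ _ hi, ← ENNReal.rpow_mul, mul_one_div,
            mul_div_cancel_left₀ _ hp'.ne']
      _ ≤ ENNReal.ofReal (2 / ε) * volume (unitBall n) ^ (1 / Real.conjExponent p) := by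
          gcongr
          simpa using ENNReal.rpow_le_rpow_of_exponent_le (hone hε hε') hs1

lemma iInf_testFunction_eq_zero {Q : (Eu n → ℝ) → ℝ≥0∞} {B : ℝ → ℝ≥0∞}
    (hB : Tendsto B (𝓝[>] 0) (𝓝 0)) (hQ : ∀ ε, 0 < ε → ε ≤ 1 / 4 → Q (cutoff n ε) ≤ B ε) :
    ⨅ (f : Eu n → ℝ) (_ : IsTestFunction (unitBall n) f) (_ : f ≠ 0), Q f = 0 := by
  refine le_antisymm (ge_of_tendsto hB ?_) bot_le
  filter_upwards [Ioc_mem_nhdsGT (show (0 : ℝ) < 1 / 4 by norm_num)] with ε ⟨hε, hε'⟩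
  exact (iInf₂_le_of_le (cutoff n ε) (isTestFunction_cutoff hε)
    (iInf_le _ (cutoff_ne_zero hε (by linarith)))).trans (hQ ε hε hε')

theorem iInf_hardy_quotient_eq_zero (hp : 1 < p) :
    ⨅ (f : Eu n → ℝ) (_ : IsTestFunction (unitBall n) f) (_ : f ≠ 0),
      energy (unitBall n) (berwald n) p f / weighted (unitBall n) (berwald n) p (-p) f = 0 := by
  obtain ⟨C, hC0, hC⟩ := exists_deriv_smoothTransition_le
  have hp0 : 0 < p := by linarith
  set V := volume (Metric.ball (0 : Eu n) (1 / 2))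
  have hV0 : V ≠ 0 := (Metric.measure_ball_pos volume _ (by norm_num)).ne'
  have hM : ENNReal.ofReal (8 * C) ^ p ≠ ⊤ :=
    ENNReal.rpow_ne_top_of_nonneg hp0.le ENNReal.ofReal_ne_top
  refine iInf_testFunction_eq_zero
    (B := fun ε => ENNReal.ofReal (8 * C) ^ p * volume (shell n ε) / V) ?_ fun ε hε hε' => ?_
  · simpa using ENNReal.Tendsto.div_const
      (ENNReal.Tendsto.const_mul (tendsto_volume_shell (n := n)) (Or.inr hM)) (Or.inr hV0)
  · refine ENNReal.div_le_div ((energy_cutoff_le hC0 hC hε hp0).trans ?_)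
      (volume_ball_half_le_weighted_cutoff hε hε' (by linarith))
    gcongr ENNReal.ofReal ?_ ^ p * _
    exact mul_le_of_le_one_right (by positivity) (by linarith)

theorem iInf_uncertainty_quotient_eq_zero (hn : 0 < n) (hp : 1 < p) (hpn : p < n)
    (hs : -p + 1 < s) (hs1 : s ≤ 1) :
    ⨅ (f : Eu n → ℝ) (_ : IsTestFunction (unitBall n) f) (_ : f ≠ 0),
      energy (unitBall n) (berwald n) p f ^ (1 / p) *
        weighted (unitBall n) (berwald n) p (Real.conjExponent p * s) f ^
          (1 / Real.conjExponent p) /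
        weighted (unitBall n) (berwald n) p (s - 1) f = 0 := by
  obtain ⟨C, hC0, hC⟩ := exists_deriv_smoothTransition_le
  obtain ⟨A, hA, hW⟩ := exists_weighted_cutoff_rpow_le hn hp hpn hs hs1
  have hp0 : 0 < p := by linarith
  have hip : 0 < 1 / p := by positivity
  set V := volume (Metric.ball (0 : Eu n) (1 / 2))
  have hV0 : V ≠ 0 := (Metric.measure_ball_pos volume _ (by norm_num)).ne'
  have hM : ENNReal.ofReal (16 * C) * A ≠ ⊤ := ENNReal.mul_ne_top ENNReal.ofReal_ne_top hA
  refine iInf_testFunction_eq_zero (B := fun ε => ENNReal.ofReal (16 * C) * A *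
    volume (shell n ε) ^ (1 / p) / V) ?_ fun ε hε hε' => ?_
  · simpa [ENNReal.zero_rpow_of_pos hip, hp0] using ENNReal.Tendsto.div_const
      (ENNReal.Tendsto.const_mul ((tendsto_volume_shell (n := n)).ennrpow_const (1 / p))
        (Or.inr hM)) (Or.inr hV0)
  · refine ENNReal.div_le_div ?_ (volume_ball_half_le_weighted_cutoff hε hε' (by linarith))
    have hconst :
        ENNReal.ofReal (16 * C) = ENNReal.ofReal (8 * C * ε) * ENNReal.ofReal (2 / ε) := by
      rw [← ENNReal.ofReal_mul (by positivity)]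
      congr 1
      field_simp
      ring
    calc _ ≤ (ENNReal.ofReal (8 * C * ε) ^ p * volume (shell n ε)) ^ (1 / p) *
              (ENNReal.ofReal (2 / ε) * A) := by
          gcongr
          · exact energy_cutoff_le hC0 hC hε hp0
          · exact hW ε hε hε'
      _ = ENNReal.ofReal (16 * C) * A * volume (shell n ε) ^ (1 / p) := by
          rw [ENNReal.mul_rpow_of_nonneg _ _ hip.le, ← ENNReal.rpow_mul, mul_one_div_cancel hp0.ne',
            ENNReal.rpow_one, hconst]
          ring

end Quotients

/-! ### Weak differentials -/

section WeakDifferential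

variable {U : Set (Eu n)} {F : Eu n → Eu n → ℝ} {p : ℝ} {u u' φ : Eu n → ℝ}
  {ξ ξ' : Eu n → Eu n →L[ℝ] ℝ}

namespace IsTestFunction

lemma eq_zero_of_notMem (hφ : IsTestFunction U φ) {x : Eu n} (hx : x ∉ U) : φ x = 0 :=
  image_eq_zero_of_notMem_tsupport fun h => hx (hφ.tsupport_subset h)

lemma fderiv_apply (hφ : IsTestFunction U φ) (v : Eu n) :
    IsTestFunction U (fun x => fderiv ℝ φ x v) where
  smooth := (hφ.smooth.fderiv_right (by simp)).clm_apply contDiff_const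
  hasCompactSupport := hφ.hasCompactSupport.of_isClosed_subset (isClosed_tsupport _)
    (tsupport_fderiv_apply_subset ℝ v)
  tsupport_subset := (tsupport_fderiv_apply_subset ℝ v).trans hφ.tsupport_subset

lemma integrable_smul {W : Type*} [NormedAddCommGroup W] [NormedSpace ℝ W]
    (hφ : IsTestFunction U φ) {f : Eu n → W} (hf : LocallyIntegrableOn f U volume) :
    Integrable (fun x => φ x • f x) := by
  have hsupp : Function.support (fun x => φ x • f x) ⊆ tsupport φ :=
    (Function.support_smul_subset_left φ f).trans (subset_tsupport φ)
  rw [← integrableOn_iff_integrable_of_support_subset hsupp]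
  exact (hf.integrableOn_compact_subset hφ.tsupport_subset hφ.hasCompactSupport).continuousOn_smul
    hφ.smooth.continuous.continuousOn hφ.hasCompactSupport

lemma setIntegral_mul (hφ : IsTestFunction U φ) (f : Eu n → ℝ) :
    ∫ x in U, f x * φ x = ∫ x, f x * φ x :=
  setIntegral_eq_integral_of_forall_compl_eq_zero fun x hx => by
    rw [hφ.eq_zero_of_notMem hx, mul_zero]

end IsTestFunction

lemma hasWeakDifferential_of_contDiffOn (hU : IsOpen U) (hu : ContDiffOn ℝ 1 u U) :
    HasWeakDifferential U u (fderiv ℝ u) := by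
  have hl : LocallyIntegrableOn u U volume :=
    hu.continuousOn.locallyIntegrableOn hU.measurableSet
  have hd : LocallyIntegrableOn (fderiv ℝ u) U volume :=
    (hu.continuousOn_fderiv_of_isOpen hU le_rfl).locallyIntegrableOn hU.measurableSet
  refine ⟨hl, hd, fun φ hφ v => ?_⟩
  rw [(hφ.fderiv_apply v).setIntegral_mul, hφ.setIntegral_mul]
  refine integral_mul_fderiv_eq_neg_fderiv_mul_of_integrable ?_ ?_ ?_ (fun x hx => ?_)
    fun x _ => hφ.smooth.differentiable (by simp) x
  · simpa [mul_comm] using (hφ.integrable_smul hd).apply_continuousLinearMap v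
  · simpa [mul_comm] using (hφ.fderiv_apply v).integrable_smul hl
  · simpa [mul_comm] using hφ.integrable_smul hl
  · exact (hu.contDiffAt (hU.mem_nhds (hφ.tsupport_subset hx))).differentiableAt (by simp)

lemma HasWeakDifferential.congr (h : HasWeakDifferential U u ξ)
    (huu' : u =ᵐ[volume.restrict U] u') : HasWeakDifferential U u' ξ where
  locallyIntegrable := h.locallyIntegrable.congr huu'
  locallyIntegrable_differential := h.locallyIntegrable_differential
  integral_eq φ hφ v := by
    rw [← h.integral_eq φ hφ v]
    refine integral_congr_ae ?_
    filter_upwards [huu'] with x hx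
    rw [hx]

lemma HasWeakDifferential.ae_eq (hU : IsOpen U) (h : HasWeakDifferential U u ξ)
    (h' : HasWeakDifferential U u ξ') : ξ =ᵐ[volume.restrict U] ξ' := by
  have hloc : LocallyIntegrableOn (fun x => ξ x - ξ' x) U volume :=
    h.locallyIntegrable_differential.sub h'.locallyIntegrable_differential
  have hzero : ∀ᵐ x, x ∈ U → ξ x - ξ' x = 0 :=
    hU.ae_eq_zero_of_integral_contDiff_smul_eq_zero hloc fun g hg hgc hgU => by
      have hgt : IsTestFunction U g := ⟨hg, hgc, hgU⟩
      have hi := hgt.integrable_smul h.locallyIntegrable_differential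
      have hi' := hgt.integrable_smul h'.locallyIntegrable_differential
      simp only [smul_sub]
      rw [integral_sub hi hi', sub_eq_zero]
      ext v
      have hv : ∫ x, ξ x v * g x = ∫ x, ξ' x v * g x := by
        rw [← hgt.setIntegral_mul, ← hgt.setIntegral_mul, ← neg_inj, ← h.integral_eq g hgt v,
          h'.integral_eq g hgt v]
      rw [ContinuousLinearMap.integral_apply hi, ContinuousLinearMap.integral_apply hi']
      simpa [mul_comm] using hv
  filter_upwards [(ae_restrict_iff' hU.measurableSet).2 hzero] with x hx using sub_eq_zero.1 hx

lemma sobolevNorm_congr_ae (hu : u =ᵐ[volume.restrict U] u') (hξ : ξ =ᵐ[volume.restrict U] ξ') :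
    sobolevNorm U F p u ξ = sobolevNorm U F p u' ξ' := by
  unfold sobolevNorm
  congr 2
  · refine lintegral_congr_ae ?_
    filter_upwards [hu] with x hx
    rw [hx]
  · refine lintegral_congr_ae ?_
    filter_upwards [hξ] with x hx
    rw [hx]

theorem mk_mem_sobolevSpace_iff (hU : IsOpen U) (hu : ContDiffOn ℝ 1 u U)
    (hm : AEStronglyMeasurable u (volume.restrict U)) :
    AEEqFun.mk u hm ∈ sobolevSpace U F p ↔
      ∃ v : ℕ → Eu n → ℝ, (∀ k, IsTestFunction U (v k)) ∧
        Tendsto (fun k => sobolevNorm U F p (fun x => u x - v k x)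
          (fun x => fderiv ℝ u x - fderiv ℝ (v k) x)) atTop (𝓝 0) := by
  have hmk := AEEqFun.coeFn_mk u hm
  have hd := hasWeakDifferential_of_contDiffOn hU hu
  have hnorm : ∀ {ξ : Eu n → Eu n →L[ℝ] ℝ}, ξ =ᵐ[volume.restrict U] fderiv ℝ u → ∀ v,
      sobolevNorm U F p (fun x => AEEqFun.mk u hm x - v x) (fun x => ξ x - fderiv ℝ v x) =
        sobolevNorm U F p (fun x => u x - v x) (fun x => fderiv ℝ u x - fderiv ℝ v x) :=
    fun hξ v => sobolevNorm_congr_ae (hmk.sub .rfl) (hξ.sub .rfl)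
  constructor
  · rintro ⟨ξ, hξ, v, hv, hlim⟩
    exact ⟨v, hv, by simpa only [hnorm ((hξ.congr hmk).ae_eq hU hd)] using hlim⟩
  · rintro ⟨v, hv, hlim⟩
    exact ⟨fderiv ℝ u, hd.congr hmk.symm, v, hv, by simpa only [hnorm .rfl] using hlim⟩

lemma rpow_lintegral_rpow_le {g : Eu n → ℝ≥0∞} {c : ℝ≥0∞} (hp : 0 < p)
    (hU : MeasurableSet U) (h : ∀ x ∈ U, g x ≤ c) :
    (∫⁻ x in U, g x ^ p) ^ (1 / p) ≤ c * volume U ^ (1 / p) := by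
  have hi : 0 ≤ 1 / p := by positivity
  calc (∫⁻ x in U, g x ^ p) ^ (1 / p) ≤ (∫⁻ _ in U, c ^ p) ^ (1 / p) :=
        ENNReal.rpow_le_rpow
          (setLIntegral_mono' hU fun x hx => ENNReal.rpow_le_rpow (h x hx) hp.le) hi
    _ = c * volume U ^ (1 / p) := by
        rw [setLIntegral_const, ENNReal.mul_rpow_of_nonneg _ _ hi, ← ENNReal.rpow_mul,
          mul_one_div_cancel hp.ne', ENNReal.rpow_one]

end WeakDifferential

section CoMetric

variable {F : Eu n → Eu n → ℝ} {x : Eu n}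

lemma coMetric_le {η : Eu n →L[ℝ] ℝ} {M : ℝ} (hF : ∀ y, y ≠ 0 → 0 < F x y)
    (h : ∀ y, η y ≤ M * F x y) : coMetric F x η ≤ ENNReal.ofReal M :=
  iSup₂_le fun y hy => ENNReal.ofReal_le_ofReal ((div_le_iff₀ (hF y hy)).2 (h y))

lemma le_coMetric (F : Eu n → Eu n → ℝ) (x : Eu n) (η : Eu n →L[ℝ] ℝ) {y : Eu n} (hy : y ≠ 0) :
    ENNReal.ofReal (η y / F x y) ≤ coMetric F x η :=
  le_iSup₂_of_le y hy le_rfl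

end CoMetric

/-! ### A smooth truncation from below -/

/-- A smooth function that vanishes on `(-∞, 1]`, has slope one on `[2, ∞)` and slope between `0`
and `1` in between. -/
def softShift (s : ℝ) : ℝ := ∫ t in (0 : ℝ)..s, Real.smoothTransition (t - 1)

lemma hasDerivAt_softShift (s : ℝ) :
    HasDerivAt softShift (Real.smoothTransition (s - 1)) s := by
  have hc : Continuous fun t : ℝ => Real.smoothTransition (t - 1) :=
    Real.smoothTransition.continuous.comp (by fun_prop)
  exact (hc.integral_hasStrictDerivAt 0 s).hasDerivAt

lemma contDiff_softShift : ContDiff ℝ ∞ softShift := by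
  refine contDiff_infty_iff_deriv.2 ⟨fun s => (hasDerivAt_softShift s).differentiableAt, ?_⟩
  rw [funext fun s => (hasDerivAt_softShift s).deriv]
  exact (Real.smoothTransition.contDiff (n := ⊤)).comp (contDiff_id.sub contDiff_const)

lemma softShift_zero : softShift 0 = 0 := by simp [softShift]

lemma softShift_eq_zero {s : ℝ} (hs : s ≤ 1) : softShift s = 0 := by
  have h : ∀ t ∈ Set.Iic (1 : ℝ), HasDerivWithinAt softShift 0 (Set.Iic 1) t := fun t ht => by
    have := (hasDerivAt_softShift t).hasDerivWithinAt (s := Set.Iic 1)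
    rwa [Real.smoothTransition.zero_of_nonpos (sub_nonpos.2 ht)] at this
  rw [eq_of_hasDerivWithinAt_zero (convex_Iic 1) h (Set.mem_Iic.2 zero_le_one) (Set.mem_Iic.2 hs),
    softShift_zero]

lemma softShift_nonneg {s : ℝ} (hs : 0 ≤ s) : 0 ≤ softShift s :=
  intervalIntegral.integral_nonneg hs fun _ _ => Real.smoothTransition.nonneg _

lemma abs_sub_softShift_le {s : ℝ} (hs : 0 ≤ s) : |s - softShift s| ≤ 2 := by
  have hd : ∀ t, HasDerivAt (fun t => t - softShift t) (1 - Real.smoothTransition (t - 1)) t :=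
    fun t => (hasDerivAt_id t).sub (hasDerivAt_softShift t)
  have hmono : Monotone fun t => t - softShift t :=
    monotone_of_deriv_nonneg (fun t => (hd t).differentiableAt) fun t => by
      rw [(hd t).deriv, sub_nonneg]
      exact Real.smoothTransition.le_one _
  have h2 : 2 - softShift 2 ≤ 2 := by linarith [softShift_nonneg zero_le_two]
  rw [abs_of_nonneg (by simpa [softShift_zero] using hmono hs)]
  rcases le_total s 2 with h | h
  · exact (hmono h).trans h2
  · have hconst : ∀ t ∈ Set.Ici (2 : ℝ),
        HasDerivWithinAt (fun t => t - softShift t) 0 (Set.Ici 2) t := fun t ht => by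
      have := (hd t).hasDerivWithinAt (s := Set.Ici 2)
      rwa [Real.smoothTransition.one_of_one_le (by linarith [Set.mem_Ici.1 ht]), sub_self] at this
    exact (eq_of_hasDerivWithinAt_zero (convex_Ici 2) hconst Set.self_mem_Ici
      (Set.mem_Ici.2 h)).le.trans h2

/-! ### The Sobolev space is not symmetric -/

section BallPow

variable {α δ p : ℝ} {x : Eu n}

/-- The power `(1 - |x|²)₊ ^ α` of the defining function of the ball. -/
def ballPow (n : ℕ) (α : ℝ) (x : Eu n) : ℝ := max (1 - ‖x‖ ^ 2) 0 ^ α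

/-- Smooth truncations, vanishing near the sphere, of `-(1 - |x|²)₊ ^ α`. Truncating the values
rather than multiplying by a cut-off function makes the differential of the error a non-negative
multiple of that of `-(1 - |x|²) ^ α`, so that it points outwards. -/
def truncation (n : ℕ) (α δ : ℝ) (x : Eu n) : ℝ := -(δ * softShift (ballPow n α x / δ))

lemma ballPow_nonneg (α : ℝ) (x : Eu n) : 0 ≤ ballPow n α x :=
  Real.rpow_nonneg (le_max_right _ _) _

lemma ballPow_eq (hx : ‖x‖ < 1) : ballPow n α x = (1 - ‖x‖ ^ 2) ^ α := by
  rw [ballPow, max_eq_left (one_sub_norm_sq_pos hx).le]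

lemma ballPow_eq_zero (hα : 0 < α) (hx : 1 ≤ ‖x‖) : ballPow n α x = 0 := by
  rw [ballPow, max_eq_right (by nlinarith), Real.zero_rpow hα.ne']

lemma continuous_ballPow (hα : 0 ≤ α) : Continuous (ballPow n α) :=
  Continuous.rpow_const (by fun_prop) fun _ => Or.inr hα

lemma ballPow_eventuallyEq (hx : ‖x‖ < 1) :
    ballPow n α =ᶠ[𝓝 x] fun z => (1 - ‖z‖ ^ 2) ^ α := by
  filter_upwards [Metric.isOpen_ball.mem_nhds (mem_ball_zero_iff.2 hx)] with z hz
  exact ballPow_eq (mem_ball_zero_iff.1 hz)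

lemma contDiffAt_ballPow (hx : ‖x‖ < 1) : ContDiffAt ℝ ∞ (ballPow n α) x :=
  ((contDiffAt_const.sub (contDiffAt_id.norm_sq ℝ)).rpow_const_of_ne
    (one_sub_norm_sq_pos hx).ne').congr_of_eventuallyEq (ballPow_eventuallyEq hx)

lemma contDiffOn_ballPow (α : ℝ) : ContDiffOn ℝ 1 (ballPow n α) (unitBall n) := fun _ hx =>
  ((contDiffAt_ballPow (mem_ball_zero_iff.1 hx)).of_le
    (WithTop.coe_le_coe.2 le_top)).contDiffWithinAt

lemma fderiv_ballPow (hx : ‖x‖ < 1) (y : Eu n) :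
    fderiv ℝ (ballPow n α) x y = -(2 * α * (1 - ‖x‖ ^ 2) ^ (α - 1) * inner ℝ x y) := by
  have h : HasFDerivAt (fun z : Eu n => (1 - ‖z‖ ^ 2) ^ α) _ x :=
    ((hasFDerivAt_id x).norm_sq.const_sub 1).rpow_const (Or.inl (one_sub_norm_sq_pos hx).ne')
  rw [(ballPow_eventuallyEq hx).fderiv_eq, h.fderiv]
  simp only [id_eq, ContinuousLinearMap.comp_id, smul_neg, neg_apply, smul_apply,
    coe_innerSL_apply, nsmul_eq_mul, Nat.cast_ofNat, smul_eq_mul, neg_inj]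
  ring

lemma isTestFunction_truncation (hα : 0 < α) (hδ : 0 < δ) :
    IsTestFunction (unitBall n) (truncation n α δ) := by
  have hzero : ∀ x, ballPow n α x ≤ δ → truncation n α δ x = 0 := fun x hx => by
    rw [truncation, softShift_eq_zero ((div_le_one hδ).2 hx), mul_zero, neg_zero]
  have hsub : tsupport (truncation n α δ) ⊆ {x | δ ≤ ballPow n α x} := by
    refine closure_minimal (fun x hx => ?_)
      (isClosed_le continuous_const (continuous_ballPow hα.le))
    by_contra h
    exact hx (hzero x (not_le.1 h).le)
  have hball : tsupport (truncation n α δ) ⊆ unitBall n := fun x hx => by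
    rw [mem_ball_zero_iff]
    by_contra! h
    have h1 : δ ≤ ballPow n α x := hsub hx
    rw [ballPow_eq_zero hα h] at h1
    linarith
  have hsmooth : ContDiff ℝ ∞ (truncation n α δ) :=
    contMDiff_iff_contDiff.1 <| contMDiff_of_tsupport fun x hx =>
      (contDiffAt_const.mul (contDiff_softShift.contDiffAt.comp x
        ((contDiffAt_ballPow (mem_ball_zero_iff.1 (hball hx))).div_const δ))).neg.contMDiffAt
  exact ⟨hsmooth, (isCompact_closedBall (0 : Eu n) 1).of_isClosed_subset
    (isClosed_tsupport _) (hball.trans Metric.ball_subset_closedBall), hball⟩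

lemma fderiv_truncation (hδ : 0 < δ) (hx : ‖x‖ < 1) (y : Eu n) :
    fderiv ℝ (truncation n α δ) x y =
      -(Real.smoothTransition (ballPow n α x / δ - 1) * fderiv ℝ (ballPow n α) x y) := by
  have h1 := ((contDiffAt_ballPow (α := α) hx).differentiableAt (by simp)).hasFDerivAt
  have h2 := (hasDerivAt_softShift (ballPow n α x / δ)).comp_hasFDerivAt x (h1.mul_const δ⁻¹)
  have h3 : HasFDerivAt (truncation n α δ) _ x := (h2.const_mul δ).neg
  rw [h3.fderiv]
  simp only [neg_apply, smul_apply, smul_eq_mul]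
  field_simp

lemma enorm_neg_ballPow_sub_truncation_le (hδ : 0 < δ) (x : Eu n) :
    ‖-ballPow n α x - truncation n α δ x‖ₑ ≤ ENNReal.ofReal (2 * δ) := by
  have h := abs_sub_softShift_le (div_nonneg (ballPow_nonneg α x) hδ.le)
  have heq : -ballPow n α x - truncation n α δ x =
      -(δ * (ballPow n α x / δ - softShift (ballPow n α x / δ))) := by
    rw [truncation]
    field_simp
    ring
  rw [← ofReal_norm, heq, norm_neg, norm_mul, Real.norm_of_nonneg hδ.le, Real.norm_eq_abs,
    mul_comm]
  gcongr

lemma one_sub_smoothTransition_mul_le (hδ : 0 < δ) {t : ℝ} (ht : 0 ≤ t) :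
    (1 - Real.smoothTransition (t / δ - 1)) * t ≤ 2 * δ := by
  rcases le_total t (2 * δ) with h | h
  · exact (mul_le_of_le_one_left ht (sub_le_self _ (Real.smoothTransition.nonneg _))).trans h
  · rw [Real.smoothTransition.one_of_one_le (by rw [le_sub_iff_add_le, le_div_iff₀ hδ]; linarith),
      sub_self, zero_mul]
    positivity

lemma coMetric_neg_ballPow_sub_truncation_le (hα : 0 < α) (hα1 : α ≤ 1) (hδ : 0 < δ)
    (hx : ‖x‖ < 1) :
    coMetric (berwald n) x (fderiv ℝ (fun z => -ballPow n α z) x - fderiv ℝ (truncation n α δ) x) ≤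
      ENNReal.ofReal (4 * δ) := by
  refine coMetric_le (fun y hy => berwald_pos hx hy) fun y => ?_
  have hc := one_sub_norm_sq_pos hx
  have hc1 : 1 - ‖x‖ ^ 2 ≤ 1 := sub_le_self _ (sq_nonneg _)
  have hB := berwald_nonneg hx y
  set S := Real.smoothTransition (ballPow n α x / δ - 1)
  have hS : 0 ≤ 1 - S := sub_nonneg.2 (Real.smoothTransition.le_one _)
  have hmul : (1 - ‖x‖ ^ 2) ^ (α - 1) * (1 - ‖x‖ ^ 2) ^ 2 = (1 - ‖x‖ ^ 2) * ballPow n α x := by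
    rw [ballPow_eq hx, Real.rpow_sub_one hc.ne']
    field_simp
  have herr0 : 0 ≤ (1 - S) * ballPow n α x := mul_nonneg hS (ballPow_nonneg α x)
  calc (fderiv ℝ (fun z => -ballPow n α z) x - fderiv ℝ (truncation n α δ) x) y
      = (1 - S) * (2 * α * (1 - ‖x‖ ^ 2) ^ (α - 1)) * inner ℝ x y := by
        rw [sub_apply, fderiv_fun_neg, neg_apply, fderiv_truncation hδ hx, fderiv_ballPow hx]
        ring
    _ ≤ (1 - S) * (2 * α * (1 - ‖x‖ ^ 2) ^ (α - 1)) * ((1 - ‖x‖ ^ 2) ^ 2 * berwald n x y) := by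
        refine mul_le_mul_of_nonneg_left (inner_le_mul_berwald hx y) (mul_nonneg hS ?_)
        exact mul_nonneg (by positivity) (Real.rpow_nonneg hc.le _)
    _ = 2 * (α * (1 - ‖x‖ ^ 2)) * ((1 - S) * ballPow n α x) * berwald n x y := by
        linear_combination (1 - S) * (2 * α) * berwald n x y * hmul
    _ ≤ 2 * 1 * (2 * δ) * berwald n x y := by
        gcongr 2 * ?_ * ?_ * _
        · exact mul_le_one₀ hα1 hc.le hc1
        · exact one_sub_smoothTransition_mul_le hδ (ballPow_nonneg α x)
    _ = 4 * δ * berwald n x y := by ring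

lemma mk_neg_ballPow_mem_sobolevSpace (hα : 0 < α) (hα1 : α ≤ 1) (hp : 0 < p)
    (hm : AEStronglyMeasurable (fun x => -ballPow n α x) (volume.restrict (unitBall n))) :
    AEEqFun.mk (fun x => -ballPow n α x) hm ∈ sobolevSpace (unitBall n) (berwald n) p := by
  refine (mk_mem_sobolevSpace_iff Metric.isOpen_ball (contDiffOn_ballPow α).neg hm).2 ?_
  obtain ⟨δ, -, hδ, hδ0⟩ := exists_seq_strictAnti_tendsto (0 : ℝ)
  refine ⟨fun k => truncation n α (δ k), fun k => isTestFunction_truncation hα (hδ k), ?_⟩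
  set V := volume (unitBall n) ^ (1 / p)
  have hV : V ≠ ⊤ := ENNReal.rpow_ne_top_of_nonneg (by positivity) measure_ball_lt_top.ne
  have hlim : ∀ c : ℝ, Tendsto (fun k => ENNReal.ofReal (c * δ k) * V) atTop (𝓝 0) := fun c => by
    simpa using ENNReal.Tendsto.mul_const (ENNReal.tendsto_ofReal (hδ0.const_mul c)) (Or.inr hV)
  have hsum := (hlim 2).add (hlim 4)
  rw [add_zero] at hsum
  refine tendsto_of_tendsto_of_tendsto_of_le_of_le tendsto_const_nhds hsum
    (fun _ => zero_le) fun k => add_le_add ?_ ?_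
  · exact rpow_lintegral_rpow_le hp measurableSet_ball fun x _ =>
      enorm_neg_ballPow_sub_truncation_le (hδ k) x
  · exact rpow_lintegral_rpow_le hp measurableSet_ball fun x hx =>
      coMetric_neg_ballPow_sub_truncation_le hα hα1 (hδ k) (mem_ball_zero_iff.1 hx)

lemma ofReal_le_coMetric_fderiv_ballPow (hα : 0 ≤ α) (hx : ‖x‖ < 1) (hx2 : 1 / 2 ≤ ‖x‖) :
    ENNReal.ofReal (α * (1 - ‖x‖ ^ 2) ^ (α - 1)) ≤
      coMetric (berwald n) x (fderiv ℝ (ballPow n α) x) := by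
  have hpos : 0 < ‖x‖ := by linarith
  have hpow : 0 ≤ α * (1 - ‖x‖ ^ 2) ^ (α - 1) :=
    mul_nonneg hα (Real.rpow_nonneg (one_sub_norm_sq_pos hx).le _)
  calc ENNReal.ofReal (α * (1 - ‖x‖ ^ 2) ^ (α - 1))
      ≤ ENNReal.ofReal (α * (1 - ‖x‖ ^ 2) ^ (α - 1) * (2 * ‖x‖ * (1 + ‖x‖) ^ 2)) :=
        ENNReal.ofReal_le_ofReal (le_mul_of_one_le_right hpow (by nlinarith))
    _ = ENNReal.ofReal (fderiv ℝ (ballPow n α) x (-x) / berwald n x (-x)) := by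
        rw [fderiv_ballPow hx, inner_neg_right, real_inner_self_eq_norm_sq, berwald_neg_self hx]
        congr 1
        field_simp
    _ ≤ coMetric (berwald n) x (fderiv ℝ (ballPow n α) x) :=
        le_coMetric _ _ _ (neg_ne_zero.2 (norm_pos_iff.1 hpos))

/-- The exponent `α = 1 - 1 / p` is the one for which `|d(1 - |x|²) ^ α| ^ p` is of order
`(1 - |x|)⁻¹`. -/
lemma ofReal_mul_le_coMetric_fderiv_ballPow_rpow (hp : 1 < p) (hx : ‖x‖ < 1)
    (hx2 : 1 / 2 ≤ ‖x‖) :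
    ENNReal.ofReal ((1 - 1 / p) ^ p / 2) * ENNReal.ofReal (1 - ‖x‖)⁻¹ ≤
      coMetric (berwald n) x (fderiv ℝ (ballPow n (1 - 1 / p)) x) ^ p := by
  have hp0 : 0 < p := by linarith
  have hα : 0 < 1 - 1 / p := by rwa [sub_pos, div_lt_one hp0]
  have hc := one_sub_norm_sq_pos hx
  have hc' : 0 < 1 - ‖x‖ := by linarith
  have hpow : 0 < (1 - ‖x‖ ^ 2) ^ (1 - 1 / p - 1) := Real.rpow_pos_of_pos hc _
  have hexp : (1 - 1 / p - 1) * p = -1 := by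
    field_simp
    ring
  have hinv : (1 - ‖x‖)⁻¹ / 2 ≤ (1 - ‖x‖ ^ 2)⁻¹ := by
    rw [inv_eq_one_div, inv_eq_one_div, div_div, div_le_div_iff₀ (mul_pos hc' two_pos) hc]
    nlinarith
  calc ENNReal.ofReal ((1 - 1 / p) ^ p / 2) * ENNReal.ofReal (1 - ‖x‖)⁻¹
      = ENNReal.ofReal ((1 - 1 / p) ^ p * ((1 - ‖x‖)⁻¹ / 2)) := by
        rw [← ENNReal.ofReal_mul (by positivity), div_mul_eq_mul_div, mul_div_assoc]
    _ ≤ ENNReal.ofReal ((1 - 1 / p) ^ p * (1 - ‖x‖ ^ 2)⁻¹) := by gcongr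
    _ = ENNReal.ofReal ((1 - 1 / p) * (1 - ‖x‖ ^ 2) ^ (1 - 1 / p - 1)) ^ p := by
        rw [ENNReal.ofReal_rpow_of_nonneg (by positivity) hp0.le, Real.mul_rpow hα.le hpow.le,
          ← Real.rpow_mul hc.le, hexp, Real.rpow_neg_one]
    _ ≤ coMetric (berwald n) x (fderiv ℝ (ballPow n (1 - 1 / p)) x) ^ p :=
        ENNReal.rpow_le_rpow (ofReal_le_coMetric_fderiv_ballPow hα.le hx hx2) hp0.le

lemma measurableSet_annulus (R : ℝ) : MeasurableSet (unitBall n ∩ {x | R < ‖x‖}) :=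
  measurableSet_ball.inter (measurableSet_lt measurable_const measurable_norm)

lemma lintegral_inv_one_sub_norm_eq_top (hn : 0 < n) {R : ℝ} (hR0 : 0 < R) (hR : R < 1) :
    ∫⁻ x in unitBall n ∩ {x | R < ‖x‖}, ENNReal.ofReal (1 - ‖x‖)⁻¹ = ⊤ := by
  by_contra hne
  have : Nonempty (Fin n) := ⟨⟨0, hn⟩⟩
  have hA : MeasurableSet {x : Eu n | R < ‖x‖} := measurableSet_lt measurable_const measurable_norm
  have hmeas : Measurable fun x : Eu n => (1 - ‖x‖)⁻¹ := (measurable_norm.const_sub 1).inv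
  have hint : IntegrableOn (fun x : Eu n => (1 - ‖x‖)⁻¹) (unitBall n ∩ {x | R < ‖x‖}) := by
    refine (lintegral_ofReal_ne_top_iff_integrable hmeas.aestronglyMeasurable ?_).1 hne
    filter_upwards [ae_restrict_mem (measurableSet_annulus R)] with x hx
    exact inv_nonneg.2 (by linarith [mem_ball_zero_iff.1 hx.1])
  have hradial : IntegrableOn
      (fun x : Eu n => (Set.Ioi R).indicator (fun t : ℝ => (1 - t)⁻¹) ‖x‖) (unitBall n) := by
    change IntegrableOn ({x : Eu n | R < ‖x‖}.indicator fun x => (1 - ‖x‖)⁻¹) (unitBall n)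
    rwa [IntegrableOn, integrable_indicator_iff hA, IntegrableOn, Measure.restrict_restrict hA,
      Set.inter_comm]
  rw [integrableOn_fun_norm_addHaar] at hradial
  have hline : IntegrableOn (fun t : ℝ => (t - 1)⁻¹) (Set.Ioo R 1) := by
    refine Integrable.mono' ((hradial.mono_set (Set.Ioo_subset_Ioo_left hR0.le)).const_mul
      ((R ^ (Module.finrank ℝ (Eu n) - 1))⁻¹)) (by fun_prop) ?_
    filter_upwards [ae_restrict_mem measurableSet_Ioo] with t ht
    have ht1 : 0 < 1 - t := by linarith [ht.2]
    rw [Set.indicator_of_mem (Set.mem_Ioi.2 ht.1), norm_inv, Real.norm_eq_abs, abs_sub_comm,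
      abs_of_pos ht1, smul_eq_mul, ← mul_assoc]
    refine le_mul_of_one_le_left (inv_nonneg.2 ht1.le) ?_
    rw [← div_eq_inv_mul, one_le_div (by positivity)]
    exact pow_le_pow_left₀ hR0.le ht.1.le _
  rw [← intervalIntegrable_iff_integrableOn_Ioo_of_le hR.le, intervalIntegrable_sub_inv_iff]
    at hline
  exact hline.elim hR.ne fun h => h Set.right_mem_uIcc

lemma lintegral_coMetric_fderiv_ballPow_eq_top (hn : 0 < n) (hp : 1 < p) {R : ℝ}
    (hR : 1 / 2 ≤ R) (hR1 : R < 1) :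
    ∫⁻ x in unitBall n ∩ {x | R < ‖x‖},
      coMetric (berwald n) x (fderiv ℝ (ballPow n (1 - 1 / p)) x) ^ p = ⊤ := by
  have hα : 0 < 1 - 1 / p := by rwa [sub_pos, div_lt_one (by linarith)]
  have hpow : ENNReal.ofReal ((1 - 1 / p) ^ p / 2) ≠ 0 :=
    (ENNReal.ofReal_pos.2 (by positivity)).ne'
  rw [eq_top_iff]
  calc (⊤ : ℝ≥0∞) = ∫⁻ x in unitBall n ∩ {x | R < ‖x‖},
          ENNReal.ofReal ((1 - 1 / p) ^ p / 2) * ENNReal.ofReal (1 - ‖x‖)⁻¹ := by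
        rw [lintegral_const_mul' _ _ ENNReal.ofReal_ne_top,
          lintegral_inv_one_sub_norm_eq_top hn (by linarith) hR1, ENNReal.mul_top hpow]
    _ ≤ _ := setLIntegral_mono' (measurableSet_annulus R) fun x hx =>
        ofReal_mul_le_coMetric_fderiv_ballPow_rpow hp (mem_ball_zero_iff.1 hx.1)
          (hR.trans hx.2.le)

lemma mk_ballPow_notMem_sobolevSpace (hn : 0 < n) (hp : 1 < p)
    (hm : AEStronglyMeasurable (ballPow n (1 - 1 / p)) (volume.restrict (unitBall n))) :
    AEEqFun.mk (ballPow n (1 - 1 / p)) hm ∉ sobolevSpace (unitBall n) (berwald n) p := by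
  rw [mk_mem_sobolevSpace_iff Metric.isOpen_ball (contDiffOn_ballPow _) hm]
  rintro ⟨v, hv, hlim⟩
  obtain ⟨k, hk⟩ := (hlim.eventually (eventually_lt_nhds one_pos)).exists
  obtain ⟨R, hR, hsub⟩ := exists_lt_subset_ball (isClosed_tsupport (v k)) (hv k).tsupport_subset
  have hv0 : ∀ x : Eu n, R < ‖x‖ → fderiv ℝ (v k) x = 0 := fun x hx =>
    fderiv_of_notMem_tsupport ℝ fun hm => hx.not_gt (mem_ball_zero_iff.1 (hsub hm))
  have htop : ∫⁻ x in unitBall n, coMetric (berwald n) x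
      (fderiv ℝ (ballPow n (1 - 1 / p)) x - fderiv ℝ (v k) x) ^ p = ⊤ := by
    rw [eq_top_iff, ← lintegral_coMetric_fderiv_ballPow_eq_top hn hp (le_max_right R (1 / 2))
      (max_lt hR (by norm_num))]
    refine (setLIntegral_mono' (measurableSet_annulus _) fun x hx => ?_).trans
      (lintegral_mono_set Set.inter_subset_left)
    rw [hv0 x ((le_max_left _ _).trans_lt hx.2), sub_zero]
  rw [sobolevNorm, htop, ENNReal.top_rpow_of_pos (by positivity), add_top] at hk
  exact not_top_lt hk

end BallPow

theorem not_exists_submodule_eq_sobolevSpace (hn : 0 < n) {p : ℝ} (hp : 1 < p) :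
    ¬ ∃ S : Submodule ℝ (Eu n →ₘ[volume.restrict (unitBall n)] ℝ),
      (S : Set (Eu n →ₘ[volume.restrict (unitBall n)] ℝ)) =
        sobolevSpace (unitBall n) (berwald n) p := by
  rintro ⟨S, hS⟩
  have hp0 : 0 < p := by linarith
  have hα : 0 < 1 - 1 / p := by rwa [sub_pos, div_lt_one hp0]
  have hα1 : 1 - 1 / p ≤ 1 := sub_le_self _ (by positivity)
  have hm : AEStronglyMeasurable (ballPow n (1 - 1 / p)) (volume.restrict (unitBall n)) :=
    (continuous_ballPow hα.le).aestronglyMeasurable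
  have hneg : -AEEqFun.mk (ballPow n (1 - 1 / p)) hm ∈ S := by
    rw [← SetLike.mem_coe, hS, AEEqFun.neg_mk]
    exact mk_neg_ballPow_mem_sobolevSpace hα hα1 hp0 hm.neg
  have hpos : AEEqFun.mk (ballPow n (1 - 1 / p)) hm ∈ S := neg_mem_iff.1 hneg
  rw [← SetLike.mem_coe, hS] at hpos
  exact mk_ballPow_notMem_sobolevSpace hn hp hm hpos

end Finsler

end

theorem theorem1p1 (n : ℕ) (hn : 2 ≤ n) :
    Finsler.IsCartanHadamard (Finsler.unitBall n) (Finsler.berwald n) ∧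
    Finsler.IsFlat (Finsler.unitBall n) (Finsler.berwald n) ∧
    -- (i) infinite reversibility, no isometric embedding into a Minkowski space
    (Finsler.reversibility (Finsler.unitBall n) (Finsler.berwald n) = ⊤ ∧
      ∀ (V : Type*) [NormedAddCommGroup V] [NormedSpace ℝ V] [FiniteDimensional ℝ V] (φ : V → ℝ),
        Finsler.IsMinkowskiNorm φ →
          ¬ ∃ f, Finsler.IsIsometricEmbedding (Finsler.unitBall n) (Finsler.berwald n) φ f) ∧
    -- (ii) the Sobolev space is not a vector space
    (∀ p : ℝ, 1 < p →
      ¬ ∃ S : Submodule ℝ (Finsler.Eu n →ₘ[volume.restrict (Finsler.unitBall n)] ℝ),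
        (S : Set (Finsler.Eu n →ₘ[volume.restrict (Finsler.unitBall n)] ℝ)) =
          Finsler.sobolevSpace (Finsler.unitBall n) (Finsler.berwald n) p) ∧
    -- (iii) the Hardy quotient is well-defined and has infimum zero
    (∀ p : ℝ, 1 < p → p < n →
      (∀ f, Finsler.IsTestFunction (Finsler.unitBall n) f → f ≠ 0 →
        Finsler.energy (Finsler.unitBall n) (Finsler.berwald n) p f < ⊤ ∧
        0 < Finsler.weighted (Finsler.unitBall n) (Finsler.berwald n) p (-p) f ∧
        Finsler.weighted (Finsler.unitBall n) (Finsler.berwald n) p (-p) f < ⊤) ∧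
      (⨅ (f : Finsler.Eu n → ℝ) (_ : Finsler.IsTestFunction (Finsler.unitBall n) f) (_ : f ≠ 0),
        Finsler.energy (Finsler.unitBall n) (Finsler.berwald n) p f /
          Finsler.weighted (Finsler.unitBall n) (Finsler.berwald n) p (-p) f) = 0) ∧
    -- (iv) the uncertainty quotient is well-defined and has infimum zero
    (∀ p s : ℝ, -p + 1 < s → s ≤ 1 → 1 < p → p < n →
      (∀ f, Finsler.IsTestFunction (Finsler.unitBall n) f → f ≠ 0 →
        Finsler.energy (Finsler.unitBall n) (Finsler.berwald n) p f < ⊤ ∧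
        Finsler.weighted (Finsler.unitBall n) (Finsler.berwald n) p
          (Real.conjExponent p * s) f < ⊤ ∧
        0 < Finsler.weighted (Finsler.unitBall n) (Finsler.berwald n) p (s - 1) f ∧
        Finsler.weighted (Finsler.unitBall n) (Finsler.berwald n) p (s - 1) f < ⊤) ∧
      (⨅ (f : Finsler.Eu n → ℝ) (_ : Finsler.IsTestFunction (Finsler.unitBall n) f) (_ : f ≠ 0),
        Finsler.energy (Finsler.unitBall n) (Finsler.berwald n) p f ^ (1 / p) *
            Finsler.weighted (Finsler.unitBall n) (Finsler.berwald n) p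
              (Real.conjExponent p * s) f ^ (1 / Real.conjExponent p) /
          Finsler.weighted (Finsler.unitBall n) (Finsler.berwald n) p (s - 1) f) = 0) := by
  have hn0 : 0 < n := by omega
  refine ⟨Finsler.isCartanHadamard_berwald, Finsler.isFlat_berwald,
    ⟨Finsler.reversibility_berwald hn0, fun V _ _ _ φ hφ =>
      Finsler.not_exists_isIsometricEmbedding hn0 hφ⟩,
    fun p hp => Finsler.not_exists_submodule_eq_sobolevSpace hn0 hp,
    fun p hp hpn => ⟨fun f hf hf0 => ?_, Finsler.iInf_hardy_quotient_eq_zero hp⟩,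
    fun p s hs hs1 hp hpn => ⟨fun f hf hf0 => ?_,
      Finsler.iInf_uncertainty_quotient_eq_zero hn0 hp hpn hs hs1⟩⟩
  · exact ⟨Finsler.energy_berwald_lt_top (by linarith) hf,
      Finsler.weighted_berwald_pos (by linarith) (by linarith) hf hf0,
      Finsler.weighted_berwald_lt_top hn0 (by linarith) (by linarith) hf⟩
  · have hq : -(n : ℝ) < Real.conjExponent p * s :=
      (neg_lt_neg hpn).trans (Finsler.neg_lt_conjExponent_mul hp hs)
    exact ⟨Finsler.energy_berwald_lt_top (by linarith) hf,
      Finsler.weighted_berwald_lt_top hn0 (by linarith) hq hf,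
      Finsler.weighted_berwald_pos (by linarith) (by linarith) hf hf0,
      Finsler.weighted_berwald_lt_top hn0 (by linarith) (by linarith) hf⟩
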